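/- Let $W$ be a vector space over $\mathbb C$ and put $\mathcal E^o(W)=\mathrm{Hom}(W,W((x^{-1})))$, with $1_W\in\mathcal E^o(W)$ the identity operator. A finite sequence $a_1,\dots,a_r$ in $\mathcal E^o(W)$ is *compatible* (resp. *quasi-compatible*) if for some $k\in\mathbb N$ and $p(x,y)=(x-y)^k$ (resp. for some nonzero polynomial $p(x,y)$), $$\Big(\prod_{1\le i<j\le r}p(x_i,x_j)\Big)a_1(x_1)\cdots a_r(x_r)\in \mathrm{Hom}\big(W,W((x_1^{-1},\dots,x_r^{-1}))\big),$$ and a subset of $\mathcal E^o(W)$ is (quasi-)compatible if every finite sequence in it is. For a quasi-compatible pair $(a,b)$ define $a(x)_nb(x)\in\mathcal E^o(W)$ by $$Y_{\mathcal E^o}(a(x),x_0)b(x)=\sum_{n\in\mathbb Z}a(x)_nb(x)\,x_0^{-n-1}=\iota_{x,\infty;x_0,0}\big(1/p(x_0+x,x)\big)\,\big(p(x_1,x)a(x_1)b(x)\big)\big|_{x_1=x+x_0},$$ where $p$ is any nonzero polynomial with $p(x_1,x_2)a(x_1)b(x_2)\in\mathrm{Hom}(W,W((x_1^{-1},x_2^{-1})))$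 and $\iota_{x,\infty;x_0,0}$ is the embedding of $\mathbb C(x,x_0)$ into $\mathbb C((x^{-1}))((x_0))$. A quasi-compatible subspace $S$ is *closed* if $a(x)_nb(x)\in S$ for all $a,b\in S$, $n\in\mathbb Z$. A subset $U\subset\mathcal E^o(W)$ is *$\mathcal S$-local* if for all $a,b\in U$ there are finitely many $u^{(i)},v^{(i)}\in U$, $f_i\in\mathbb C(x)$ $(1\le i\le r)$ and $k\in\mathbb N$ with $$(x_1-x_2)^ka(x_1)b(x_2)=(x_1-x_2)^k\sum_{i=1}^r\iota_{x,\infty}(f_i)(-x_1+x_2)\,u^{(i)}(x_2)v^{(i)}(x_1),$$ where $\iota_{x,\infty}:\mathbb C(x)\to\mathbb C((x^{-1}))$ is the expansion at infinity and powers of $-x_1+x_2$ are expanded in nonnegative powers of $x_2$. A *nonlocal vertex algebra* is a vector space $V$ with a vector $\mathbf 1$ and a linear map $Y:V\to\mathrm{Hom}(V,V((x)))$ such that (V) $Y(\mathbf 1,x)v=v$, $Y(v,x)\mathbf 1\in V[[x]]$ and $\lim_{x\to0}Y(v,x)\mathbf 1=v$ for all $v\in V$, and such that for all $u,v,w\in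 V$ there is $l\in\mathbb N$ with $(x_0+x_2)^lY(u,x_0+x_2)Y(v,x_2)w=(x_0+x_2)^lY(Y(u,x_0)v,x_2)w$. A *weak quantum vertex algebra* is $(V,Y,\mathbf 1)$ as above satisfying (V) and such that for all $u,v\in V$ there are finitely many $u^{(i)},v^{(i)}\in V$, $f_i\in\mathbb C((x))$ with $$x_0^{-1}\delta\Big(\tfrac{x_1-x_2}{x_0}\Big)Y(u,x_1)Y(v,x_2)-x_0^{-1}\delta\Big(\tfrac{x_2-x_1}{-x_0}\Big)\sum_if_i(-x_0)Y(v^{(i)},x_2)Y(u^{(i)},x_1)=x_2^{-1}\delta\Big(\tfrac{x_1-x_0}{x_2}\Big)Y(Y(u,x_0)v,x_2).$$ A *module-at-infinity* for a nonlocal vertex algebra $V$ is a vector space $W$ with a linear map $Y_W:V\to\mathrm{Hom}(W,W((x^{-1})))$ such that $Y_W(\mathbf 1,x)=1_W$ and for all $u,v\in V$ there is $k\in\mathbb N$ with $(x_1-x_2)^kY_W(u,x_1)Y_W(v,x_2)\in\mathrm{Hom}(W,W((x_1^{-1},x_2^{-1})))$ and $$x_0^kY_W(Y(u,x_0)v,x_2)=\big((x_1-x_2)^kY_W(u,x_1)Y_W(v,x_2)\big)\big|_{x_1=x_2+x_0}.$$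 **Theorem.** Let $U$ be an $\mathcal S$-local subset of $\mathcal E^o(W)$. Then $U$ is compatible; there is a smallest closed quasi-compatible subspace $\langle U\rangle$ of $\mathcal E^o(W)$ containing $U$ and $1_W$; and $(\langle U\rangle,Y_{\mathcal E^o},1_W)$ is a nonlocal vertex algebra and a weak quantum vertex algebra, with $W$ as a module-at-infinity via $Y_W(\alpha(x),x_0)=\alpha(x_0)$ for $\alpha(x)\in\langle U\rangle$. -/

import Mathlib

noncomputable section

namespace VAInf

/-! ### Formal series in several commuting variables -/

/-- Doubly infinite formal series in `r` commuting variables with coefficients in `M`: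
`F e` is the coefficient of the monomial `∏ i, x_i ^ (e i)`. -/
abbrev FDist (r : ℕ) (M : Type*) := (Fin r → ℤ) → M

/-- Multiplication of a formal series by a polynomial in the same variables. -/
def polyMul {r : ℕ} {M : Type*} [AddCommGroup M] [Module ℂ M]
    (P : MvPolynomial (Fin r) ℂ) (F : FDist r M) : FDist r M :=
  fun e => ∑ d ∈ P.support, P.coeff d • F (fun i => e i - (d i : ℤ))

/-- The product of a scalar formal series and an `M`-valued formal series. It is only used where
all the sums that define the coefficients have finitely many nonzero terms. -/
def seriesMul {r : ℕ} {M : Type*} [AddCommGroup M] [Module ℂ M]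
    (c : FDist r ℂ) (F : FDist r M) : FDist r M :=
  fun e => ∑ᶠ d : Fin r → ℤ, c d • F (e - d)

/-- Apply an operator-valued formal series to a vector. -/
def appVec {r : ℕ} {M : Type*} [AddCommGroup M] [Module ℂ M]
    (F : FDist r (Module.End ℂ M)) (w : M) : FDist r M :=
  fun e => F e w

/-- The product `a_1(x_1) a_2(x_2) ⋯ a_r(x_r)` of operator-valued formal series in one variable,
`a i n` being the coefficient of `x ^ n` in `a_i(x)`. -/
def opProd {r : ℕ} {M : Type*} [AddCommGroup M] [Module ℂ M]
    (a : Fin r → ℤ → Module.End ℂ M) : FDist r (Module.End ℂ M) :=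
  fun e => (List.ofFn fun i => a i (e i)).prod

/-- For `g(z) = ∑ₙ g n zⁿ`, the series `g(α x + β y) = ∑ₙ g n (α x + β y)ⁿ` in the variables
`x` (number `0`) and `y` (number `1`), every power being expanded in nonnegative powers of `y`. -/
def expandLin (g : ℤ → ℂ) (α β : ℂ) : FDist 2 ℂ := fun e =>
  if 0 ≤ e 1 then
    g (e 0 + e 1) * ((Ring.choose (e 0 + e 1) (e 1).toNat : ℤ) : ℂ) * α ^ (e 0) * β ^ (e 1)
  else 0

/-- In three variables, with `z`, `x`, `y` a numbering of them, the formal delta series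
`z⁻¹ δ((α x + β y) / (γ z)) = ∑ₙ γ⁻ⁿ z⁻ⁿ⁻¹ (α x + β y)ⁿ`, `n` ranging over the integers and
every power being expanded in nonnegative powers of `y`. -/
def deltaSeries (z x y : Fin 3) (α β γ : ℂ) : FDist 3 ℂ := fun e =>
  if e z + e x + e y + 1 = 0 ∧ 0 ≤ e y then
    ((Ring.choose (e x + e y) (e y).toNat : ℤ) : ℂ) * α ^ (e x) * β ^ (e y) * γ ^ (-(e x + e y))
  else 0

/-- For `A(x₁, x₂)`, the series `A(x₀ + x₂, x₂)` in the variables `x₀` (number `0`) and `x₂`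
(number `1`), the powers of `x₀ + x₂` being expanded in nonnegative powers of `x₂`. It is used for
series whose powers of `x₂` are bounded below, so that the sums are finite. -/
def substAssoc {M : Type*} [AddCommGroup M] [Module ℂ M] (A : FDist 2 M) : FDist 2 M := fun e =>
  ∑ᶠ i : ℕ, (Ring.choose (e 0 + i) i : ℤ) • A ![e 0 + i, e 1 - i]

/-- For `F(x₁, x₂)`, the series `F(x₁, x₂)|_{x₁ = x₂ + x₀}` in the variables `x₀` (number `0`) and
`x₂` (number `1`), the powers of `x₂ + x₀` being expanded in nonnegative powers of `x₀`. It is used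
for series whose powers of `x₁` and of `x₂` are bounded above, so that the sums are finite. -/
def substShift {M : Type*} [AddCommGroup M] [Module ℂ M] (F : FDist 2 M) : FDist 2 M := fun e =>
  if 0 ≤ e 0 then
    ∑ᶠ m : ℤ, (Ring.choose (m + e 0) (e 0).toNat : ℤ) • F ![m + e 0, e 1 - m]
  else 0

/-- `F` lies in `M((x₁⁻¹, …, x_r⁻¹))`: the exponents of every variable are bounded above. -/
def IsLaurentInf {r : ℕ} {M : Type*} [AddCommGroup M] (F : FDist r M) : Prop :=
  ∃ N : ℤ, ∀ e : Fin r → ℤ, (∃ i, N < e i) → F e = 0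

/-- `F` lies in `Hom(M, M((x₁⁻¹, …, x_r⁻¹)))`. -/
def IsHomLaurentInf {r : ℕ} {M : Type*} [AddCommGroup M] [Module ℂ M]
    (F : FDist r (Module.End ℂ M)) : Prop :=
  ∀ w : M, IsLaurentInf (appVec F w)

/-- Laurent series over a field, again a field. (The zero of the coefficients is that of the field
structure, so that the construction can be iterated.) -/
abbrev LaurentField (K : Type*) [Field K] := LaurentSeries K

/-- `M((t))` for a vector space `M` over a field `K`, a vector space over the field `K((t))`. -/
abbrev LaurentSpace (K M : Type*) [Field K] [AddCommGroup M] [Module K M] := HahnModule ℤ K M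

/-! ### The space `Hom(W, W((x⁻¹)))`, compatibility and `S`-locality -/

/-- `Hom(W, W((x⁻¹)))`: the linear maps from `W` to the Laurent series in the variable `x⁻¹` with
coefficients in `W`. -/
abbrev EInf (W : Type*) [AddCommGroup W] [Module ℂ W] := HVertexOperator ℤ ℂ W W

/-- The coefficient of `x ^ m` in `a(x)`, that is, of the power `-m` of the variable `x⁻¹`. -/
def coeffInf {W : Type*} [AddCommGroup W] [Module ℂ W] (a : EInf W) (m : ℤ) : Module.End ℂ W :=
  HVertexOperator.coeff a (-m)

/-- The identity operator `1_W`, as a constant series in `Hom(W, W((x⁻¹)))`. -/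
def idInf (W : Type*) [AddCommGroup W] [Module ℂ W] : EInf W :=
  HVertexOperator.of_coeff (fun n => if n = 0 then LinearMap.id else 0) (fun w => by
    refine (Set.finite_singleton (0 : ℤ)).isPWO.mono ?_
    intro n hn
    by_contra h
    have h0 : n ≠ 0 := h
    simp [h0] at hn)

/-- A finite sequence `a_1(x), …, a_r(x)` is quasi-compatible: for some nonzero polynomial `p`,
`(∏_{i<j} p(x_i, x_j)) a_1(x_1) ⋯ a_r(x_r)` lies in `Hom(W, W((x_1⁻¹, …, x_r⁻¹)))`. -/
def IsQuasiCompatibleSeq {W : Type*} [AddCommGroup W] [Module ℂ W] {r : ℕ}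
    (a : Fin r → EInf W) : Prop :=
  ∃ p : MvPolynomial (Fin 2) ℂ, p ≠ 0 ∧
    IsHomLaurentInf (polyMul (∏ i, ∏ j ∈ Finset.Ioi i, MvPolynomial.rename ![i, j] p)
      (opProd fun i => coeffInf (a i)))

/-- A finite sequence `a_1(x), …, a_r(x)` is compatible: for some `k ∈ ℕ`,
`(∏_{i<j} (x_i - x_j)^k) a_1(x_1) ⋯ a_r(x_r)` lies in `Hom(W, W((x_1⁻¹, …, x_r⁻¹)))`. -/
def IsCompatibleSeq {W : Type*} [AddCommGroup W] [Module ℂ W] {r : ℕ}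
    (a : Fin r → EInf W) : Prop :=
  ∃ k : ℕ,
    IsHomLaurentInf (polyMul
      (∏ i, ∏ j ∈ Finset.Ioi i, (MvPolynomial.X i - MvPolynomial.X j) ^ k)
      (opProd fun i => coeffInf (a i)))

/-- Every finite sequence in `S` is quasi-compatible. -/
def IsQuasiCompatible {W : Type*} [AddCommGroup W] [Module ℂ W] (S : Set (EInf W)) : Prop :=
  ∀ (r : ℕ) (a : Fin r → EInf W), (∀ i, a i ∈ S) → IsQuasiCompatibleSeq a

/-- Every finite sequence in `S` is compatible. -/
def IsCompatible {W : Type*} [AddCommGroup W] [Module ℂ W] (S : Set (EInf W)) : Prop :=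
  ∀ (r : ℕ) (a : Fin r → EInf W), (∀ i, a i ∈ S) → IsCompatibleSeq a

/-- The expansion at infinity `ι_{x,∞} : ℂ(x) → ℂ((x⁻¹))`, the target being Laurent series in the
variable `x⁻¹`: evaluate numerator and denominator at `x` (the power `-1` of the variable) and
divide in the field of Laurent series. -/
def iotaInf (f : RatFunc ℂ) : LaurentField ℂ :=
  RatFunc.eval (algebraMap ℂ (LaurentField ℂ)) (HahnSeries.single (-1 : ℤ) (1 : ℂ)) f

/-- `U` is `S`-local: for `a, b ∈ U` there are `u_i, v_i ∈ U`, rational functions `f_i` and `k ∈ ℕ`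
such that `(x₁ - x₂)^k a(x₁) b(x₂) = (x₁ - x₂)^k ∑_i ι_{x,∞}(f_i)(-x₁ + x₂) u_i(x₂) v_i(x₁)`.
The variables are `x₁` (number `0`) and `x₂` (number `1`); the identity is read on every `w`. -/
def IsSLocal {W : Type*} [AddCommGroup W] [Module ℂ W] (U : Set (EInf W)) : Prop :=
  ∀ a ∈ U, ∀ b ∈ U, ∃ (r : ℕ) (u v : Fin r → EInf W) (f : Fin r → RatFunc ℂ) (k : ℕ),
    (∀ i, u i ∈ U) ∧ (∀ i, v i ∈ U) ∧
    ∀ w : W,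
      polyMul ((MvPolynomial.X 0 - MvPolynomial.X 1) ^ k)
          (fun e => coeffInf a (e 0) (coeffInf b (e 1) w)) =
        polyMul ((MvPolynomial.X 0 - MvPolynomial.X 1) ^ k)
          (∑ i, seriesMul (expandLin (fun n => (iotaInf (f i)).coeff (-n)) (-1) 1)
            (fun e => coeffInf (u i) (e 1) (coeffInf (v i) (e 0) w)))

/-! ### The operations `a(x)_n b(x)` -/

/-- For `F(x₁, x₂)` in `Hom(W, W((x₁⁻¹, x₂⁻¹)))`, the coefficients of `x₀^j x^m` in
`F(x + x₀, x) w` have finitely many nonzero terms. -/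
theorem finite_substShift {W : Type*} [AddCommGroup W] [Module ℂ W]
    {F : FDist 2 (Module.End ℂ W)} (hF : IsHomLaurentInf F) (j m : ℤ) (w : W) :
    (Function.support fun p : ℤ =>
      (Ring.choose (p + j) j.toNat : ℤ) • F ![p + j, m - p] w).Finite := by
  obtain ⟨N, hN⟩ := hF w
  refine (Set.finite_Icc (m - N) (N - j)).subset ?_
  intro p hp
  by_contra hcon
  apply hp
  have h0 : F ![p + j, m - p] w = 0 := by
    apply hN
    rw [Set.mem_Icc, not_and_or, not_le, not_le] at hcon
    rcases hcon with h | h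
    · exact ⟨1, by simp; omega⟩
    · exact ⟨0, by simp; omega⟩
  simp [h0]

theorem substShift_of_nonneg {M : Type*} [AddCommGroup M] [Module ℂ M] (F : FDist 2 M) {j : ℤ}
    (hj : 0 ≤ j) (m : ℤ) : substShift F ![j, m] =
      ∑ᶠ p : ℤ, (Ring.choose (p + j) j.toNat : ℤ) • F ![p + j, m - p] :=
  if_pos hj

theorem substShift_of_neg {M : Type*} [AddCommGroup M] [Module ℂ M] (F : FDist 2 M) {j : ℤ}
    (hj : ¬ 0 ≤ j) (m : ℤ) : substShift F ![j, m] = 0 :=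
  if_neg hj

/-- The coefficient of `x₀^j x^m` in `F(x + x₀, x)`, an operator on `W`. -/
def shiftEnd {W : Type*} [AddCommGroup W] [Module ℂ W]
    (F : FDist 2 (Module.End ℂ W)) (hF : IsHomLaurentInf F) (j m : ℤ) : Module.End ℂ W where
  toFun w := substShift (appVec F w) ![j, m]
  map_add' w w' := by
    by_cases hj : 0 ≤ j
    · simp only [substShift_of_nonneg _ hj, appVec, map_add, smul_add]
      exact finsum_add_distrib (finite_substShift hF j m w) (finite_substShift hF j m w')
    · simp only [substShift_of_neg _ hj, add_zero]
  map_smul' c w := by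
    by_cases hj : 0 ≤ j
    · simp only [substShift_of_nonneg _ hj, appVec, RingHom.id_apply, map_smul]
      rw [smul_finsum' c (finite_substShift hF j m w)]
      exact finsum_congr fun p => smul_comm _ _ _
    · simp only [substShift_of_neg _ hj, smul_zero]

theorem shiftEnd_bdd {W : Type*} [AddCommGroup W] [Module ℂ W]
    (F : FDist 2 (Module.End ℂ W)) (hF : IsHomLaurentInf F) (j : ℤ) (w : W) :
    (Function.support fun n : ℤ => shiftEnd F hF j (-n) w).IsPWO := by
  suffices h : BddBelow (Function.support fun n : ℤ => shiftEnd F hF j (-n) w) from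
    h.isWF.isPWO
  obtain ⟨N, hN⟩ := hF w
  refine ⟨j - 2 * N, ?_⟩
  intro n hn
  by_contra hlt
  rw [not_le] at hlt
  apply hn
  change substShift (appVec F w) ![j, -n] = 0
  by_cases hj : 0 ≤ j
  · rw [substShift_of_nonneg _ hj]
    refine finsum_eq_zero_of_forall_eq_zero fun p => ?_
    rw [hN, smul_zero]
    by_cases hp : N < p + j
    · exact ⟨0, by simpa using hp⟩
    · exact ⟨1, by simp; omega⟩
  · exact substShift_of_neg _ hj _

/-- The coefficient of `x₀^j` in `F(x + x₀, x)`, an element of `Hom(W, W((x⁻¹)))`. -/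
def shiftOp {W : Type*} [AddCommGroup W] [Module ℂ W]
    (F : FDist 2 (Module.End ℂ W)) (hF : IsHomLaurentInf F) (j : ℤ) : EInf W :=
  HVertexOperator.of_coeff (fun n => shiftEnd F hF j (-n)) (shiftEnd_bdd F hF j)

theorem shiftOp_bdd {W : Type*} [AddCommGroup W] [Module ℂ W]
    (F : FDist 2 (Module.End ℂ W)) (hF : IsHomLaurentInf F) :
    BddBelow (Function.support (shiftOp F hF)) := by
  refine ⟨0, ?_⟩
  intro j hj
  by_contra hlt
  apply hj
  ext w n
  exact substShift_of_neg (appVec F w) hlt (-n)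

/-- `Hom(W, W((x⁻¹)))((x₀))`, the Laurent series in `x₀` over `Hom(W, W((x⁻¹)))`; it is a vector
space over the field `ℂ((x⁻¹))((x₀))`. -/
abbrev EInfSeries (W : Type*) [AddCommGroup W] [Module ℂ W] :=
  LaurentSpace (LaurentField ℂ) (EInf W)

/-- `F(x₁, x)|_{x₁ = x + x₀}` as an element of `Hom(W, W((x⁻¹)))((x₀))`. -/
def shiftSeries {W : Type*} [AddCommGroup W] [Module ℂ W]
    (F : FDist 2 (Module.End ℂ W)) (hF : IsHomLaurentInf F) : EInfSeries W :=
  HahnModule.of (LaurentField ℂ)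
    (HahnSeries.ofSuppBddBelow (shiftOp F hF) (shiftOp_bdd F hF))

/-- `ι_{x,∞;x₀,0}(1 / p(x₀ + x, x))`, an element of the field `ℂ((x⁻¹))((x₀))`: the inverse of the
image of the polynomial `p(x₀ + x, x)`. -/
def iotaInv (p : MvPolynomial (Fin 2) ℂ) : LaurentField (LaurentField ℂ) :=
  (MvPolynomial.aeval
    ![HahnSeries.single (1 : ℤ) (1 : LaurentField ℂ)
        + HahnSeries.C (HahnSeries.single (-1 : ℤ) (1 : ℂ) : LaurentField ℂ),
      HahnSeries.C (HahnSeries.single (-1 : ℤ) (1 : ℂ) : LaurentField ℂ)] p)⁻¹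

/-- `p(x₁, x₂)` is nonzero and `p(x₁, x₂) a(x₁) b(x₂)` lies in `Hom(W, W((x₁⁻¹, x₂⁻¹)))`. -/
structure Clears {W : Type*} [AddCommGroup W] [Module ℂ W] (a b : EInf W)
    (p : MvPolynomial (Fin 2) ℂ) : Prop where
  ne_zero : p ≠ 0
  isHom : IsHomLaurentInf (polyMul p (opProd ![coeffInf a, coeffInf b]))

/-- For a nonzero polynomial `p` such that `p(x₁, x₂) a(x₁) b(x₂)` lies in
`Hom(W, W((x₁⁻¹, x₂⁻¹)))`, the element
`ι_{x,∞;x₀,0}(1 / p(x₀ + x, x)) (p(x₁, x) a(x₁) b(x))|_{x₁ = x + x₀}`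
of `Hom(W, W((x⁻¹)))((x₀))`. -/
def vertexProdWith {W : Type*} [AddCommGroup W] [Module ℂ W] (a b : EInf W)
    (p : MvPolynomial (Fin 2) ℂ) (hp : Clears a b p) : EInfSeries W :=
  iotaInv p • shiftSeries (polyMul p (opProd ![coeffInf a, coeffInf b])) hp.isHom

open scoped Classical in
/-- `Y(a(x), x₀) b(x)` for a quasi-compatible pair `(a(x), b(x))`: the element above for any
polynomial `p` that is allowed there. (It is set to `0` for pairs that are not
quasi-compatible.) -/
def vertexProd {W : Type*} [AddCommGroup W] [Module ℂ W] (a b : EInf W) : EInfSeries W :=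
  if h : ∃ p, Clears a b p then vertexProdWith a b h.choose h.choose_spec else 0

/-- `a(x)_n b(x)`, the coefficient of `x₀ ^ (-n - 1)` in `Y(a(x), x₀) b(x)`. -/
def nthProd {W : Type*} [AddCommGroup W] [Module ℂ W] (a : EInf W) (n : ℤ) (b : EInf W) : EInf W :=
  ((HahnModule.of (LaurentField ℂ)).symm (vertexProd a b)).coeff (-n - 1)

/-- The closed quasi-compatible subspaces of `Hom(W, W((x⁻¹)))` that contain `U` and `1_W`. -/
def closedSubspaces {W : Type*} [AddCommGroup W] [Module ℂ W] (U : Set (EInf W)) :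
    Set (Submodule ℂ (EInf W)) :=
  {S | IsQuasiCompatible (S : Set (EInf W)) ∧
    (∀ a ∈ S, ∀ b ∈ S, ∀ n : ℤ, nthProd a n b ∈ S) ∧ idInf W ∈ S ∧ U ⊆ S}

/-- `⟨U⟩`: the intersection of the closed quasi-compatible subspaces containing `U` and `1_W`. -/
def generated {W : Type*} [AddCommGroup W] [Module ℂ W] (U : Set (EInf W)) :
    Submodule ℂ (EInf W) :=
  sInf (closedSubspaces U)

/-! ### Nonlocal vertex algebras, weak quantum vertex algebras, modules-at-infinity

The vertex operator map is a linear map `Y : V → Hom(V, V((x)))`; Mathlib's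
`VertexOperator ℂ V` is `Hom(V, V((x)))`, and `HVertexOperator.coeff (Y v) n` is the coefficient
of `x ^ n` in `Y(v, x)`, an operator on `V`. -/

/-- `Y(𝟏, x) v = v`, `Y(v, x)𝟏 ∈ V[[x]]` and `lim_{x → 0} Y(v, x)𝟏 = v`. -/
structure HasVacuum {V : Type*} [AddCommGroup V] [Module ℂ V]
    (Y : V →ₗ[ℂ] VertexOperator ℂ V) (one : V) : Prop where
  vacuum_zero : ∀ v : V, HVertexOperator.coeff (Y one) 0 v = v
  vacuum_ne : ∀ (v : V) (n : ℤ), n ≠ 0 → HVertexOperator.coeff (Y one) n v = 0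
  creation_neg : ∀ (v : V) (n : ℤ), n < 0 → HVertexOperator.coeff (Y v) n one = 0
  creation_zero : ∀ v : V, HVertexOperator.coeff (Y v) 0 one = v

/-- A nonlocal vertex algebra: the vacuum and creation properties and weak associativity
`(x₀ + x₂)^l Y(u, x₀ + x₂) Y(v, x₂) w = (x₀ + x₂)^l Y(Y(u, x₀)v, x₂) w`
(variables `x₀`, number `0`, and `x₂`, number `1`). -/
structure IsNonlocalVertexAlgebra {V : Type*} [AddCommGroup V] [Module ℂ V]
    (Y : V →ₗ[ℂ] VertexOperator ℂ V) (one : V) : Prop extends HasVacuum Y one where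
  weak_assoc : ∀ u v w : V, ∃ l : ℕ,
    polyMul ((MvPolynomial.X 0 + MvPolynomial.X 1) ^ l)
        (substAssoc fun e =>
          HVertexOperator.coeff (Y u) (e 0) (HVertexOperator.coeff (Y v) (e 1) w)) =
      polyMul ((MvPolynomial.X 0 + MvPolynomial.X 1) ^ l)
        (fun e => HVertexOperator.coeff (Y (HVertexOperator.coeff (Y u) (e 0) v)) (e 1) w)

/-- A weak quantum vertex algebra: the vacuum and creation properties, and for all `u, v` there are
`u_i, v_i ∈ V` and `f_i ∈ ℂ((x))` with the `S`-Jacobi identity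
`x₀⁻¹ δ((x₁ - x₂)/x₀) Y(u, x₁) Y(v, x₂)
  - x₀⁻¹ δ((x₂ - x₁)/(-x₀)) ∑_i f_i(-x₀) Y(v_i, x₂) Y(u_i, x₁)
  = x₂⁻¹ δ((x₁ - x₀)/x₂) Y(Y(u, x₀)v, x₂)`.
The variables `x₀, x₁, x₂` have the numbers `0, 1, 2`; the identity is read on every `w`. -/
structure IsWeakQuantumVertexAlgebra {V : Type*} [AddCommGroup V] [Module ℂ V]
    (Y : V →ₗ[ℂ] VertexOperator ℂ V) (one : V) : Prop extends HasVacuum Y one where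
  jacobi : ∀ u v : V, ∃ (r : ℕ) (u' v' : Fin r → V) (f : Fin r → LaurentSeries ℂ), ∀ w : V,
    seriesMul (deltaSeries 0 1 2 1 (-1) 1)
        (fun e => if e 0 = 0 then
          HVertexOperator.coeff (Y u) (e 1) (HVertexOperator.coeff (Y v) (e 2) w) else 0)
      - seriesMul (deltaSeries 0 2 1 1 (-1) (-1))
        (fun e => ∑ i, ((f i).coeff (e 0) * (-1 : ℂ) ^ (e 0)) •
          HVertexOperator.coeff (Y (v' i)) (e 2) (HVertexOperator.coeff (Y (u' i)) (e 1) w)) =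
      seriesMul (deltaSeries 2 1 0 1 (-1) 1)
        (fun e => if e 1 = 0 then
          HVertexOperator.coeff (Y (HVertexOperator.coeff (Y u) (e 0) v)) (e 2) w else 0)

/-- The condition, for a polynomial `p(x₁, x₂)`, that
`p(x₁, x₂) Y_W(u, x₁) Y_W(v, x₂)` lies in `Hom(W, W((x₁⁻¹, x₂⁻¹)))` and
`p(x₀ + x₂, x₂) Y_W(Y(u, x₀)v, x₂) = (p(x₁, x₂) Y_W(u, x₁) Y_W(v, x₂))|_{x₁ = x₂ + x₀}`
(variables `x₀`, number `0`, and `x₂`, number `1`; the identity is read on every `w`). -/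
def AssocAtInfinity {V W : Type*} [AddCommGroup V] [Module ℂ V] [AddCommGroup W] [Module ℂ W]
    (Y : V →ₗ[ℂ] VertexOperator ℂ V) (YW : V →ₗ[ℂ] EInf W) (u v : V)
    (p : MvPolynomial (Fin 2) ℂ) : Prop :=
  IsHomLaurentInf (polyMul p (opProd ![coeffInf (YW u), coeffInf (YW v)])) ∧
  ∀ w : W,
    polyMul (MvPolynomial.aeval ![MvPolynomial.X 0 + MvPolynomial.X 1,
          (MvPolynomial.X 1 : MvPolynomial (Fin 2) ℂ)] p)
        (fun e => coeffInf (YW (HVertexOperator.coeff (Y u) (e 0) v)) (e 1) w) =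
      substShift (appVec (polyMul p (opProd ![coeffInf (YW u), coeffInf (YW v)])) w)

/-- `(W, Y_W)` is a (left) quasi module-at-infinity for `(V, Y, 𝟏)`. -/
structure IsQuasiModuleAtInfinity {V W : Type*} [AddCommGroup V] [Module ℂ V]
    [AddCommGroup W] [Module ℂ W] (Y : V →ₗ[ℂ] VertexOperator ℂ V) (one : V)
    (YW : V →ₗ[ℂ] EInf W) : Prop where
  vacuum : YW one = idInf W
  quasi_assoc : ∀ u v : V, ∃ p : MvPolynomial (Fin 2) ℂ, p ≠ 0 ∧ AssocAtInfinity Y YW u v p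

/-- `(W, Y_W)` is a (left) module-at-infinity for `(V, Y, 𝟏)`: a quasi module-at-infinity for which
the polynomial can be taken to be a power of `x₁ - x₂` (so that `p(x₀ + x₂, x₂)` is `x₀ ^ k`). -/
structure IsModuleAtInfinity {V W : Type*} [AddCommGroup V] [Module ℂ V]
    [AddCommGroup W] [Module ℂ W] (Y : V →ₗ[ℂ] VertexOperator ℂ V) (one : V)
    (YW : V →ₗ[ℂ] EInf W) : Prop extends IsQuasiModuleAtInfinity Y one YW where
  assoc : ∀ u v : V, ∃ k : ℕ,
    AssocAtInfinity Y YW u v ((MvPolynomial.X 0 - MvPolynomial.X 1) ^ k)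

end VAInf

end

set_option linter.unusedSectionVars false

/-! Formal series are treated as modules over polynomial rings, and the operations `a(x)_n b(x)`
enter only through one property (`isExp2_with_of_mem`): if (x₁-x)^k a(x₁)b(x) lies in Hom(W,
W((x₁⁻¹,x⁻¹))), then setting x₁ = x + x₀ in it gives x₀^k Y(a,x₀)b. Powers of a variable can be
cancelled, so this determines Y. Identities between products of operators are therefore carried over
to vertex operators by expanding both sides where the variables coincide and using uniqueness
(`IsExp2.unique`, `IsExp.unique`).

Compatibility of U: in a₁(x₁)⋯a_r(x_r)w, `S`-locality moves a₁(x₁) to the right until it acts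
directly on w, where its exponents are bounded above. Each exchange costs a power of x₁-x_j and a
factor f(-x₁+x₂), whose exponents of x₁ are bounded above. The other variables follow by induction,
because the factors to their left act coefficientwise.

Existence of ⟨U⟩: replacing two neighbours x, y of a compatible sequence by a product x_n y keeps it
compatible (`IsCompatibleSeq.nthProd`). When the two variables are identified, the Vandermonde
polynomial without their difference still divides a power of the smaller Vandermonde polynomial.
Hence `compatHull` is a closed compatible subspace, and the intersection defining ⟨U⟩ is itself
closed and compatible.

Weak associativity: multiply a(x₁)b(x₂)c(x)w by a power of (x₁-x₂)(x₁-x)(x₂-x) that removes all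
poles. Setting x₁ = x+z₁ and x₂ = x+z₂ gives Y(a,z₁)Y(b,z₂)c; setting x₁ = x₂+z₀ and then x₂ = x+z₂
gives Y(Y(a,z₀)b,z₂)c. The two are related by z₁ = z₀+z₂, which on monomials is the Chu-Vandermonde
identity (`assocVar_substVar`).

The `S`-Jacobi identity: with denominators cleared, `S`-locality says that h(x₂-x₁)a(x₁)b(x₂) is a
combination of terms g(x₂-x₁)u(x₂)v(x₁) with polynomials g and h ≠ 0. This form passes from U to ⟨U⟩
(`polyLocal_generated`) and then to Y (`PolyLocal.exists_vprod_eq`); division by the common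
denominator in ℂ((x)) produces the f_i. After multiplication by a monomial and by a polynomial in
x₀, both cancellable, the Jacobi identity is reduced to series with nonnegative exponents, where it
is the three-term identity for delta series (`deltaSeries_sub`). -/

noncomputable section
namespace VAInf

/-! ### Formal series as modules over polynomial rings -/

section PolyModule

variable {r : ℕ} {M M' : Type*} [AddCommGroup M] [Module ℂ M] [AddCommGroup M'] [Module ℂ M']

/-- The monomials act on formal series by shifting exponents. -/
def shiftHom (r : ℕ) (M : Type*) [AddCommGroup M] [Module ℂ M] :
    Multiplicative (Fin r →₀ ℕ) →* Module.End ℂ (FDist r M) where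
  toFun d :=
    { toFun := fun F e => F (fun i => e i - (d.toAdd i : ℤ))
      map_add' := fun _ _ => rfl
      map_smul' := fun _ _ => rfl }
  map_one' := by ext F e; simp
  map_mul' d d' := by
    refine LinearMap.ext fun F => funext fun e => ?_
    simp only [toAdd_mul, LinearMap.coe_mk, AddHom.coe_mk, Module.End.mul_apply]
    congr 1
    funext i
    simp
    ring

/-- The action of polynomials on formal series, as an algebra homomorphism. -/
def polyAct (r : ℕ) (M : Type*) [AddCommGroup M] [Module ℂ M] :
    MvPolynomial (Fin r) ℂ →ₐ[ℂ] Module.End ℂ (FDist r M) :=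
  AddMonoidAlgebra.lift ℂ _ _ (shiftHom r M)

theorem polyAct_apply (P : MvPolynomial (Fin r) ℂ) (F : FDist r M) :
    polyAct r M P F = polyMul P F := by
  rw [polyAct, AddMonoidAlgebra.lift_apply, Finsupp.sum, LinearMap.sum_apply]
  funext e
  rw [Finset.sum_apply]
  rfl

/-- The axioms come from the algebra homomorphism `polyAct`, while the scalar action is `polyMul` by
definition, so the formulas of the statement can be read as scalar multiplications without
rewriting. -/
instance : Module (MvPolynomial (Fin r) ℂ) (FDist r M) where
  smul := polyMul
  one_smul F := by
    change polyMul _ _ = _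
    rw [← polyAct_apply, map_one]; rfl
  mul_smul P Q F := by
    change polyMul _ _ = polyMul _ (polyMul _ _)
    simp only [← polyAct_apply, map_mul]; rfl
  smul_zero P := by
    change polyMul _ _ = _
    rw [← polyAct_apply, map_zero]
  smul_add P F G := by
    change polyMul _ _ = polyMul _ _ + polyMul _ _
    simp only [← polyAct_apply, map_add]
  add_smul P Q F := by
    change polyMul _ _ = polyMul _ _ + polyMul _ _
    simp only [← polyAct_apply, map_add]; rfl
  zero_smul F := by
    change polyMul _ _ = _
    rw [← polyAct_apply, map_zero]; rfl

theorem polySMul_def (P : MvPolynomial (Fin r) ℂ) (F : FDist r M) : P • F = polyMul P F := rfl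

theorem X_smul_apply (i : Fin r) (F : FDist r M) (e : Fin r → ℤ) :
    ((MvPolynomial.X i : MvPolynomial (Fin r) ℂ) • F) e = F (e - Pi.single i 1) := by
  rw [polySMul_def, ← polyAct_apply]
  have : polyAct r M (MvPolynomial.X i) =
      shiftHom r M (Multiplicative.ofAdd (Finsupp.single i 1)) := by
    rw [polyAct]
    exact (AddMonoidAlgebra.lift_single _ _ _).trans (one_smul _ _)
  rw [this]
  change F _ = _
  congr 1
  funext j
  by_cases h : j = i
  · subst h; simp
  · simp [h]

theorem C_smul (c : ℂ) (F : FDist r M) : (MvPolynomial.C c : MvPolynomial (Fin r) ℂ) • F = c •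
    F := by
  rw [polySMul_def, ← polyAct_apply]
  have : polyAct r M (MvPolynomial.C c) = algebraMap ℂ _ c := (polyAct r M).commutes c
  rw [this]; rfl

instance : IsScalarTower ℂ (MvPolynomial (Fin r) ℂ) (FDist r M) where
  smul_assoc c P F := by
    rw [MvPolynomial.smul_eq_C_mul, mul_smul, C_smul]

/-- A subspace of formal series that is stable under the variables is stable under polynomials. -/
theorem smul_mem_of_X_smul_mem (S : Submodule ℂ (FDist r M))
    (h : ∀ i, ∀ F ∈ S, (MvPolynomial.X i : MvPolynomial (Fin r) ℂ) • F ∈ S)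
    (P : MvPolynomial (Fin r) ℂ) {F : FDist r M} (hF : F ∈ S) : P • F ∈ S := by
  induction P using MvPolynomial.induction_on with
  | C c => rw [C_smul]; exact S.smul_mem c hF
  | add p q hp hq => rw [add_smul]; exact S.add_mem hp hq
  | mul_X p i hp => rw [mul_comm, mul_smul]; exact h i _ hp

/-- An additive map on a subspace stable under the variables that is semilinear for the variables
is semilinear for all polynomials. -/
theorem map_smul_of_map_X_smul {q : ℕ} (S : Submodule ℂ (FDist r M))
    (hS : ∀ i, ∀ F ∈ S, (MvPolynomial.X i : MvPolynomial (Fin r) ℂ) • F ∈ S)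
    (T : FDist r M → FDist q M') (φ : MvPolynomial (Fin r) ℂ →ₐ[ℂ] MvPolynomial (Fin q) ℂ)
    (hadd : ∀ F ∈ S, ∀ G ∈ S, T (F + G) = T F + T G)
    (hsmul : ∀ (c : ℂ), ∀ F ∈ S, T (c • F) = c • T F)
    (hX : ∀ i, ∀ F ∈ S, T ((MvPolynomial.X i : MvPolynomial (Fin r) ℂ) • F)
      = φ (MvPolynomial.X i) • T F)
    (P : MvPolynomial (Fin r) ℂ) {F : FDist r M} (hF : F ∈ S) : T (P • F) = φ P • T F := by
  induction P using MvPolynomial.induction_on with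
  | C c =>
    rw [C_smul, hsmul c F hF]
    have : φ (MvPolynomial.C c) = MvPolynomial.C c := φ.commutes c
    rw [this, C_smul]
  | add p q hp hq =>
    rw [add_smul, hadd _ (smul_mem_of_X_smul_mem S hS p hF) _ (smul_mem_of_X_smul_mem S hS q hF),
      hp, hq, map_add, add_smul]
  | mul_X p i hp =>
    rw [mul_comm, mul_smul, hX i _ (smul_mem_of_X_smul_mem S hS p hF), hp, map_mul, mul_smul]

/-- Pull back a formal series along an affine map of exponents and push forward its coefficients:
if the variables correspond, then polynomials do. -/
theorem reindex_smul {q : ℕ} (T : FDist r M →ₗ[ℂ] FDist q M')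
    (φ : MvPolynomial (Fin r) ℂ →ₐ[ℂ] MvPolynomial (Fin q) ℂ)
    (hX : ∀ i F, T ((MvPolynomial.X i : MvPolynomial (Fin r) ℂ) • F) = φ (MvPolynomial.X i) • T F)
    (P : MvPolynomial (Fin r) ℂ) (F : FDist r M) : T (P • F) = φ P • T F :=
  map_smul_of_map_X_smul ⊤ (fun _ _ _ => trivial) T φ (fun _ _ _ _ => map_add _ _ _)
    (fun _ _ _ => map_smul _ _ _) (fun i F _ => hX i F) P trivial

/-- Apply a linear map to the coefficients. -/
def mapF (φ : M →ₗ[ℂ] M') : FDist r M →ₗ[ℂ] FDist r M' where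
  toFun F e := φ (F e)
  map_add' _ _ := by funext e; simp
  map_smul' _ _ := by funext e; simp

theorem mapF_apply (φ : M →ₗ[ℂ] M') (F : FDist r M) (e : Fin r → ℤ) : mapF φ F e = φ (F e) := rfl

theorem mapF_smul (φ : M →ₗ[ℂ] M') (P : MvPolynomial (Fin r) ℂ) (F : FDist r M) :
    mapF φ (P • F) = P • mapF φ F :=
  reindex_smul (mapF φ) (AlgHom.id ℂ _) (fun i F => by
    funext e; simp [mapF_apply, X_smul_apply]) P F

theorem appVec_smul (P : MvPolynomial (Fin r) ℂ) (F : FDist r (Module.End ℂ M)) (w : M) :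
    appVec (P • F) w = P • appVec F w :=
  mapF_smul (LinearMap.applyₗ w) P F

theorem exists_submodule_lowerBound (i : Fin r) (N : ℤ) : ∃ S : Submodule ℂ (FDist r M),
    (∀ F, F ∈ S ↔ ∀ e : Fin r → ℤ, e i < N → F e = 0) ∧
    ∀ j, ∀ F ∈ S, (MvPolynomial.X j : MvPolynomial (Fin r) ℂ) • F ∈ S := by
  refine ⟨{ carrier := {F | ∀ e : Fin r → ℤ, e i < N → F e = 0}
            add_mem' := ?_, zero_mem' := ?_, smul_mem' := ?_ }, fun F => Iff.rfl, ?_⟩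
  · intro F G hF hG e he; simp [hF e he, hG e he]
  · intro e he; rfl
  · intro c F hF e he; simp [hF e he]
  · intro j F hF e he
    rw [X_smul_apply]
    apply hF
    by_cases h : i = j
    · subst h; simp; omega
    · simp [h, he]

/-- Polynomials preserve lower bounds on exponents. -/
theorem smul_apply_eq_zero_of_lt {i : Fin r} {N : ℤ} {F : FDist r M}
    (hF : ∀ e : Fin r → ℤ, e i < N → F e = 0) (P : MvPolynomial (Fin r) ℂ) {e : Fin r → ℤ}
    (he : e i < N) : (P • F) e = 0 := by
  obtain ⟨S, hS, hX⟩ := exists_submodule_lowerBound (M := M) i N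
  exact (hS _).1 (smul_mem_of_X_smul_mem S hX P ((hS F).2 hF)) e he

/-- The series whose exponents of the variable number `i` are bounded above. -/
def bddVar (M : Type*) [AddCommGroup M] [Module ℂ M] (i : Fin r) :
    Submodule (MvPolynomial (Fin r) ℂ) (FDist r M) :=
  let S : Submodule ℂ (FDist r M) :=
    { carrier := {F | ∃ N : ℤ, ∀ e, N < e i → F e = 0}
      add_mem' := by
        rintro F G ⟨N, hN⟩ ⟨N', hN'⟩
        exact ⟨max N N', fun e he => by
          simp [hN e (lt_of_le_of_lt (le_max_left _ _) he),
            hN' e (lt_of_le_of_lt (le_max_right _ _) he)]⟩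
      zero_mem' := ⟨0, fun _ _ => rfl⟩
      smul_mem' := by
        rintro c F ⟨N, hN⟩
        exact ⟨N, fun e he => by simp [hN e he]⟩ }
  { carrier := S
    add_mem' := S.add_mem
    zero_mem' := S.zero_mem
    smul_mem' := fun P F hF => smul_mem_of_X_smul_mem S (by
      rintro j F ⟨N, hN⟩
      refine ⟨N + 1, fun e he => ?_⟩
      rw [X_smul_apply]
      apply hN
      by_cases h : i = j
      · subst h; simp; omega
      · simp [h]; omega) P hF }

/-- `M((x₁⁻¹, …, x_r⁻¹))` as a submodule. -/
def laurentInf (r : ℕ) (M : Type*) [AddCommGroup M] [Module ℂ M] :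
    Submodule (MvPolynomial (Fin r) ℂ) (FDist r M) := ⨅ i, bddVar M i

theorem mem_laurentInf' {F : FDist r M} : F ∈ laurentInf r M ↔ ∀ i, F ∈ bddVar M i := by
  simp [laurentInf]

theorem mem_laurentInf {F : FDist r M} : F ∈ laurentInf r M ↔ IsLaurentInf F := by
  rw [mem_laurentInf']
  constructor
  · intro h
    choose N hN using h
    obtain ⟨B, hB⟩ := (Set.finite_range N).bddAbove
    refine ⟨B, fun e ⟨i, hi⟩ => hN i e (lt_of_le_of_lt (hB ⟨i, rfl⟩) hi)⟩
  · rintro ⟨N, hN⟩ i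
    exact ⟨N, fun e he => hN e ⟨i, he⟩⟩

theorem isHomLaurentInf_iff {F : FDist r (Module.End ℂ M)} :
    IsHomLaurentInf F ↔ ∀ w, appVec F w ∈ laurentInf r M :=
  forall_congr' fun _ => mem_laurentInf.symm

/-- The action of a variable is injective. -/
theorem X_smul_injective (i : Fin r) :
    Function.Injective fun F : FDist r M => (MvPolynomial.X i : MvPolynomial (Fin r) ℂ) • F := by
  intro F G h
  funext e
  have := congrFun h (e + Pi.single i 1)
  simpa [X_smul_apply] using this

theorem X_pow_smul_injective (i : Fin r) (k : ℕ) :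
    Function.Injective fun F : FDist r M => (MvPolynomial.X i ^ k : MvPolynomial (Fin r) ℂ) •
      F := by
  induction k with
  | zero => intro F G h; simpa using h
  | succ k ih =>
    intro F G h
    simp only [pow_succ, mul_smul] at h
    exact X_smul_injective i (ih h)

theorem X_pow_smul_apply (i : Fin r) (k : ℕ) (F : FDist r M) (e : Fin r → ℤ) :
    ((MvPolynomial.X i ^ k : MvPolynomial (Fin r) ℂ) • F) e = F (e - Pi.single i (k : ℤ)) := by
  induction k generalizing e with
  | zero => simp
  | succ k ih =>
    rw [pow_succ', mul_smul, X_smul_apply, ih]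
    congr 1
    rw [sub_sub, ← Pi.single_add]
    congr 2
    push_cast; ring

end PolyModule

end VAInf
end

noncomputable section
namespace VAInf

open MvPolynomial (X C)

/-! ### The substitution `x₁ = x₂ + x₀` -/


section Binomial

/-- Binomial coefficients with integer arguments. -/
def bin (a j : ℤ) : ℤ := if 0 ≤ j then Ring.choose a j.toNat else 0

theorem bin_of_nonneg (a : ℤ) {j : ℤ} (hj : 0 ≤ j) : bin a j = Ring.choose a j.toNat := if_pos hj

theorem bin_of_neg (a : ℤ) {j : ℤ} (hj : j < 0) : bin a j = 0 := if_neg (not_le.2 hj)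

theorem bin_natCast (a : ℤ) (j : ℕ) : bin a j = Ring.choose a j := by
  rw [bin_of_nonneg _ (Int.natCast_nonneg j), Int.toNat_natCast]

theorem bin_zero_right (a : ℤ) : bin a 0 = 1 := by
  rw [bin_of_nonneg _ le_rfl]; simp

theorem bin_zero_left (j : ℤ) : bin 0 j = if j = 0 then 1 else 0 := by
  rcases lt_or_ge j 0 with h | h
  · rw [bin_of_neg _ h, if_neg (by omega)]
  · obtain ⟨n, rfl⟩ := Int.eq_ofNat_of_zero_le h
    rw [bin_natCast, Ring.choose_zero_ite]
    simp

/-- Pascal's rule without a sign condition on `j`, thanks to the value 0 for negative `j`. It is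
what makes every substitution x ↦ x + y below compatible with multiplication by variables. -/
theorem bin_succ (a j : ℤ) : bin (a + 1) j = bin a (j - 1) + bin a j := by
  rcases lt_trichotomy j 0 with h | rfl | h
  · rw [bin_of_neg _ h, bin_of_neg _ h, bin_of_neg _ (by omega)]; rfl
  · rw [bin_zero_right, bin_zero_right, bin_of_neg _ (by omega)]; rfl
  · obtain ⟨n, rfl⟩ : ∃ n : ℕ, j = (n : ℤ) + 1 := ⟨(j - 1).toNat, by omega⟩
    rw [show (n : ℤ) + 1 = ((n + 1 : ℕ) : ℤ) by push_cast; ring, bin_natCast, bin_natCast,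
      show ((n + 1 : ℕ) : ℤ) - 1 = (n : ℤ) by push_cast; ring, bin_natCast, Ring.choose_succ_succ]

end Binomial

section SubstShift

variable {M M' : Type*} [AddCommGroup M] [Module ℂ M] [AddCommGroup M'] [Module ℂ M']

/-- The convention for `bin` absorbs the case distinction of the definition, so sums can be
reindexed freely. -/
theorem substShift_apply (F : FDist 2 M) (e : Fin 2 → ℤ) :
    substShift F e = ∑ᶠ m : ℤ, bin (m + e 0) (e 0) • F ![m + e 0, e 1 - m] := by
  rw [substShift]
  split_ifs with h
  · exact finsum_congr fun m => by rw [bin_of_nonneg _ h]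
  · exact (finsum_eq_zero_of_forall_eq_zero fun m => by
      rw [bin_of_neg _ (not_le.1 h), zero_smul]).symm

theorem finite_support_substShift {F : FDist 2 M} (hF : F ∈ laurentInf 2 M) (c : ℤ → ℤ) (j n : ℤ) :
    (Function.support fun m : ℤ => c m • F ![m + j, n - m]).Finite := by
  obtain ⟨N, hN⟩ := mem_laurentInf.1 hF
  refine (Set.finite_Icc (n - N) (N - j)).subset fun p hp => ?_
  by_contra hcon
  apply hp
  have h0 : F ![p + j, n - p] = 0 := by
    apply hN
    rw [Set.mem_Icc, not_and_or, not_le, not_le] at hcon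
    rcases hcon with h | h
    · exact ⟨1, by simp; omega⟩
    · exact ⟨0, by simp; omega⟩
  simp [h0]

theorem substShift_add {F G : FDist 2 M} (hF : F ∈ laurentInf 2 M) (hG : G ∈ laurentInf 2 M) :
    substShift (F + G) = substShift F + substShift G := by
  funext e
  simp only [substShift_apply, Pi.add_apply, smul_add]
  exact finsum_add_distrib (finite_support_substShift hF _ _ _) (finite_support_substShift hG _ _ _)

theorem substShift_const_smul (c : ℂ) {F : FDist 2 M} (hF : F ∈ laurentInf 2 M) :
    substShift (c • F) = c • substShift F := by
  funext e
  simp only [substShift_apply, Pi.smul_apply]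
  rw [smul_finsum' c (finite_support_substShift hF _ _ _)]
  exact finsum_congr fun m => smul_comm _ _ _

theorem substShift_mapF (φ : M →ₗ[ℂ] M') {F : FDist 2 M} (hF : F ∈ laurentInf 2 M) :
    substShift (mapF φ F) = mapF φ (substShift F) := by
  funext e
  simp only [substShift_apply, mapF_apply]
  refine Eq.trans (finsum_congr fun m => ?_)
    (AddMonoidHom.map_finsum φ.toAddMonoidHom (finite_support_substShift hF _ _ _)).symm
  exact (map_zsmul φ _ _).symm

theorem mapF_mem_laurentInf {r : ℕ} (φ : M →ₗ[ℂ] M') {F : FDist r M} (hF : F ∈ laurentInf r M) :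
    mapF φ F ∈ laurentInf r M' := by
  obtain ⟨N, hN⟩ := mem_laurentInf.1 hF
  exact mem_laurentInf.2 ⟨N, fun e he => by rw [mapF_apply, hN e he, map_zero]⟩

/-- The substitution `x_s ↦ x_s + x_t` of polynomials. -/
def shiftAlg {r : ℕ} (s t : Fin r) : MvPolynomial (Fin r) ℂ →ₐ[ℂ] MvPolynomial (Fin r) ℂ :=
  MvPolynomial.aeval (Function.update X s (X s + X t))

theorem shiftAlg_X_self {r : ℕ} (s t : Fin r) : shiftAlg s t (X s) = X s + X t := by
  simp [shiftAlg]

theorem shiftAlg_X_of_ne {r : ℕ} {s u : Fin r} (t : Fin r) (h : u ≠ s) :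
    shiftAlg s t (X u) = X u := by
  simp [shiftAlg, h]

theorem shiftAlg_zero_one : shiftAlg (0 : Fin 2) 1 =
    MvPolynomial.aeval ![X 0 + X 1, (X 1 : MvPolynomial (Fin 2) ℂ)] := by
  refine MvPolynomial.algHom_ext fun i => ?_
  fin_cases i
  · simp [shiftAlg]
  · simp [shiftAlg]

theorem shiftAlg_X_sub_X {r : ℕ} {s t : Fin r} (h : s ≠ t) : shiftAlg s t (X s - X t) = X s := by
  rw [map_sub, shiftAlg_X_self, shiftAlg_X_of_ne _ h.symm, add_sub_cancel_right]

theorem vec2_sub_single_zero (a b : ℤ) : ![a, b] - Pi.single 0 1 = ![a - 1, b] := by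
  funext i; fin_cases i <;> simp

theorem vec2_sub_single_one (a b : ℤ) : ![a, b] - Pi.single 1 1 = ![a, b - 1] := by
  funext i; fin_cases i <;> simp

theorem substShift_X_zero_smul {F : FDist 2 M} (hF : F ∈ laurentInf 2 M) :
    substShift ((X 0 : MvPolynomial (Fin 2) ℂ) • F)
      = (X 0 + X 1 : MvPolynomial (Fin 2) ℂ) • substShift F := by
  funext e
  rw [add_smul, Pi.add_apply, X_smul_apply, X_smul_apply]
  simp only [substShift_apply, X_smul_apply]
  have h2 : (∑ᶠ m : ℤ, bin (m + (e - Pi.single 1 1 : Fin 2 → ℤ) 0) ((e - Pi.single 1 1 :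
      Fin 2 → ℤ) 0)
        • F ![m + (e - Pi.single 1 1 : Fin 2 → ℤ) 0, (e - Pi.single 1 1 : Fin 2 → ℤ) 1 - m]) =
      ∑ᶠ m : ℤ, bin (m + (e 0 - 1)) (e 0) • F ![m + (e 0 - 1), e 1 - m] := by
    -- The shift of `m` by one makes both sums involve the same coefficients of `F`; Pascal's rule
    -- then adds the binomials.
    rw [← finsum_comp_equiv (Equiv.subRight (1 : ℤ))]
    refine finsum_congr fun m => ?_
    simp only [Equiv.subRight_apply, Pi.sub_apply, Pi.single_eq_same]
    rw [Pi.single_eq_of_ne (by decide)]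
    rw [show m - 1 + (e 0 - 0) = m + (e 0 - 1) by ring, show e 1 - 1 - (m - 1) = e 1 - m by ring,
      sub_zero]
  rw [h2]
  have h1 : (∑ᶠ m : ℤ, bin (m + (e - Pi.single 0 1 : Fin 2 → ℤ) 0) ((e - Pi.single 0 1 :
      Fin 2 → ℤ) 0)
        • F ![m + (e - Pi.single 0 1 : Fin 2 → ℤ) 0, (e - Pi.single 0 1 : Fin 2 → ℤ) 1 - m]) =
      ∑ᶠ m : ℤ, bin (m + (e 0 - 1)) (e 0 - 1) • F ![m + (e 0 - 1), e 1 - m] := by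
    refine finsum_congr fun m => ?_
    simp
  rw [h1, ← finsum_add_distrib (finite_support_substShift hF (fun m => bin (m + (e 0 - 1))
      (e 0 - 1)) _ _)
    (finite_support_substShift hF (fun m => bin (m + (e 0 - 1)) (e 0)) _ _)]
  refine finsum_congr fun m => ?_
  rw [← add_smul, ← bin_succ, vec2_sub_single_zero]
  congr 2
  · ring
  · congr 1; ring

theorem substShift_X_one_smul (F : FDist 2 M) :
    substShift ((X 1 : MvPolynomial (Fin 2) ℂ) • F) = (X 1 : MvPolynomial (Fin 2) ℂ) •
      substShift F := by
  funext e
  rw [X_smul_apply]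
  simp only [substShift_apply, X_smul_apply]
  refine finsum_congr fun m => ?_
  rw [vec2_sub_single_one]
  simp
  rw [sub_right_comm]

/-- The substitution is a ring homomorphism on polynomials, so semilinearity need only be tested on
the two variables; the upper bounds on exponents keep all sums finite. -/
theorem substShift_smul (P : MvPolynomial (Fin 2) ℂ) {F : FDist 2 M} (hF : F ∈ laurentInf 2 M) :
    substShift (P • F) = shiftAlg 0 1 P • substShift F := by
  refine map_smul_of_map_X_smul ((laurentInf 2 M).restrictScalars ℂ)
    (fun i F hF => (laurentInf 2 M).smul_mem _ hF) substShift _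
    (fun F hF G hG => substShift_add hF hG) (fun c F hF => substShift_const_smul c hF)
    (fun i F hF => ?_) P hF
  fin_cases i
  · exact (substShift_X_zero_smul hF).trans (by rw [← shiftAlg_X_self]; rfl)
  · exact (substShift_X_one_smul F).trans (by
      rw [← shiftAlg_X_of_ne (s := (0 : Fin 2)) 1 (by decide : (1 : Fin 2) ≠ 0)]; rfl)

/-- `B(z, x)` is the re-expansion of `A(x + z, x)`, the poles of `A(x₁, x)` lying on `x₁ = x`. -/
def IsExp2 (A B : FDist 2 M) : Prop :=
  ∃ K : ℕ, ((X 0 - X 1) ^ K : MvPolynomial (Fin 2) ℂ) • A ∈ laurentInf 2 M ∧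
    substShift (((X 0 - X 1) ^ K : MvPolynomial (Fin 2) ℂ) • A) =
      (X 0 ^ K : MvPolynomial (Fin 2) ℂ) • B

/-- The exponent in `IsExp2` can be enlarged. -/
theorem pole_order_mono {A B : FDist 2 M} {K K' : ℕ} (hK : K ≤ K')
    (h : ((X 0 - X 1) ^ K : MvPolynomial (Fin 2) ℂ) • A ∈ laurentInf 2 M ∧
      substShift (((X 0 - X 1) ^ K : MvPolynomial (Fin 2) ℂ) • A) =
        (X 0 ^ K : MvPolynomial (Fin 2) ℂ) • B) :
    ((X 0 - X 1) ^ K' : MvPolynomial (Fin 2) ℂ) • A ∈ laurentInf 2 M ∧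
      substShift (((X 0 - X 1) ^ K' : MvPolynomial (Fin 2) ℂ) • A) =
        (X 0 ^ K' : MvPolynomial (Fin 2) ℂ) • B := by
  obtain ⟨d, rfl⟩ := Nat.exists_eq_add_of_le' hK
  refine ⟨?_, ?_⟩
  · rw [pow_add, mul_smul]; exact (laurentInf 2 M).smul_mem _ h.1
  · rw [pow_add, mul_smul, substShift_smul _ h.1, h.2, map_pow, shiftAlg_X_sub_X (by decide),
      pow_add, mul_smul]

theorem IsExp2.add {A B A' B' : FDist 2 M} (h : IsExp2 A B) (h' : IsExp2 A' B') :
    IsExp2 (A + A') (B + B') := by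
  obtain ⟨K, hK⟩ := h
  obtain ⟨K', hK'⟩ := h'
  obtain ⟨h1, h2⟩ := pole_order_mono (le_max_left K K') hK
  obtain ⟨h3, h4⟩ := pole_order_mono (le_max_right K K') hK'
  refine ⟨max K K', ?_, ?_⟩
  · rw [smul_add]; exact add_mem h1 h3
  · rw [smul_add, substShift_add h1 h3, h2, h4, smul_add]

/-- With a common pole order both candidates have the same multiple by a power of the first
variable, which acts injectively. This replaces any explicit inversion of polynomials. -/
theorem IsExp2.unique {A B B' : FDist 2 M} (h : IsExp2 A B) (h' : IsExp2 A B') : B = B' := by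
  obtain ⟨K, hK⟩ := h
  obtain ⟨K', hK'⟩ := h'
  obtain ⟨h1, h2⟩ := pole_order_mono (le_max_left K K') hK
  obtain ⟨h3, h4⟩ := pole_order_mono (le_max_right K K') hK'
  exact X_pow_smul_injective 0 (max K K') (h2.symm.trans h4)

theorem IsExp2.smul {A B : FDist 2 M} (h : IsExp2 A B) (P : MvPolynomial (Fin 2) ℂ) :
    IsExp2 (P • A) (shiftAlg 0 1 P • B) := by
  obtain ⟨K, h1, h2⟩ := h
  refine ⟨K, ?_, ?_⟩
  · rw [smul_comm]; exact (laurentInf 2 M).smul_mem _ h1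
  · rw [smul_comm, substShift_smul _ h1, h2, smul_comm]

theorem isExp2_substShift {F : FDist 2 M} (hF : F ∈ laurentInf 2 M) : IsExp2 F (substShift F) :=
  ⟨0, by simpa using hF, by simp⟩

theorem IsExp2.map {A B : FDist 2 M} (h : IsExp2 A B) (φ : M →ₗ[ℂ] M') :
    IsExp2 (mapF φ A) (mapF φ B) := by
  obtain ⟨K, h1, h2⟩ := h
  refine ⟨K, ?_, ?_⟩
  · rw [← mapF_smul]; exact mapF_mem_laurentInf φ h1
  · rw [← mapF_smul, substShift_mapF φ h1, h2, mapF_smul]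

end SubstShift

/-! ### Expansion in two chosen variables of a series in several variables -/

section Fibers

variable {r : ℕ} {M M' : Type*} [AddCommGroup M] [Module ℂ M] [AddCommGroup M'] [Module ℂ M']

/-- Replace the exponents number `s` and `t`. -/
def ins (s t : Fin r) (e : Fin r → ℤ) (f : Fin 2 → ℤ) : Fin r → ℤ :=
  Function.update (Function.update e s (f 0)) t (f 1)

/-- The coefficients of a series as a series in the variables number `s` and `t`. -/
def fib (s t : Fin r) (e : Fin r → ℤ) (A : FDist r M) : FDist 2 M := fun f => A (ins s t e f)

theorem ins_left {s t : Fin r} (h : s ≠ t) (e : Fin r → ℤ) (f : Fin 2 → ℤ) : ins s t e f s =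
    f 0 := by
  simp [ins, h]

theorem ins_right (s t : Fin r) (e : Fin r → ℤ) (f : Fin 2 → ℤ) : ins s t e f t = f 1 := by
  simp [ins]

theorem ins_of_ne {s t u : Fin r} (hs : u ≠ s) (ht : u ≠ t) (e : Fin r → ℤ) (f : Fin 2 → ℤ) :
    ins s t e f u = e u := by
  simp [ins, hs, ht]

theorem ins_self (s t : Fin r) (e : Fin r → ℤ) : ins s t e ![e s, e t] = e := by
  simp [ins]

theorem ins_ins {s t : Fin r} (h : s ≠ t) (e : Fin r → ℤ) (f g : Fin 2 → ℤ) :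
    ins s t (ins s t e f) g = ins s t e g := by
  funext u
  by_cases ht : u = t
  · subst ht; simp [ins]
  · by_cases hs : u = s
    · subst hs; simp [ins, h]
    · simp [ins, hs, ht]

theorem fib_self (s t : Fin r) (e : Fin r → ℤ) (A : FDist r M) : fib s t e A ![e s, e t] = A e := by
  rw [fib, ins_self]

theorem fib_ins {s t : Fin r} (h : s ≠ t) (e : Fin r → ℤ) (f : Fin 2 → ℤ) (A : FDist r M) :
    fib s t (ins s t e f) A = fib s t e A := by
  funext g; rw [fib, fib, ins_ins h]

theorem fib_add (s t : Fin r) (e : Fin r → ℤ) (A B : FDist r M) :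
    fib s t e (A + B) = fib s t e A + fib s t e B := rfl

theorem fib_X_left {s t : Fin r} (h : s ≠ t) (e : Fin r → ℤ) (A : FDist r M) :
    fib s t e ((X s : MvPolynomial (Fin r) ℂ) • A) = (X 0 : MvPolynomial (Fin 2) ℂ) •
      fib s t e A := by
  funext f
  rw [X_smul_apply, fib, X_smul_apply, fib]
  congr 1
  funext u
  by_cases ht : u = t
  · subst ht; simp [ins, h.symm]
  · by_cases hs : u = s
    · subst hs; simp [ins, h]
    · simp [ins, hs, ht]

theorem fib_X_right {s t : Fin r} (h : s ≠ t) (e : Fin r → ℤ) (A : FDist r M) :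
    fib s t e ((X t : MvPolynomial (Fin r) ℂ) • A) = (X 1 : MvPolynomial (Fin 2) ℂ) •
      fib s t e A := by
  funext f
  rw [X_smul_apply, fib, X_smul_apply, fib]
  congr 1
  funext u
  by_cases ht : u = t
  · subst ht; simp [ins]
  · by_cases hs : u = s
    · subst hs; simp [ins, h]
    · simp [ins, hs, ht]

theorem fib_X_of_ne {s t u : Fin r} (hs : u ≠ s) (ht : u ≠ t) (e : Fin r → ℤ) (A : FDist r M) :
    fib s t e ((X u : MvPolynomial (Fin r) ℂ) • A) = fib s t (e - Pi.single u 1) A := by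
  funext f
  rw [fib, X_smul_apply, fib]
  congr 1
  funext v
  by_cases hvt : v = t
  · subst hvt; simp [ins, ht.symm]
  · by_cases hvs : v = s
    · subst hvs; simp [ins, hvt, hs.symm]
    · simp [ins, hvs, hvt]

/-- The polynomials in the two variables of a fibre act fibrewise. -/
theorem fib_smul {s t : Fin r} (h : s ≠ t) (e : Fin r → ℤ) (P : MvPolynomial (Fin 2) ℂ)
    (A : FDist r M) :
    fib s t e (MvPolynomial.rename ![s, t] P • A) = P • fib s t e A := by
  induction P using MvPolynomial.induction_on generalizing A with
  | C c => rw [MvPolynomial.rename_C, C_smul, C_smul]; rfl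
  | add p q hp hq => rw [map_add, add_smul, add_smul, fib_add, hp, hq]
  | mul_X p i hp =>
    rw [map_mul, mul_smul, mul_smul, hp, MvPolynomial.rename_X]
    congr 1
    fin_cases i
    · exact fib_X_left h e A
    · exact fib_X_right h e A

/-- `IsExp2` for two of the variables, fibrewise in the other ones. -/
def IsExp (s t : Fin r) (A B : FDist r M) : Prop := ∀ e, IsExp2 (fib s t e A) (fib s t e B)

theorem IsExp.add {s t : Fin r} {A B A' B' : FDist r M} (h : IsExp s t A B)
    (h' : IsExp s t A' B') : IsExp s t (A + A') (B + B') := fun e => (h e).add (h' e)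

theorem IsExp.unique {s t : Fin r} {A B B' : FDist r M} (h : IsExp s t A B)
    (h' : IsExp s t A B') : B = B' := by
  funext e
  rw [← fib_self s t e B, (h e).unique (h' e), fib_self]

theorem isExp_zero (s t : Fin r) : IsExp s t (0 : FDist r M) 0 := fun e =>
  ⟨0, by simp only [pow_zero, one_smul]; exact zero_mem (laurentInf 2 M), by
    simp only [pow_zero, one_smul]
    funext f
    rw [substShift_apply]
    exact finsum_eq_zero_of_forall_eq_zero fun m => smul_zero _⟩

theorem IsExp.sum {ι : Type*} {s t : Fin r} {A B : ι → FDist r M} (I : Finset ι)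
    (h : ∀ i, IsExp s t (A i) (B i)) : IsExp s t (∑ i ∈ I, A i) (∑ i ∈ I, B i) := by
  classical
  induction I using Finset.induction_on with
  | empty => simpa using isExp_zero s t
  | insert i I hi ih => rw [Finset.sum_insert hi, Finset.sum_insert hi]; exact (h i).add ih

theorem IsExp.smul {s t : Fin r} (hst : s ≠ t) {A B : FDist r M} (h : IsExp s t A B)
    (P : MvPolynomial (Fin r) ℂ) : IsExp s t (P • A) (shiftAlg s t P • B) := by
  induction P using MvPolynomial.induction_on with
  | C c =>
    have : shiftAlg s t (C c) = C c := (shiftAlg s t).commutes c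
    rw [this, C_smul, C_smul]
    intro e
    have := (h e).smul (C c)
    rwa [show shiftAlg (0 : Fin 2) 1 (C c) = C c from (shiftAlg (0 : Fin 2) 1).commutes c, C_smul,
      C_smul] at this
  | add p q hp hq => rw [map_add, add_smul, add_smul]; exact hp.add hq
  | mul_X p u hp =>
    rw [map_mul, mul_comm p, mul_comm (shiftAlg s t p), mul_smul, mul_smul]
    intro e
    by_cases hs : u = s
    · subst hs
      rw [fib_X_left hst, shiftAlg_X_self, add_smul, fib_add, fib_X_left hst, fib_X_right hst,
        ← add_smul, ← shiftAlg_X_self]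
      exact (hp e).smul _
    · rw [shiftAlg_X_of_ne _ hs]
      by_cases ht : u = t
      · subst ht
        rw [fib_X_right hst, fib_X_right hst]
        have := (hp e).smul (X 1)
        rwa [shiftAlg_X_of_ne _ (by decide)] at this
      -- A third variable only moves the base point of the fibre, and the hypothesis holds at every
      -- base point.
      · rw [fib_X_of_ne hs ht, fib_X_of_ne hs ht]
        exact hp _

/-- The substitution `x_s ↦ x_t + x_s`, with powers expanded in nonnegative powers of `x_s`. -/
def substVar (s t : Fin r) (F : FDist r M) : FDist r M := fun e =>
  substShift (fib s t e F) ![e s, e t]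

theorem fib_substVar {s t : Fin r} (h : s ≠ t) (e : Fin r → ℤ) (F : FDist r M) :
    fib s t e (substVar s t F) = substShift (fib s t e F) := by
  funext f
  rw [fib, substVar, fib_ins h, ins_left h, ins_right]
  congr 1
  funext i; fin_cases i <;> rfl

theorem isExp_substVar {s t : Fin r} (h : s ≠ t) {F : FDist r M}
    (hF : ∀ e, fib s t e F ∈ laurentInf 2 M) : IsExp s t F (substVar s t F) := by
  intro e
  rw [fib_substVar h]
  exact isExp2_substShift (hF e)

theorem fib_mem_laurentInf {s t : Fin r} (h : s ≠ t) {F : FDist r M} (hF : F ∈ laurentInf r M)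
    (e : Fin r → ℤ) : fib s t e F ∈ laurentInf 2 M := by
  obtain ⟨N, hN⟩ := mem_laurentInf.1 hF
  refine mem_laurentInf.2 ⟨N, fun f ⟨i, hi⟩ => hN _ ?_⟩
  fin_cases i
  · exact ⟨s, by rwa [ins_left h]⟩
  · exact ⟨t, by rwa [ins_right]⟩

end Fibers

end VAInf
end

noncomputable section
namespace VAInf

open MvPolynomial (X C)

/-! ### Iterated substitutions in three variables -/

section ThreeVariables

variable {M : Type*} [AddCommGroup M] [Module ℂ M]

/-- Since C(p+i,i) C(α,p+i) = C(α,p) C(α-p,i), the sum over `i` is the Chu-Vandermonde sum for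
C(α-p+β,q). For negative `p` the surviving terms have 0 ≤ p+i < i, where the first binomial
vanishes. -/
theorem bin_mul_bin_vandermonde (α β p q : ℤ) :
    (∑ᶠ i : ℕ, Ring.choose (p + i) i * (bin α (p + i) * bin β (q - i))) =
      bin α p * bin (α - p + β) q := by
  rcases lt_or_ge q 0 with hq | hq
  · rw [bin_of_neg _ hq, mul_zero]
    exact finsum_eq_zero_of_forall_eq_zero fun i => by rw [bin_of_neg β (by omega)]; ring
  rcases lt_or_ge p 0 with hp | hp
  · rw [bin_of_neg _ hp, zero_mul]
    refine finsum_eq_zero_of_forall_eq_zero fun i => ?_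
    rcases lt_or_ge (p + i) 0 with h | h
    · rw [bin_of_neg _ h]; ring
    · obtain ⟨n, hn⟩ := Int.eq_ofNat_of_zero_le h
      rw [hn, Ring.choose_natCast, Nat.choose_eq_zero_of_lt (by omega)]
      simp
  obtain ⟨a, rfl⟩ := Int.eq_ofNat_of_zero_le hp
  obtain ⟨b, rfl⟩ := Int.eq_ofNat_of_zero_le hq
  rw [finsum_eq_sum_of_support_subset (s := Finset.range (b + 1))]
  · rw [bin_natCast, bin_natCast, Ring.add_choose_eq _ (Commute.all _ _),
      Finset.Nat.sum_antidiagonal_eq_sum_range_succ_mk, Finset.mul_sum]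
    refine Finset.sum_congr rfl fun i hi => ?_
    have hib : i ≤ b := Nat.lt_succ_iff.1 (Finset.mem_range.1 hi)
    rw [show (a : ℤ) + i = ((a + i : ℕ) : ℤ) by push_cast; ring,
      show (b : ℤ) - i = ((b - i : ℕ) : ℤ) by omega, bin_natCast, bin_natCast,
      Ring.choose_natCast, ← mul_assoc, ← mul_assoc]
    congr 1
    have := Ring.choose_smul_choose α (Nat.le_add_right a i)
    rw [Nat.add_sub_cancel_left] at this
    rw [← this, nsmul_eq_mul, Nat.choose_symm_add]
  · intro i hi
    rw [Finset.coe_range, Set.mem_Iio]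
    by_contra h
    exact hi (by dsimp only; rw [bin_of_neg β (by omega)]; ring)

theorem substVar_zero_two (F : FDist 3 M) (e : Fin 3 → ℤ) :
    substVar 0 2 F e = ∑ᶠ m : ℤ, bin (m + e 0) (e 0) • F ![m + e 0, e 1, e 2 - m] := by
  rw [substVar, substShift_apply]
  refine finsum_congr fun m => ?_
  simp only [fib]
  congr 2
  funext i; fin_cases i <;> simp [ins]

theorem substVar_one_two (F : FDist 3 M) (e : Fin 3 → ℤ) :
    substVar 1 2 F e = ∑ᶠ m : ℤ, bin (m + e 1) (e 1) • F ![e 0, m + e 1, e 2 - m] := by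
  rw [substVar, substShift_apply]
  refine finsum_congr fun m => ?_
  simp only [fib]
  congr 2
  funext i; fin_cases i <;> simp [ins]

theorem substVar_zero_one (F : FDist 3 M) (e : Fin 3 → ℤ) :
    substVar 0 1 F e = ∑ᶠ m : ℤ, bin (m + e 0) (e 0) • F ![m + e 0, e 1 - m, e 2] := by
  rw [substVar, substShift_apply]
  refine finsum_congr fun m => ?_
  simp only [fib]
  congr 2
  funext i; fin_cases i <;> simp [ins]

/-- For `A(x₁, x₂, x)`, the series `A(x₀ + x₂, x₂, x)`, expanded in nonnegative powers of `x₂`. -/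
def assocVar (A : FDist 3 M) : FDist 3 M := fun e =>
  ∑ᶠ i : ℕ, (Ring.choose (e 0 + i) i : ℤ) • A ![e 0 + i, e 1 - i, e 2]

theorem substVar_apply_eq_zero_of_neg {r : ℕ} {s t : Fin r} {F : FDist r M} {e : Fin r → ℤ}
    (he : e s < 0) : substVar s t F e = 0 := by
  rw [substVar, substShift, if_neg]
  simpa using he

theorem fib_zero_two_substVar_one_two {F : FDist 3 M} (hF : F ∈ laurentInf 3 M) (e : Fin 3 → ℤ) :
    fib 0 2 e (substVar 1 2 F) ∈ laurentInf 2 M := by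
  obtain ⟨N, hN⟩ := mem_laurentInf.1 hF
  refine mem_laurentInf.2 ⟨max N (2 * N - e 1), fun f ⟨i, hi⟩ => ?_⟩
  rw [fib, substVar_one_two]
  refine finsum_eq_zero_of_forall_eq_zero fun m => ?_
  rw [ins_of_ne (by decide) (by decide), ins_left (by decide), ins_right, hN, smul_zero]
  fin_cases i
  · exact ⟨0, by simp at hi ⊢; omega⟩
  · simp at hi
    by_cases h : N < m + e 1
    · exact ⟨1, by simpa using h⟩
    · exact ⟨2, by simp; omega⟩

theorem fib_one_two_substVar_zero_two {F : FDist 3 M} (hF : F ∈ laurentInf 3 M) (e : Fin 3 → ℤ) :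
    fib 1 2 e (substVar 0 2 F) ∈ laurentInf 2 M := by
  obtain ⟨N, hN⟩ := mem_laurentInf.1 hF
  refine mem_laurentInf.2 ⟨max N (2 * N - e 0), fun f ⟨i, hi⟩ => ?_⟩
  rw [fib, substVar_zero_two]
  refine finsum_eq_zero_of_forall_eq_zero fun m => ?_
  rw [ins_of_ne (by decide) (by decide), ins_left (by decide), ins_right, hN, smul_zero]
  fin_cases i
  · exact ⟨1, by simp at hi ⊢; omega⟩
  · simp at hi
    by_cases h : N < m + e 0
    · exact ⟨0, by simpa using h⟩
    · exact ⟨2, by simp; omega⟩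

theorem fib_one_two_substVar_zero_one {F : FDist 3 M} (hF : F ∈ laurentInf 3 M) (e : Fin 3 → ℤ) :
    fib 1 2 e (substVar 0 1 F) ∈ laurentInf 2 M := by
  obtain ⟨N, hN⟩ := mem_laurentInf.1 hF
  refine mem_laurentInf.2 ⟨max N (2 * N - e 0), fun f ⟨i, hi⟩ => ?_⟩
  rw [fib, substVar_zero_one]
  refine finsum_eq_zero_of_forall_eq_zero fun m => ?_
  rw [ins_of_ne (by decide) (by decide), ins_left (by decide), ins_right, hN, smul_zero]
  fin_cases i
  · simp at hi
    by_cases h : N < m + e 0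
    · exact ⟨0, by simpa using h⟩
    · exact ⟨1, by simp; omega⟩
  · exact ⟨2, by simp at hi ⊢; omega⟩

theorem substVar_add {r : ℕ} {s t : Fin r} {F G : FDist r M}
    (hF : ∀ e, fib s t e F ∈ laurentInf 2 M) (hG : ∀ e, fib s t e G ∈ laurentInf 2 M) :
    substVar s t (F + G) = substVar s t F + substVar s t G := by
  funext e
  rw [substVar, fib_add, substShift_add (hF e) (hG e)]
  rfl

theorem assocVar_add {A B : FDist 3 M} (hA : ∀ e : Fin 3 → ℤ, e 1 < 0 → A e = 0)
    (hB : ∀ e : Fin 3 → ℤ, e 1 < 0 → B e = 0) : assocVar (A + B) = assocVar A + assocVar B := by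
  have key : ∀ A : FDist 3 M, (∀ e : Fin 3 → ℤ, e 1 < 0 → A e = 0) → ∀ e : Fin 3 → ℤ,
      (Function.support fun i : ℕ =>
        (Ring.choose (e 0 + i) i : ℤ) • A ![e 0 + i, e 1 - i, e 2]).Finite := by
    intro A hA e
    refine (Set.finite_Iic (e 1).toNat).subset fun i hi => ?_
    rw [Set.mem_Iic]
    by_contra h
    exact hi (by dsimp only; rw [hA _ (by simp; omega), smul_zero])
  funext e
  simp only [assocVar, Pi.add_apply, smul_add]
  exact finsum_add_distrib (key A hA e) (key B hB e)

/-- The total degree of a monomial in three variables. -/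
abbrev deg3 (e : Fin 3 → ℤ) : ℤ := e 0 + e 1 + e 2

/-- The value of `T F` at `e` depends only on the coefficients of `F` of the total degree of `e`. -/
def IsDegLocal (T : FDist 3 M → FDist 3 M) : Prop :=
  ∀ F G e, (∀ e', deg3 e' = deg3 e → F e' = G e') → T F e = T G e

theorem IsDegLocal.comp {T T' : FDist 3 M → FDist 3 M} (h : IsDegLocal T) (h' : IsDegLocal T') :
    IsDegLocal fun F => T (T' F) := fun F G e hFG =>
  h _ _ e fun e' he' => h' F G e' fun e'' he'' => hFG e'' (he''.trans he')

theorem isDegLocal_substVar_zero_two : IsDegLocal (substVar (M := M) (0 : Fin 3) 2) := by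
  intro F G e h
  rw [substVar_zero_two, substVar_zero_two]
  exact finsum_congr fun m => by rw [h]; simp [deg3]; ring

theorem isDegLocal_substVar_one_two : IsDegLocal (substVar (M := M) (1 : Fin 3) 2) := by
  intro F G e h
  rw [substVar_one_two, substVar_one_two]
  exact finsum_congr fun m => by rw [h]; simp [deg3]; ring

theorem isDegLocal_substVar_zero_one : IsDegLocal (substVar (M := M) (0 : Fin 3) 1) := by
  intro F G e h
  rw [substVar_zero_one, substVar_zero_one]
  exact finsum_congr fun m => by rw [h]; simp [deg3]; ring

theorem isDegLocal_assocVar : IsDegLocal (assocVar (M := M)) := by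
  intro F G e h
  rw [assocVar, assocVar]
  exact finsum_congr fun m => by rw [h]; simp [deg3]

theorem single_mem_laurentInf {r : ℕ} (α : Fin r → ℤ) (v : M) :
    (Pi.single α v : FDist r M) ∈ laurentInf r M := by
  refine mem_laurentInf'.2 fun i => ⟨α i, fun e he => ?_⟩
  rw [Pi.single_eq_of_ne]
  rintro rfl
  exact lt_irrefl _ he

/-- Two degree-local additive maps on `M((x₁⁻¹, x₂⁻¹, x₃⁻¹))` that agree on monomials are equal. -/
theorem eq_on_laurentInf_of_single {T T' : FDist 3 M → FDist 3 M} (hT : IsDegLocal T)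
    (hT' : IsDegLocal T')
    (hadd : ∀ F ∈ laurentInf 3 M, ∀ G ∈ laurentInf 3 M, T (F + G) = T F + T G)
    (hadd' : ∀ F ∈ laurentInf 3 M, ∀ G ∈ laurentInf 3 M, T' (F + G) = T' F + T' G)
    (h : ∀ (α : Fin 3 → ℤ) (v : M), T (Pi.single α v) = T' (Pi.single α v))
    {F : FDist 3 M} (hF : F ∈ laurentInf 3 M) : T F = T' F := by
  funext e
  obtain ⟨N, hN⟩ := mem_laurentInf.1 hF
  -- All exponents are at most `N` and their sum is fixed, so each is at least the degree minus 2N.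
  have hfin : {e' | deg3 e' = deg3 e ∧ F e' ≠ 0}.Finite := by
    refine (Set.finite_Icc (fun _ => deg3 e - 2 * N) (fun _ => N : Fin 3 → ℤ)).subset ?_
    rintro e' ⟨h1, h2⟩
    have hle : ∀ i, e' i ≤ N := fun i => by
      by_contra hi
      exact h2 (hN e' ⟨i, not_le.1 hi⟩)
    have h0 := hle 0
    have h1' := hle 1
    have h2' := hle 2
    simp only [deg3] at h1
    refine Set.mem_Icc.2 ⟨fun i => ?_, hle⟩
    simp only [deg3]
    fin_cases i <;> simp <;> omega
  have hG : ∀ I : Finset (Fin 3 → ℤ), (∑ α ∈ I, (Pi.single α (F α) : FDist 3 M)) ∈ laurentInf 3 M ∧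
      T (∑ α ∈ I, (Pi.single α (F α) : FDist 3 M)) = T' (∑ α ∈ I, Pi.single α (F α)) := by
    intro I
    induction I using Finset.induction_on with
    | empty =>
      refine ⟨by simp, ?_⟩
      have h0 := hadd 0 (zero_mem _) 0 (zero_mem _)
      have h0' := hadd' 0 (zero_mem _) 0 (zero_mem _)
      rw [add_zero] at h0 h0'
      rw [Finset.sum_empty, left_eq_add.1 h0, left_eq_add.1 h0']
    | insert α I hα ih =>
      rw [Finset.sum_insert hα]
      refine ⟨add_mem (single_mem_laurentInf _ _) ih.1, ?_⟩
      rw [hadd _ (single_mem_laurentInf _ _) _ ih.1, hadd' _ (single_mem_laurentInf _ _) _ ih.1, h,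
        ih.2]
  have hagree : ∀ e', deg3 e' = deg3 e →
      F e' = (∑ α ∈ hfin.toFinset, (Pi.single α (F α) : FDist 3 M)) e' := by
    intro e' he'
    rw [Finset.sum_apply]
    by_cases h0 : F e' = 0
    · rw [h0, Finset.sum_eq_zero]
      intro α hα
      by_cases hαe : e' = α
      · subst hαe; simp [h0]
      · simp [hαe]
    · rw [Finset.sum_eq_single e']
      · simp
      · intro α _ hα; simp [hα.symm]
      · intro hn; exact absurd (hfin.mem_toFinset.2 ⟨he', h0⟩) hn
  rw [hT _ _ e hagree, hT' _ _ e hagree, (hG _).2]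

theorem finsum_bin_smul_single (c : ℤ → ℤ) (m₀ : ℤ) (F : ℤ → M) (hF : ∀ m, m ≠ m₀ → F m = 0) :
    ∑ᶠ m, c m • F m = c m₀ • F m₀ :=
  finsum_eq_single _ m₀ fun m hm => by rw [hF m hm, smul_zero]

theorem substVar_one_two_single (α : Fin 3 → ℤ) (v : M) (e : Fin 3 → ℤ) :
    substVar 1 2 (Pi.single α v : FDist 3 M) e =
      if e 0 = α 0 ∧ e 1 + e 2 = α 1 + α 2 then bin (α 1) (e 1) • v else 0 := by
  rw [substVar_one_two, finsum_bin_smul_single _ (α 1 - e 1)]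
  · rw [sub_add_cancel, Pi.single_apply]
    simp only [funext_iff, Fin.forall_fin_succ, smul_ite, smul_zero]
    refine if_congr ?_ rfl rfl
    simp
    omega
  · intro m hm
    rw [Pi.single_eq_of_ne]
    intro h
    apply hm
    have := congrFun h 1
    simp at this
    omega

theorem substVar_zero_two_single (α : Fin 3 → ℤ) (v : M) (e : Fin 3 → ℤ) :
    substVar 0 2 (Pi.single α v : FDist 3 M) e =
      if e 1 = α 1 ∧ e 0 + e 2 = α 0 + α 2 then bin (α 0) (e 0) • v else 0 := by
  rw [substVar_zero_two, finsum_bin_smul_single _ (α 0 - e 0)]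
  · rw [sub_add_cancel, Pi.single_apply]
    simp only [funext_iff, Fin.forall_fin_succ, smul_ite, smul_zero]
    refine if_congr ?_ rfl rfl
    simp
    omega
  · intro m hm
    rw [Pi.single_eq_of_ne]
    intro h
    apply hm
    have := congrFun h 0
    simp at this
    omega

theorem substVar_zero_one_single (α : Fin 3 → ℤ) (v : M) (e : Fin 3 → ℤ) :
    substVar 0 1 (Pi.single α v : FDist 3 M) e =
      if e 2 = α 2 ∧ e 0 + e 1 = α 0 + α 1 then bin (α 0) (e 0) • v else 0 := by
  rw [substVar_zero_one, finsum_bin_smul_single _ (α 0 - e 0)]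
  · rw [sub_add_cancel, Pi.single_apply]
    simp only [funext_iff, Fin.forall_fin_succ, smul_ite, smul_zero]
    refine if_congr ?_ rfl rfl
    simp
    omega
  · intro m hm
    rw [Pi.single_eq_of_ne]
    intro h
    apply hm
    have := congrFun h 0
    simp at this
    omega

theorem substVar_zero_two_one_two_single (α : Fin 3 → ℤ) (v : M) (e : Fin 3 → ℤ) :
    substVar 0 2 (substVar 1 2 (Pi.single α v : FDist 3 M)) e =
      if deg3 e = deg3 α then (bin (α 0) (e 0) * bin (α 1) (e 1)) • v else 0 := by
  rw [substVar_zero_two, finsum_bin_smul_single _ (α 0 - e 0)]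
  · rw [substVar_one_two_single, sub_add_cancel, smul_ite, smul_zero, mul_smul]
    refine if_congr ?_ rfl rfl
    simp [deg3]
    omega
  · intro m hm
    rw [substVar_one_two_single, if_neg]
    rintro ⟨h, _⟩
    apply hm
    simp at h
    omega

theorem substVar_one_two_zero_two_single (α : Fin 3 → ℤ) (v : M) (e : Fin 3 → ℤ) :
    substVar 1 2 (substVar 0 2 (Pi.single α v : FDist 3 M)) e =
      if deg3 e = deg3 α then (bin (α 0) (e 0) * bin (α 1) (e 1)) • v else 0 := by
  rw [substVar_one_two, finsum_bin_smul_single _ (α 1 - e 1)]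
  · rw [substVar_zero_two_single, sub_add_cancel, smul_ite, smul_zero, mul_comm, mul_smul]
    refine if_congr ?_ rfl rfl
    simp [deg3]
    omega
  · intro m hm
    rw [substVar_zero_two_single, if_neg]
    rintro ⟨h, _⟩
    apply hm
    simp at h
    omega

theorem substVar_one_two_zero_one_single (α : Fin 3 → ℤ) (v : M) (e : Fin 3 → ℤ) :
    substVar 1 2 (substVar 0 1 (Pi.single α v : FDist 3 M)) e =
      if deg3 e = deg3 α then (bin (α 0) (e 0) * bin (α 0 - e 0 + α 1) (e 1)) • v else 0 := by
  rw [substVar_one_two, finsum_bin_smul_single _ (α 0 - e 0 + α 1 - e 1)]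
  · rw [substVar_zero_one_single, sub_add_cancel, smul_ite, smul_zero, mul_comm, mul_smul]
    refine if_congr ?_ rfl rfl
    simp [deg3]
    omega
  · intro m hm
    rw [substVar_zero_one_single, if_neg]
    rintro ⟨_, h⟩
    apply hm
    simp at h
    omega

/-- For a monomial both sides expand (x+z₀+z₁)^α₀ (x+z₁)^α₁ x^α₂; equality of the coefficients is
`bin_mul_bin_vandermonde`. -/
theorem assocVar_single (α : Fin 3 → ℤ) (v : M) :
    assocVar (substVar 0 2 (substVar 1 2 (Pi.single α v : FDist 3 M))) =
      substVar 1 2 (substVar 0 1 (Pi.single α v)) := by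
  funext e
  rw [substVar_one_two_zero_one_single, assocVar]
  simp only [substVar_zero_two_one_two_single]
  by_cases h : deg3 e = deg3 α
  · have hfin : (Function.support fun i : ℕ => Ring.choose (e 0 + i) i *
        (bin (α 0) (e 0 + i) * bin (α 1) (e 1 - i))).Finite := by
      refine (Set.finite_Iic (e 1).toNat).subset fun i hi => ?_
      rw [Set.mem_Iic]
      by_contra h
      exact hi (by dsimp only; rw [bin_of_neg (α 1) (by omega)]; ring)
    rw [if_pos h, ← bin_mul_bin_vandermonde, finsum_smul' hfin]
    refine finsum_congr fun i => ?_
    rw [if_pos (by rw [← h]; simp [deg3]), mul_smul, mul_smul, mul_smul]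
    rfl
  · rw [if_neg h]
    refine finsum_eq_zero_of_forall_eq_zero fun i => ?_
    rw [if_neg, smul_zero]
    intro h'
    apply h
    rw [← h']; simp [deg3]

theorem substVar_comp_add {s t s' t' : Fin 3}
    (h : ∀ F ∈ laurentInf 3 M, ∀ e, fib s' t' e (substVar s t F) ∈ laurentInf 2 M) (hst : s ≠ t)
    {F G : FDist 3 M} (hF : F ∈ laurentInf 3 M) (hG : G ∈ laurentInf 3 M) :
    substVar s' t' (substVar s t (F + G)) =
      substVar s' t' (substVar s t F) + substVar s' t' (substVar s t G) := by
  rw [substVar_add (fib_mem_laurentInf hst hF) (fib_mem_laurentInf hst hG),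
    substVar_add (h F hF) (h G hG)]

theorem substVar_one_two_neg {F : FDist 3 M} (e : Fin 3 → ℤ) (he : e 1 < 0) :
    substVar 0 2 (substVar 1 2 F) e = 0 := by
  rw [substVar_zero_two]
  refine finsum_eq_zero_of_forall_eq_zero fun m => ?_
  rw [substVar_apply_eq_zero_of_neg (by simpa using he), smul_zero]

theorem substVar_comm {F : FDist 3 M} (hF : F ∈ laurentInf 3 M) :
    substVar 0 2 (substVar 1 2 F) = substVar 1 2 (substVar 0 2 F) :=
  eq_on_laurentInf_of_single (T := fun F => substVar 0 2 (substVar 1 2 F))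
    (T' := fun F => substVar 1 2 (substVar 0 2 F))
    (isDegLocal_substVar_zero_two.comp isDegLocal_substVar_one_two)
    (isDegLocal_substVar_one_two.comp isDegLocal_substVar_zero_two)
    (fun _ hF _ hG => substVar_comp_add (fun _ h => fib_zero_two_substVar_one_two h)
        (by decide) hF hG)
    (fun _ hF _ hG => substVar_comp_add (fun _ h => fib_one_two_substVar_zero_two h)
        (by decide) hF hG)
    (fun α v => funext fun e => by
      rw [substVar_zero_two_one_two_single, substVar_one_two_zero_two_single]) hF

/-- The formal core of associativity: substituting x₁ = x+z₁, x₂ = x+z₂ and then z₁ = z₀+z₂ is the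
same as substituting x₁ = x₂+z₀ and then x₂ = x+z₂. All maps involved are degree-local, so monomials
suffice. -/
theorem assocVar_substVar {F : FDist 3 M} (hF : F ∈ laurentInf 3 M) :
    assocVar (substVar 0 2 (substVar 1 2 F)) = substVar 1 2 (substVar 0 1 F) :=
  eq_on_laurentInf_of_single (T := fun F => assocVar (substVar 0 2 (substVar 1 2 F)))
    (T' := fun F => substVar 1 2 (substVar 0 1 F))
    (isDegLocal_assocVar.comp (isDegLocal_substVar_zero_two.comp isDegLocal_substVar_one_two))
    (isDegLocal_substVar_one_two.comp isDegLocal_substVar_zero_one)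
    (fun _ hF _ hG => by
      rw [substVar_comp_add (fun _ h => fib_zero_two_substVar_one_two h) (by decide) hF hG,
        assocVar_add substVar_one_two_neg substVar_one_two_neg])
    (fun _ hF _ hG => substVar_comp_add (fun _ h => fib_one_two_substVar_zero_one h)
        (by decide) hF hG)
    assocVar_single hF

end ThreeVariables

end VAInf
end

noncomputable section
namespace VAInf

open MvPolynomial (X C)

/-! ### The operations `a(x)_n b(x)` as expansion coefficients -/

section NthProd

variable {W : Type*} [AddCommGroup W] [Module ℂ W]

/-- `a(x₁) b(x₂) w`. -/
def prod2 (a b : EInf W) (w : W) : FDist 2 W := fun e => coeffInf a (e 0) (coeffInf b (e 1) w)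

/-- `(Y(a(x), x₀) b)(x) w`, in the variables `x₀` and `x`. -/
def yser (a b : EInf W) (w : W) : FDist 2 W := fun e => coeffInf (nthProd a (-e 0 - 1) b) (e 1) w

theorem eInf_ext {a b : EInf W} (h : ∀ m w, coeffInf a m w = coeffInf b m w) : a = b := by
  refine HVertexOperator.coeff_inj ?_
  funext n
  refine LinearMap.ext fun w => ?_
  have := h (-n) w
  rwa [coeffInf, coeffInf, neg_neg] at this

theorem coeffInf_add (a b : EInf W) (m : ℤ) : coeffInf (a + b) m = coeffInf a m + coeffInf b m := by
  rw [coeffInf, map_add]; rfl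

theorem coeffInf_smul (c : ℂ) (a : EInf W) (m : ℤ) : coeffInf (c • a) m = c • coeffInf a m := by
  rw [coeffInf, map_smul]; rfl

theorem coeffInf_zero (m : ℤ) : coeffInf (0 : EInf W) m = 0 := by
  rw [coeffInf, map_zero]; rfl

theorem coeffInf_bddAbove (a : EInf W) (w : W) : ∃ N : ℤ, ∀ m, N < m → coeffInf a m w = 0 := by
  refine ⟨-((HahnModule.of ℂ).symm (a w)).order, fun m hm => ?_⟩
  exact HahnSeries.coeff_eq_zero_of_lt_order (by omega)

theorem coeffInf_idInf (m : ℤ) : coeffInf (idInf W) m = if m = 0 then LinearMap.id else 0 := by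
  rw [coeffInf, idInf, HVertexOperator.coeff_of_coeff]
  simp only [neg_eq_zero]

theorem appVec_opProd_pair (p : MvPolynomial (Fin 2) ℂ) (a b : EInf W) (w : W) :
    appVec (polyMul p (opProd ![coeffInf a, coeffInf b])) w = p • prod2 a b w := by
  rw [← polySMul_def, appVec_smul]
  congr 1

theorem clears_iff {a b : EInf W} {p : MvPolynomial (Fin 2) ℂ} :
    Clears a b p ↔ p ≠ 0 ∧ ∀ w, p • prod2 a b w ∈ laurentInf 2 W := by
  constructor
  · rintro ⟨h, h'⟩
    refine ⟨h, fun w => ?_⟩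
    rw [← appVec_opProd_pair]
    exact isHomLaurentInf_iff.1 h' w
  · rintro ⟨h, h'⟩
    refine ⟨h, isHomLaurentInf_iff.2 fun w => ?_⟩
    rw [appVec_opProd_pair]
    exact h' w

/-- The coefficients of `v(x₀)(x) w` for `v ∈ Hom(W, W((x⁻¹)))((x₀))`. -/
def seriesCoeff (w : W) (v : EInfSeries W) : FDist 2 W := fun e =>
  coeffInf (((HahnModule.of (LaurentField ℂ)).symm v).coeff (e 0)) (e 1) w

theorem eInfSeries_ext {v v' : EInfSeries W} (h : ∀ w, seriesCoeff w v = seriesCoeff w v') :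
    v = v' := by
  refine HahnModule.ext _ _ ?_
  funext n
  exact eInf_ext fun m w => congrFun (h w) ![n, m]

theorem seriesCoeff_add (w : W) (v v' : EInfSeries W) :
    seriesCoeff w (v + v') = seriesCoeff w v + seriesCoeff w v' := by
  funext e
  simp [seriesCoeff, coeffInf_add]

/-- The element `x` of `ℂ((x⁻¹))`. -/
abbrev varInf : LaurentField ℂ := HahnSeries.single (-1 : ℤ) (1 : ℂ)

/-- The embedding of `ℂ[x₀, x]` into `ℂ((x⁻¹))((x₀))`. -/
def polyToLaurent : MvPolynomial (Fin 2) ℂ →ₐ[ℂ] LaurentField (LaurentField ℂ) :=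
  MvPolynomial.aeval ![HahnSeries.single (1 : ℤ) (1 : LaurentField ℂ), HahnSeries.C varInf]

theorem algebraMap_laurentField (c : ℂ) : algebraMap ℂ (LaurentField (LaurentField ℂ)) c =
    HahnSeries.C (HahnSeries.C c : LaurentField ℂ) := by
  have h1 : algebraMap ℂ (LaurentField ℂ) c = HahnSeries.C c := by
    rw [HahnSeries.algebraMap_apply', PowerSeries.algebraMap_apply, HahnSeries.ofPowerSeries_C]
    rfl
  rw [HahnSeries.algebraMap_apply', PowerSeries.algebraMap_apply, HahnSeries.ofPowerSeries_C, h1]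

theorem polyToLaurent_C (c : ℂ) :
    polyToLaurent (C c) = HahnSeries.C (HahnSeries.C c : LaurentField ℂ) := by
  rw [polyToLaurent, MvPolynomial.aeval_C, algebraMap_laurentField]

theorem C_smul_seriesCoeff (s : LaurentField ℂ) (w : W) (v : EInfSeries W) (e : Fin 2 → ℤ) :
    seriesCoeff w ((HahnSeries.C s : LaurentField (LaurentField ℂ)) • v) e =
      ((HahnModule.of ℂ).symm
        (s • (((HahnModule.of (LaurentField ℂ)).symm v).coeff (e 0) w))).coeff (-(e 1)) := by
  rw [seriesCoeff, HahnSeries.C_apply, HahnModule.coeff_single_zero_smul]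
  rfl

/-- Links the vector space structure over the field ℂ((x⁻¹))((x₀)), in which `nthProd` is defined,
with the polynomial action on coefficients. The variable x is the power -1 of the Hahn variable,
hence the change of sign in its exponent. -/
theorem seriesCoeff_polyToLaurent_smul (w : W) (p : MvPolynomial (Fin 2) ℂ) (v : EInfSeries W) :
    seriesCoeff w (polyToLaurent p • v) = p • seriesCoeff w v := by
  induction p using MvPolynomial.induction_on generalizing v with
  | C c =>
    rw [polyToLaurent_C, C_smul]
    funext e
    rw [C_smul_seriesCoeff, HahnSeries.C_apply, HahnModule.coeff_single_zero_smul]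
    rfl
  | add p q hp hq => rw [map_add, add_smul, seriesCoeff_add, hp, hq, add_smul]
  | mul_X p i hp =>
    rw [map_mul, mul_smul, hp, mul_smul]
    congr 1
    funext e
    rw [X_smul_apply]
    fin_cases i
    · have h1 : polyToLaurent (X 0) = HahnSeries.single (1 : ℤ) (1 : LaurentField ℂ) := by
        simp [polyToLaurent]
      change seriesCoeff w (polyToLaurent (X 0) • v) e = _
      rw [h1, seriesCoeff]
      have h2 : e 0 = (1 : ℤ) +ᵥ (e 0 - 1) := by simp
      rw [h2, HahnModule.coeff_single_smul_vadd, one_smul]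
      simp [seriesCoeff]
    · have h1 : polyToLaurent (X 1) = HahnSeries.C varInf := by simp [polyToLaurent]
      change seriesCoeff w (polyToLaurent (X 1) • v) e = _
      rw [h1, C_smul_seriesCoeff]
      have h2 : -(e 1) = (-1 : ℤ) +ᵥ (-(e 1 - 1)) := by rw [vadd_eq_add]; ring
      rw [h2, HahnModule.coeff_single_smul_vadd, one_smul]
      change _ = ((HahnModule.of ℂ).symm (((HahnModule.of (LaurentField ℂ)).symm v).coeff
        ((e - Pi.single 1 1 : Fin 2 → ℤ) 0) w)).coeff (-((e - Pi.single 1 1 : Fin 2 → ℤ) 1))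
      simp

theorem polyToLaurent_monomial (d : Fin 2 →₀ ℕ) (c : ℂ) :
    polyToLaurent (MvPolynomial.monomial d c) =
      HahnSeries.single (d 0 : ℤ) (HahnSeries.single (-(d 1 : ℤ)) c) := by
  rw [polyToLaurent, MvPolynomial.aeval_monomial, Finsupp.prod_fintype _ _ (by simp),
    Fin.prod_univ_two]
  rw [algebraMap_laurentField]
  simp [HahnSeries.single_pow, HahnSeries.C_apply, HahnSeries.single_mul_single]

/-- The coefficients of the polynomial can be read off from the iterated Laurent series. -/
theorem polyToLaurent_injective : Function.Injective polyToLaurent := by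
  have key : ∀ (p : MvPolynomial (Fin 2) ℂ) (d : Fin 2 →₀ ℕ),
      ((polyToLaurent p).coeff (d 0 : ℤ)).coeff (-(d 1 : ℤ)) = MvPolynomial.coeff d p := by
    intro p d
    induction p using MvPolynomial.induction_on' with
    | monomial d' c =>
      rw [polyToLaurent_monomial, MvPolynomial.coeff_monomial, HahnSeries.coeff_single]
      by_cases h : d' = d
      · subst h; simp
      · rw [if_neg h]
        split_ifs with h0
        · rw [HahnSeries.coeff_single, if_neg]
          intro h1
          apply h
          ext i
          fin_cases i
          · exact (by exact_mod_cast h0 : d 0 = d' 0).symm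
          · exact (by exact_mod_cast neg_injective h1 : d 1 = d' 1).symm
        · simp
    | add p q hp hq => rw [map_add, HahnSeries.coeff_add, HahnSeries.coeff_add, hp, hq,
        MvPolynomial.coeff_add]
  intro p q h
  ext d
  rw [← key, ← key, h]

/-- The substitution x_s ↦ x_s - x_t is a left inverse. -/
theorem shiftAlg_injective {r : ℕ} {s t : Fin r} (h : s ≠ t) :
    Function.Injective (shiftAlg s t) := by
  have : ((MvPolynomial.aeval (Function.update X s (X s - X t)) :
      MvPolynomial (Fin r) ℂ →ₐ[ℂ] MvPolynomial (Fin r) ℂ).comp (shiftAlg s t)) =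
          AlgHom.id ℂ _ := by
    refine MvPolynomial.algHom_ext fun i => ?_
    by_cases hi : i = s
    · subst hi
      simp [shiftAlg_X_self, h.symm]
    · simp [shiftAlg_X_of_ne t hi, hi]
  intro p q hpq
  have h1 := DFunLike.congr_fun this p
  have h2 := DFunLike.congr_fun this q
  simp only [AlgHom.comp_apply, AlgHom.id_apply] at h1 h2
  rw [← h1, ← h2, hpq]

theorem iotaInv_eq (p : MvPolynomial (Fin 2) ℂ) :
    iotaInv p = (polyToLaurent (shiftAlg 0 1 p))⁻¹ := by
  have h : (MvPolynomial.aeval ![HahnSeries.single (1 : ℤ) (1 : LaurentField ℂ)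
      + HahnSeries.C varInf, HahnSeries.C varInf] :
        MvPolynomial (Fin 2) ℂ →ₐ[ℂ] LaurentField (LaurentField ℂ)) =
      polyToLaurent.comp (shiftAlg 0 1) := by
    refine MvPolynomial.algHom_ext fun i => ?_
    rw [AlgHom.comp_apply]
    fin_cases i
    · change _ = polyToLaurent (shiftAlg 0 1 (X 0))
      rw [shiftAlg_X_self, map_add]
      simp [polyToLaurent]
    · change _ = polyToLaurent (shiftAlg 0 1 (X 1))
      rw [shiftAlg_X_of_ne _ (by decide)]
      simp [polyToLaurent]
  unfold iotaInv
  rw [h, AlgHom.comp_apply]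

theorem polyToLaurent_shiftAlg_ne_zero {p : MvPolynomial (Fin 2) ℂ} (hp : p ≠ 0) :
    polyToLaurent (shiftAlg 0 1 p) ≠ 0 := by
  rw [Ne, map_eq_zero_iff _ polyToLaurent_injective,
    map_eq_zero_iff _ (shiftAlg_injective (by decide))]
  exact hp

theorem seriesCoeff_shiftSeries (F : FDist 2 (Module.End ℂ W)) (hF : IsHomLaurentInf F) (w : W) :
    seriesCoeff w (shiftSeries F hF) = substShift (appVec F w) := by
  funext e
  change substShift (appVec F w) ![e 0, - -e 1] = _
  rw [neg_neg]
  congr 1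
  funext i; fin_cases i <;> rfl

theorem polyToLaurent_smul_shiftSeries {a b : EInf W} {p q : MvPolynomial (Fin 2) ℂ}
    (hp : Clears a b p) (hqp : Clears a b (q * p)) :
    polyToLaurent (shiftAlg 0 1 q) • shiftSeries _ hp.isHom = shiftSeries _ hqp.isHom := by
  refine eInfSeries_ext fun w => ?_
  rw [seriesCoeff_polyToLaurent_smul, seriesCoeff_shiftSeries, seriesCoeff_shiftSeries,
    appVec_opProd_pair, appVec_opProd_pair, mul_smul, substShift_smul _ ((clears_iff.1 hp).2 w)]

theorem shiftSeries_congr {F G : FDist 2 (Module.End ℂ W)} (h : F = G) (hF : IsHomLaurentInf F)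
    (hG : IsHomLaurentInf G) : shiftSeries F hF = shiftSeries G hG := by subst h; rfl

/-- `Y(a(x), x₀) b(x)` can be computed with any polynomial that clears the poles. -/
theorem polyToLaurent_smul_vertexProd {a b : EInf W} {q : MvPolynomial (Fin 2) ℂ}
    (hq : Clears a b q) :
    polyToLaurent (shiftAlg 0 1 q) • vertexProd a b = shiftSeries _ hq.isHom := by
  have hex : ∃ p, Clears a b p := ⟨q, hq⟩
  obtain ⟨p, hp, hv⟩ : ∃ p, ∃ hp : Clears a b p, vertexProd a b = vertexProdWith a b p hp :=
    ⟨hex.choose, hex.choose_spec, dif_pos hex⟩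
  have hp0 := polyToLaurent_shiftAlg_ne_zero hp.ne_zero
  have hqp : Clears a b (q * p) := clears_iff.2 ⟨mul_ne_zero hq.ne_zero hp.ne_zero, fun w => by
    rw [mul_smul]; exact (laurentInf 2 W).smul_mem _ ((clears_iff.1 hp).2 w)⟩
  have hpq : Clears a b (p * q) := by rwa [mul_comm]
  have h1 : polyToLaurent (shiftAlg 0 1 p) • vertexProd a b = shiftSeries _ hp.isHom := by
    rw [hv, vertexProdWith, iotaInv_eq, smul_inv_smul₀ hp0]
  -- Here `p` is the polynomial selected in the definition of `vertexProd`. After multiplication by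
  -- its nonzero image both sides are the shift of p q a(x₁)b(x), so the choice is irrelevant.
  refine (smul_right_injective (EInfSeries W) hp0) ?_
  change polyToLaurent (shiftAlg 0 1 p) • polyToLaurent (shiftAlg 0 1 q) • vertexProd a b =
    polyToLaurent (shiftAlg 0 1 p) • shiftSeries _ hq.isHom
  rw [smul_comm, h1, polyToLaurent_smul_shiftSeries hp hqp, polyToLaurent_smul_shiftSeries hq hpq]
  exact shiftSeries_congr (by rw [mul_comm]) _ _

theorem seriesCoeff_vertexProd (a b : EInf W) (w : W) :
    seriesCoeff w (vertexProd a b) = yser a b w := by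
  funext e
  rw [seriesCoeff, yser, nthProd]
  congr 3
  ring

/-- The pair `a(x), b(x)` is compatible. -/
def CompatPair (a b : EInf W) : Prop :=
  ∃ k : ℕ, ∀ w, ((X 0 - X 1) ^ k : MvPolynomial (Fin 2) ℂ) • prod2 a b w ∈ laurentInf 2 W

theorem X_sub_X_ne_zero {r : ℕ} {s t : Fin r} (h : s ≠ t) :
    (X s - X t : MvPolynomial (Fin r) ℂ) ≠ 0 := by
  rw [sub_ne_zero]
  exact fun h' => h (MvPolynomial.X_injective h')

/-- The polynomial (x₁-x)^k becomes x₀^k under x₁ = x+x₀, so the inverse in the definition of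
`nthProd` turns into multiplication by x₀^k on the other side. -/
theorem isExp2_with_of_mem {a b : EInf W} {k : ℕ}
    (h : ∀ w, ((X 0 - X 1) ^ k : MvPolynomial (Fin 2) ℂ) • prod2 a b w ∈ laurentInf 2 W) (w : W) :
    substShift (((X 0 - X 1) ^ k : MvPolynomial (Fin 2) ℂ) • prod2 a b w) =
      (X 0 ^ k : MvPolynomial (Fin 2) ℂ) • yser a b w := by
  have hq : Clears a b ((X 0 - X 1) ^ k) :=
    clears_iff.2 ⟨pow_ne_zero _ (X_sub_X_ne_zero (by decide)), h⟩
  have h1 := congrArg (seriesCoeff w) (polyToLaurent_smul_vertexProd hq)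
  rw [seriesCoeff_polyToLaurent_smul, seriesCoeff_shiftSeries, appVec_opProd_pair,
    seriesCoeff_vertexProd, map_pow, shiftAlg_X_sub_X (by decide)] at h1
  exact h1.symm

theorem CompatPair.isExp2 {a b : EInf W} (h : CompatPair a b) (w : W) :
    IsExp2 (prod2 a b w) (yser a b w) := by
  obtain ⟨k, hk⟩ := h
  exact ⟨k, hk w, isExp2_with_of_mem hk w⟩

/-- The substitution produces only nonnegative powers of x₀, so x₀^k Y(a,x₀)b has no negative ones
and the products vanish for n ≥ k. -/
theorem CompatPair.nthProd_eq_zero {a b : EInf W} (h : CompatPair a b) :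
    ∃ N : ℤ, ∀ n, N ≤ n → nthProd a n b = 0 := by
  obtain ⟨k, hk⟩ := h
  refine ⟨k, fun n hn => eInf_ext fun m w => ?_⟩
  have h1 := congrFun (isExp2_with_of_mem hk w) ![-n - 1 + k, m]
  rw [X_pow_smul_apply, substShift, if_neg (by simp; omega)] at h1
  rw [coeffInf_zero, LinearMap.zero_apply, h1]
  simp [yser]

/-- By uniqueness any expansion computes the products; linearity in each argument follows from the
linearity of expansions. -/
theorem nthProd_eq_of_isExp2 {a b : EInf W} (h : CompatPair a b) (c : ℤ → EInf W)
    (hc : ∀ w, IsExp2 (prod2 a b w) (fun e => coeffInf (c (e 0)) (e 1) w)) (n : ℤ) :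
    nthProd a n b = c (-n - 1) := by
  refine eInf_ext fun m w => ?_
  have := congrFun ((h.isExp2 w).unique (hc w)) ![-n - 1, m]
  simpa [yser] using this

theorem prod2_add_left (a a' b : EInf W) (w : W) :
    prod2 (a + a') b w = prod2 a b w + prod2 a' b w := by
  funext e; simp [prod2, coeffInf_add]

theorem prod2_add_right (a b b' : EInf W) (w : W) :
    prod2 a (b + b') w = prod2 a b w + prod2 a b' w := by
  funext e; simp [prod2, coeffInf_add]

theorem prod2_smul_left (c : ℂ) (a b : EInf W) (w : W) : prod2 (c • a) b w = c • prod2 a b w := by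
  funext e; simp [prod2, coeffInf_smul]

theorem prod2_smul_right (c : ℂ) (a b : EInf W) (w : W) : prod2 a (c • b) w = c • prod2 a b w := by
  funext e; simp [prod2, coeffInf_smul]

theorem IsExp2.const_smul {M : Type*} [AddCommGroup M] [Module ℂ M] {A B : FDist 2 M}
    (h : IsExp2 A B) (c : ℂ) : IsExp2 (c • A) (c • B) := by
  have := h.smul (C c)
  rwa [show shiftAlg (0 : Fin 2) 1 (C c) = C c from (shiftAlg (0 : Fin 2) 1).commutes c, C_smul,
    C_smul] at this

theorem nthProd_add_left {a a' b : EInf W} (h : CompatPair a b) (h' : CompatPair a' b)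
    (h'' : CompatPair (a + a') b) (n : ℤ) :
    nthProd (a + a') n b = nthProd a n b + nthProd a' n b := by
  rw [nthProd_eq_of_isExp2 h'' (fun j => nthProd a (-j - 1) b + nthProd a' (-j - 1) b)]
  · congr 2 <;> ring
  · intro w
    rw [prod2_add_left]
    convert! (h.isExp2 w).add (h'.isExp2 w) using 1

theorem nthProd_add_right {a b b' : EInf W} (h : CompatPair a b) (h' : CompatPair a b')
    (h'' : CompatPair a (b + b')) (n : ℤ) :
    nthProd a n (b + b') = nthProd a n b + nthProd a n b' := by
  rw [nthProd_eq_of_isExp2 h'' (fun j => nthProd a (-j - 1) b + nthProd a (-j - 1) b')]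
  · congr 2 <;> ring
  · intro w
    rw [prod2_add_right]
    convert! (h.isExp2 w).add (h'.isExp2 w) using 1

theorem nthProd_smul_left {a b : EInf W} (c : ℂ) (h : CompatPair a b) (h' : CompatPair (c • a) b)
    (n : ℤ) : nthProd (c • a) n b = c • nthProd a n b := by
  rw [nthProd_eq_of_isExp2 h' (fun j => c • nthProd a (-j - 1) b)]
  · congr 2; ring
  · intro w
    rw [prod2_smul_left]
    convert! (h.isExp2 w).const_smul c using 1

theorem nthProd_smul_right {a b : EInf W} (c : ℂ) (h : CompatPair a b) (h' : CompatPair a (c • b))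
    (n : ℤ) : nthProd a n (c • b) = c • nthProd a n b := by
  rw [nthProd_eq_of_isExp2 h' (fun j => c • nthProd a (-j - 1) b)]
  · congr 2; ring
  · intro w
    rw [prod2_smul_right]
    convert! (h.isExp2 w).const_smul c using 1

theorem prod2_idInf_left (b : EInf W) (w : W) (e : Fin 2 → ℤ) :
    prod2 (idInf W) b w e = if e 0 = 0 then coeffInf b (e 1) w else 0 := by
  rw [prod2, coeffInf_idInf]
  split_ifs <;> rfl

theorem prod2_idInf_right (b : EInf W) (w : W) (e : Fin 2 → ℤ) :
    prod2 b (idInf W) w e = if e 1 = 0 then coeffInf b (e 0) w else 0 := by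
  rw [prod2, coeffInf_idInf]
  split_ifs <;> simp

theorem prod2_idInf_left_mem (b : EInf W) (w : W) : prod2 (idInf W) b w ∈ laurentInf 2 W := by
  obtain ⟨N, hN⟩ := coeffInf_bddAbove b w
  refine mem_laurentInf.2 ⟨max N 0, fun e ⟨i, hi⟩ => ?_⟩
  rw [prod2_idInf_left]
  fin_cases i
  · rw [if_neg]; simp at hi; omega
  · rw [hN _ (by simp at hi; omega), ite_self]

theorem prod2_idInf_right_mem (b : EInf W) (w : W) : prod2 b (idInf W) w ∈ laurentInf 2 W := by
  obtain ⟨N, hN⟩ := coeffInf_bddAbove b w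
  refine mem_laurentInf.2 ⟨max N 0, fun e ⟨i, hi⟩ => ?_⟩
  rw [prod2_idInf_right]
  fin_cases i
  · rw [hN _ (by simp at hi; omega), ite_self]
  · rw [if_neg]; simp at hi; omega

/-- The product 1(x₁)b(x) has no poles and does not involve x₁, so k = 0 works and the substitution
changes nothing. -/
theorem yser_idInf_left (b : EInf W) (w : W) : yser (idInf W) b w = prod2 (idInf W) b w := by
  have h := isExp2_with_of_mem (a := idInf W) (b := b) (k := 0)
    (fun w => by simpa using prod2_idInf_left_mem b w) w
  simp only [pow_zero, one_smul] at h
  rw [← h]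
  funext e
  rw [substShift_apply, finsum_eq_single _ (-e 0), neg_add_cancel, bin_zero_left]
  · rw [prod2_idInf_left, prod2_idInf_left, if_pos (Matrix.cons_val_zero _ _)]
    by_cases h : e 0 = 0 <;> simp [h]
  · intro m hm
    rw [prod2_idInf_left, if_neg, smul_zero]
    simp; omega

/-- With k = 0 the expansion is the Taylor series of b(x+x₀), which yields the creation property. -/
theorem yser_idInf_right (b : EInf W) (w : W) (e : Fin 2 → ℤ) :
    yser b (idInf W) w e = bin (e 1 + e 0) (e 0) • coeffInf b (e 1 + e 0) w := by
  have h := isExp2_with_of_mem (a := b) (b := idInf W) (k := 0)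
    (fun w => by simpa using prod2_idInf_right_mem b w) w
  simp only [pow_zero, one_smul] at h
  rw [← h, substShift_apply, finsum_eq_single _ (e 1)]
  · rw [prod2_idInf_right]; simp
  · intro m hm
    rw [prod2_idInf_right, if_neg, smul_zero]
    simp; omega

end NthProd

end VAInf
end

noncomputable section
namespace VAInf

open MvPolynomial (X C)

/-! ### Slices of a formal series and extraction of coefficients -/

section Slices

variable {n : ℕ} {M M' : Type*} [AddCommGroup M] [Module ℂ M] [AddCommGroup M'] [Module ℂ M']

/-- The coefficient of `x_s ^ m`. -/
def slice (s : Fin (n + 1)) (m : ℤ) : FDist (n + 1) M →ₗ[ℂ] FDist n M where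
  toFun B e := B (s.insertNth (α := fun _ => ℤ) m e)
  map_add' _ _ := rfl
  map_smul' _ _ := rfl

theorem slice_apply (s : Fin (n + 1)) (m : ℤ) (B : FDist (n + 1) M) (e : Fin n → ℤ) :
    slice s m B e = B (s.insertNth (α := fun _ => ℤ) m e) := rfl

theorem slice_X_self_smul (s : Fin (n + 1)) (m : ℤ) (B : FDist (n + 1) M) :
    slice s m ((X s : MvPolynomial (Fin (n + 1)) ℂ) • B) = slice s (m - 1) B := by
  funext e
  rw [slice_apply, X_smul_apply, slice_apply]
  congr 1
  funext u
  refine Fin.succAboveCases s ?_ (fun j => ?_) u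
  · simp
  · simp

theorem slice_X_pow_self_smul (s : Fin (n + 1)) (m : ℤ) (k : ℕ) (B : FDist (n + 1) M) :
    slice s m ((X s ^ k : MvPolynomial (Fin (n + 1)) ℂ) • B) = slice s (m - k) B := by
  induction k generalizing m with
  | zero => simp
  | succ k ih =>
    rw [pow_succ', mul_smul, slice_X_self_smul, ih,
      show m - 1 - (k : ℤ) = m - ((k + 1 : ℕ) : ℤ) by push_cast; ring]

theorem slice_rename_smul (s : Fin (n + 1)) (m : ℤ) (P : MvPolynomial (Fin n) ℂ)
    (B : FDist (n + 1) M) :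
    slice s m (MvPolynomial.rename s.succAbove P • B) = P • slice s m B := by
  induction P using MvPolynomial.induction_on generalizing B with
  | C c => rw [MvPolynomial.rename_C, C_smul, C_smul, map_smul]
  | add p q hp hq => rw [map_add, add_smul, add_smul, map_add, hp, hq]
  | mul_X p j hp =>
    rw [map_mul, mul_smul, mul_smul, hp, MvPolynomial.rename_X]
    congr 1
    funext e
    rw [slice_apply, X_smul_apply, X_smul_apply, slice_apply]
    congr 1
    funext u
    refine Fin.succAboveCases s ?_ (fun l => ?_) u
    · simp [(Fin.succAbove_ne s j).symm]
    · simp [Pi.single_apply]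

/-- If all coefficients of the multiples of `P B` lie in `Sp`, then some power of the constant
coefficient of `P` moves every coefficient of `B` into `Sp`. -/
theorem slice_extract {s : Fin (n + 1)} {Sp : AddSubgroup (FDist n M)} {p0 : MvPolynomial (Fin n) ℂ}
    (hSp : ∀ x ∈ Sp, p0 • x ∈ Sp) (R0 : Subalgebra ℂ (MvPolynomial (Fin (n + 1)) ℂ))
    {P R1 : MvPolynomial (Fin (n + 1)) ℂ} (hR1 : R1 ∈ R0)
    (hP : P = MvPolynomial.rename s.succAbove p0 + X s * R1) {B : FDist (n + 1) M} {b : ℤ}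
    (hB : ∀ e : Fin (n + 1) → ℤ, e s < b → B e = 0)
    (h : ∀ r ∈ R0, ∀ m, slice s m ((r * P) • B) ∈ Sp) (m : ℤ) :
    ∃ N : ℕ, ∀ r ∈ R0, p0 ^ N • slice s m (r • B) ∈ Sp := by
  have hpow : ∀ (N : ℕ), ∀ x ∈ Sp, p0 ^ N • x ∈ Sp := by
    intro N
    induction N with
    | zero => intro x hx; simpa using hx
    | succ N ih => intro x hx; rw [pow_succ, mul_smul]; exact ih _ (hSp x hx)
  -- Induction upwards from `b`, below which all slices vanish. One `N` must serve all `r`, because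
  -- the induction step applies the claim to r R1.
  suffices H : ∀ d : ℕ, ∀ m < b + d, ∃ N : ℕ, ∀ r ∈ R0, p0 ^ N • slice s m (r • B) ∈ Sp from
    H (m - b + 1).toNat m (by omega)
  intro d
  induction d with
  | zero =>
    intro m hm
    refine ⟨0, fun r _ => ?_⟩
    have : slice s m (r • B) = 0 := by
      funext e
      exact smul_apply_eq_zero_of_lt hB r (by simpa using hm)
    rw [this, smul_zero]
    exact Sp.zero_mem
  | succ d ih =>
    intro m hm
    obtain ⟨N, hN⟩ := ih (m - 1) (by push_cast at hm; omega)
    refine ⟨N + 1, fun r hr => ?_⟩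
    -- As P = p0 + x_s R1, multiplication by `p0` differs from multiplication by `P` by a term that
    -- only sees the previous slice.
    have key : p0 • slice s m (r • B) =
        slice s m ((r * P) • B) - slice s (m - 1) ((r * R1) • B) := by
      rw [← slice_rename_smul, ← slice_X_self_smul, ← map_sub, smul_smul, smul_smul, ← sub_smul]
      congr 2
      rw [hP]; ring
    rw [pow_succ, mul_smul, key, smul_sub]
    exact Sp.sub_mem (hpow N _ (h r hr m)) (hN _ (R0.mul_mem hr hR1))

/-- The polynomial obtained by setting the variable number `s` equal to zero. -/
def setZero (s : Fin (n + 1)) : MvPolynomial (Fin (n + 1)) ℂ →ₐ[ℂ] MvPolynomial (Fin n) ℂ :=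
  MvPolynomial.aeval (s.insertNth (α := fun _ => MvPolynomial (Fin n) ℂ) 0 X)

theorem setZero_X_self (s : Fin (n + 1)) : setZero s (X s) = 0 := by simp [setZero]

theorem setZero_X_succAbove (s : Fin (n + 1)) (j : Fin n) :
    setZero s (X (s.succAbove j)) = X j := by simp [setZero]

theorem exists_eq_setZero_add (s : Fin (n + 1)) (P : MvPolynomial (Fin (n + 1)) ℂ) :
    ∃ R, P = MvPolynomial.rename s.succAbove (setZero s P) + X s * R := by
  induction P using MvPolynomial.induction_on with
  | C c => exact ⟨0, by simp [setZero]⟩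
  | add p q hp hq =>
    obtain ⟨R, hR⟩ := hp
    obtain ⟨R', hR'⟩ := hq
    refine ⟨R + R', ?_⟩
    rw [map_add, map_add]
    nth_rewrite 1 [hR, hR']
    ring
  | mul_X p u hp =>
    obtain ⟨R, hR⟩ := hp
    rw [map_mul, map_mul]
    refine Fin.succAboveCases s ?_ (fun j => ?_) u
    · exact ⟨p, by rw [setZero_X_self, map_zero]; ring⟩
    · refine ⟨R * X (s.succAbove j), ?_⟩
      rw [setZero_X_succAbove, MvPolynomial.rename_X]
      nth_rewrite 1 [hR]
      ring

end Slices

/-! ### Products of several operators -/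

section Products

theorem ofFn_update {α : Type*} {n : ℕ} (g : Fin n → α) (i : Fin n) (y : α) :
    List.ofFn (Function.update g i y) =
        (List.ofFn g).take i ++ y :: (List.ofFn g).drop (i + 1) := by
  induction n with
  | zero => exact i.elim0
  | succ n ih =>
    refine Fin.cases ?_ (fun j => ?_) i
    · simp [List.ofFn_succ]
    · have h : (fun k : Fin n => Function.update g j.succ y k.succ) =
          Function.update (fun k : Fin n => g k.succ) j y := by
        funext k
        simp [Function.update_apply]
      rw [List.ofFn_succ, h, ih, Function.update_of_ne (Fin.succ_ne_zero j).symm,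
        List.ofFn_succ (f := g)]
      simp

theorem ofFn_insertNth_update {α : Type*} {n : ℕ} (g : Fin (n + 1) → α) (i : Fin (n + 1))
    (x y : α) :
    List.ofFn (i.castSucc.insertNth (α := fun _ => α) x (Function.update g i y)) =
      (List.ofFn g).take i ++ x :: y :: (List.ofFn g).drop (i + 1) := by
  have hzero : ∀ {n : ℕ} (g : Fin (n + 1) → α),
      List.ofFn ((0 : Fin (n + 1)).castSucc.insertNth (α := fun _ => α) x (Function.update g 0 y)) =
      (List.ofFn g).take (0 : Fin (n + 1)) ++ x :: y :: (List.ofFn g).drop ((0 :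
          Fin (n + 1)) + 1) := by
    intro n g
    rw [Fin.castSucc_zero, Fin.insertNth_zero', List.ofFn_cons, ofFn_update]
    simp
  induction n with
  | zero => exact Fin.cases (hzero g) (fun j => j.elim0) i
  | succ n ih =>
    refine Fin.cases (hzero g) (fun j => ?_) i
    have h : (fun k : Fin (n + 2) => (j.succ.castSucc.insertNth (α := fun _ => α) x
        (Function.update g j.succ y)) k.succ) = j.castSucc.insertNth (α := fun _ => α) x
          (Function.update (fun k : Fin (n + 1) => g k.succ) j y) := by
      funext k
      refine Fin.succAboveCases j.castSucc ?_ (fun l => ?_) k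
      · rw [Fin.insertNth_apply_same, Fin.succ_castSucc, Fin.insertNth_apply_same]
      · rw [Fin.insertNth_apply_succAbove, ← Fin.succ_castSucc, ← Fin.succ_succAbove_succ,
          Fin.insertNth_apply_succAbove]
        simp [Function.update_apply]
    have h0 : (j.succ.castSucc.insertNth (α := fun _ => α) x (Function.update g j.succ y)) 0 =
        g 0 := by
      have : (0 : Fin (n + 3)) = j.succ.castSucc.succAbove 0 := by
        rw [← Fin.succ_castSucc, Fin.succ_succAbove_zero]
      rw [this, Fin.insertNth_apply_succAbove, Function.update_of_ne (Fin.succ_ne_zero j).symm]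
    rw [List.ofFn_succ, h, ih, List.ofFn_succ (f := g), h0]
    simp

variable {W : Type*} [AddCommGroup W] [Module ℂ W]

/-- `a_1(x_1) ⋯ a_r(x_r) w`. -/
def prodSeq {r : ℕ} (a : Fin r → EInf W) (w : W) : FDist r W :=
  appVec (opProd fun i => coeffInf (a i)) w

theorem prodSeq_apply {r : ℕ} (a : Fin r → EInf W) (w : W) (e : Fin r → ℤ) :
    prodSeq a w e = (List.ofFn fun i => coeffInf (a i) (e i)).prod w := rfl

theorem prodSeq_zero (a : Fin 0 → EInf W) (w : W) (e : Fin 0 → ℤ) : prodSeq a w e = w := by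
  simp [prodSeq_apply]

theorem prodSeq_succ {r : ℕ} (a : Fin (r + 1) → EInf W) (w : W) (e : Fin (r + 1) → ℤ) :
    prodSeq a w e = coeffInf (a 0) (e 0) (prodSeq (fun i => a i.succ) w (fun i => e i.succ)) := by
  rw [prodSeq_apply, List.ofFn_succ, List.prod_cons]
  rfl

/-- `∏_{i < j} (x_i - x_j)`. -/
def vandPoly (r : ℕ) : MvPolynomial (Fin r) ℂ := ∏ i, ∏ j ∈ Finset.Ioi i, (X i - X j)

theorem X_sub_X_dvd_vandPoly {r : ℕ} {i j : Fin r} (h : i < j) :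
    (X i - X j : MvPolynomial (Fin r) ℂ) ∣ vandPoly r :=
  (Finset.dvd_prod_of_mem (fun j => (X i - X j : MvPolynomial (Fin r) ℂ))
    (Finset.mem_Ioi.2 h)).trans
    (Finset.dvd_prod_of_mem (fun i => ∏ j ∈ Finset.Ioi i, (X i - X j : MvPolynomial (Fin r) ℂ))
      (Finset.mem_univ i))

theorem smul_mem_of_dvd {r : ℕ} {M : Type*} [AddCommGroup M] [Module ℂ M]
    {S : Submodule (MvPolynomial (Fin r) ℂ) (FDist r M)} {P Q : MvPolynomial (Fin r) ℂ} (h : P ∣ Q)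
    {F : FDist r M} (hF : P • F ∈ S) : Q • F ∈ S := by
  obtain ⟨R, rfl⟩ := h
  rw [mul_comm, mul_smul]
  exact S.smul_mem _ hF

theorem isCompatibleSeq_iff {r : ℕ} {a : Fin r → EInf W} :
    IsCompatibleSeq a ↔ ∃ k : ℕ, ∀ w, vandPoly r ^ k • prodSeq a w ∈ laurentInf r W := by
  refine exists_congr fun k => ?_
  rw [isHomLaurentInf_iff]
  refine forall_congr' fun w => ?_
  rw [← polySMul_def, appVec_smul, vandPoly, ← Finset.prod_pow]
  simp only [Finset.prod_pow]
  rfl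

theorem compatPair_iff {a b : EInf W} : CompatPair a b ↔ IsCompatibleSeq ![a, b] := by
  rw [isCompatibleSeq_iff]
  refine exists_congr fun k => forall_congr' fun w => ?_
  have h1 : vandPoly 2 = X 0 - X 1 := by
    rw [vandPoly, Fin.prod_univ_two]
    have h0 : Finset.Ioi (0 : Fin 2) = {1} := by decide
    have h1 : Finset.Ioi (1 : Fin 2) = ∅ := by decide
    rw [h0, h1]
    simp
  have h2 : prodSeq ![a, b] w = prod2 a b w := by
    funext e
    simp [prodSeq_apply, prod2]
  rw [h1, h2]

/-- The factors of a product of operators on both sides of the position `i`. -/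
theorem exists_prodSeq_eq {n : ℕ} (g : Fin (n + 1) → EInf W) (i : Fin (n + 1)) (w : W)
    (e : Fin (n + 1) → ℤ) : ∃ (L : Module.End ℂ W) (w' : W),
      (∀ c q, prodSeq (Function.update g i c) w (Function.update e i q) = L (coeffInf c q w')) ∧
      ∀ x y p q, prodSeq (i.castSucc.insertNth (α := fun _ => EInf W) x (Function.update g i y)) w
        (i.castSucc.insertNth (α := fun _ => ℤ) p (Function.update e i q)) =
          L (prod2 x y w' ![p, q]) := by
  refine ⟨((List.ofFn fun j => coeffInf (g j) (e j)).take i).prod,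
    ((List.ofFn fun j => coeffInf (g j) (e j)).drop (i + 1)).prod w, ?_, ?_⟩
  · intro c q
    have : (fun j => coeffInf (Function.update g i c j) (Function.update e i q j)) =
        Function.update (fun j => coeffInf (g j) (e j)) i (coeffInf c q) := by
      funext j
      by_cases h : j = i
      · subst h; simp
      · simp [h]
    rw [prodSeq_apply, this, ofFn_update, List.prod_append, List.prod_cons]
    rfl
  · intro x y p q
    have : (fun j => coeffInf
        (i.castSucc.insertNth (α := fun _ => EInf W) x (Function.update g i y) j)
        (i.castSucc.insertNth (α := fun _ => ℤ) p (Function.update e i q) j)) =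
        i.castSucc.insertNth (α := fun _ => Module.End ℂ W) (coeffInf x p)
          (Function.update (fun j => coeffInf (g j) (e j)) i (coeffInf y q)) := by
      funext j
      refine Fin.succAboveCases i.castSucc ?_ (fun l => ?_) j
      · simp
      · by_cases h : l = i
        · subst h; simp
        · simp [h]
    rw [prodSeq_apply, this, ofFn_insertNth_update, List.prod_append, List.prod_cons,
      List.prod_cons]
    rfl

theorem ins_insertNth {n : ℕ} (i : Fin (n + 1)) (m : ℤ) (e : Fin (n + 1) → ℤ) (f : Fin 2 → ℤ) :
    ins i.castSucc i.succ (i.castSucc.insertNth (α := fun _ => ℤ) m e) f =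
      i.castSucc.insertNth (α := fun _ => ℤ) (f 0) (Function.update e i (f 1)) := by
  funext u
  rw [ins, ← Fin.succAbove_castSucc_self]
  refine Fin.succAboveCases i.castSucc ?_ (fun l => ?_) u
  · rw [Fin.insertNth_apply_same, Function.update_of_ne (Fin.succAbove_ne _ _).symm,
      Function.update_self]
  · rw [Fin.insertNth_apply_succAbove]
    by_cases h : l = i
    · subst h; simp
    · rw [Function.update_of_ne h, Function.update_of_ne
        (fun h' => h (Fin.succAbove_right_injective h')), Function.update_of_ne
        (Fin.succAbove_ne _ _), Fin.insertNth_apply_succAbove]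

/-- The expansion of a product of operators at `x_i = x_{i+1}`. -/
theorem isExp_prodSeq {n : ℕ} (g : Fin (n + 1) → EInf W) (i : Fin (n + 1)) {x y : EInf W}
    (h : CompatPair x y) (w : W) :
    IsExp i.castSucc i.succ
      (prodSeq (i.castSucc.insertNth (α := fun _ => EInf W) x (Function.update g i y)) w)
      (fun e => prodSeq (Function.update g i (nthProd x (-e i.castSucc - 1) y)) w
        (i.castSucc.removeNth e)) := by
  intro e
  obtain ⟨m, e, rfl⟩ : ∃ m e', e = i.castSucc.insertNth (α := fun _ => ℤ) m e' :=
    ⟨e i.castSucc, i.castSucc.removeNth e, (Fin.insertNth_self_removeNth _ _).symm⟩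
  obtain ⟨L, w', hL, hL'⟩ := exists_prodSeq_eq g i w e
  have h1 := (h.isExp2 w').map L
  convert! h1 using 1
  · funext f
    rw [fib, ins_insertNth, hL', mapF_apply]
    congr 2
  · funext f
    rw [fib, ins_insertNth, Fin.insertNth_apply_same, Fin.removeNth_insertNth, hL, mapF_apply]
    rfl

/-- A nonzero term needs m + e_s ≤ N and e_t - m ≤ N, whence e_t ≤ 2N - e_s. The bound is not
uniform in e_s, which is why slices are used. -/
theorem substVar_apply_eq_zero_of_gt {r : ℕ} {M : Type*} [AddCommGroup M] [Module ℂ M] {s t : Fin r}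
    (hst : s ≠ t) {F : FDist r M} {N : ℤ} (hN : ∀ e : Fin r → ℤ, (∃ i, N < e i) → F e = 0)
    {e : Fin r → ℤ} {u : Fin r} (hu : u ≠ s) (he : max N (2 * N - e s) < e u) :
    substVar s t F e = 0 := by
  rw [substVar, substShift_apply]
  refine finsum_eq_zero_of_forall_eq_zero fun m => ?_
  rw [fib, hN, smul_zero]
  by_cases ht : u = t
  · subst ht
    by_cases h : N < m + e s
    · exact ⟨s, by rw [ins_left hst]; simpa using h⟩
    · exact ⟨u, by rw [ins_right]; simp; omega⟩
  · exact ⟨u, by rw [ins_of_ne hu ht]; omega⟩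

theorem slice_substVar_mem {n : ℕ} {M : Type*} [AddCommGroup M] [Module ℂ M] {s t : Fin (n + 1)}
    (hst : s ≠ t) {F : FDist (n + 1) M} (hF : F ∈ laurentInf (n + 1) M) (m : ℤ) :
    slice s m (substVar s t F) ∈ laurentInf n M := by
  obtain ⟨N, hN⟩ := mem_laurentInf.1 hF
  refine mem_laurentInf.2 ⟨max N (2 * N - m), fun e ⟨u, hu⟩ => ?_⟩
  rw [slice_apply, substVar_apply_eq_zero_of_gt hst hN (Fin.succAbove_ne s u)]
  simpa using hu

theorem slice_smul_mem {n : ℕ} {M : Type*} [AddCommGroup M] [Module ℂ M] {s : Fin (n + 1)}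
    {S : Submodule (MvPolynomial (Fin n) ℂ) (FDist n M)} {G : FDist (n + 1) M}
    (hG : ∀ m, slice s m G ∈ S) (r : MvPolynomial (Fin (n + 1)) ℂ) (m : ℤ) :
    slice s m (r • G) ∈ S := by
  induction r using MvPolynomial.induction_on generalizing m with
  | C c =>
    rw [C_smul, map_smul, ← C_smul]
    exact S.smul_mem _ (hG m)
  | add p q hp hq =>
    rw [add_smul, map_add]
    exact S.add_mem (hp m) (hq m)
  | mul_X p v hp =>
    rw [mul_comm, mul_smul]
    refine Fin.succAboveCases s ?_ (fun l => ?_) v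
    · rw [slice_X_self_smul]; exact hp _
    · rw [← MvPolynomial.rename_X (R := ℂ) s.succAbove l, slice_rename_smul]
      exact S.smul_mem _ (hp m)

/-- Setting the difference variable to zero after the shift identifies the two adjacent variables,
and `predAbove` is the resulting map of indices. -/
theorem shiftAlg_setZero_X {n : ℕ} (i : Fin (n + 1)) (u : Fin (n + 2)) :
    setZero i.castSucc (shiftAlg i.castSucc i.succ (X u)) = X (i.predAbove u) := by
  rw [← Fin.succAbove_castSucc_self]
  refine Fin.succAboveCases i.castSucc ?_ (fun l => ?_) u
  · rw [shiftAlg_X_self, map_add, setZero_X_self, setZero_X_succAbove, zero_add,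
      Fin.predAbove_castSucc_self]
  · rw [shiftAlg_X_of_ne _ (Fin.succAbove_ne _ _), setZero_X_succAbove, Fin.predAbove_succAbove]

/-- The collapsing map is monotone and identifies only the adjacent pair, so every other difference
stays a factor of the smaller Vandermonde polynomial. -/
theorem predAbove_lt {n : ℕ} {i : Fin (n + 1)} {u v : Fin (n + 2)} (huv : u < v)
    (h : ¬ (u = i.castSucc ∧ v = i.succ)) : i.predAbove u < i.predAbove v := by
  rw [Fin.lt_def] at huv ⊢
  simp only [Fin.ext_iff, Fin.val_castSucc, Fin.val_succ] at h
  simp only [Fin.predAbove, Fin.lt_def, Fin.val_castSucc]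
  split_ifs <;> simp <;> omega

/-- Removing the factor of an adjacent pair from the Vandermonde polynomial and identifying the two
variables gives a divisor of a power of the Vandermonde polynomial. -/
theorem exists_vandPoly_eq_mul {n : ℕ} (i : Fin (n + 1)) : ∃ (Q : MvPolynomial (Fin (n + 2)) ℂ)
    (N : ℕ), vandPoly (n + 2) = (X i.castSucc - X i.succ) * Q ∧
      setZero i.castSucc (shiftAlg i.castSucc i.succ Q) ∣ vandPoly (n + 1) ^ N := by
  let I : Finset ((_ : Fin (n + 2)) × Fin (n + 2)) := Finset.univ.sigma fun i => Finset.Ioi i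
  refine ⟨∏ p ∈ I.erase ⟨i.castSucc, i.succ⟩, (X p.1 - X p.2), (I.erase ⟨i.castSucc, i.succ⟩).card,
    ?_, ?_⟩
  · rw [vandPoly, Finset.prod_sigma']
    exact (Finset.mul_prod_erase I (fun p => (X p.1 - X p.2 : MvPolynomial (Fin (n + 2)) ℂ))
      (a := ⟨i.castSucc, i.succ⟩) (by simp [I])).symm
  · rw [map_prod, map_prod, ← Finset.prod_const]
    refine Finset.prod_dvd_prod_of_dvd _ _ fun p hp => ?_
    rw [map_sub, map_sub, shiftAlg_setZero_X, shiftAlg_setZero_X]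
    rw [Finset.mem_erase] at hp
    refine X_sub_X_dvd_vandPoly (predAbove_lt (by simpa [I] using hp.2) fun h' => hp.1 ?_)
    exact Sigma.ext h'.1 (heq_of_eq h'.2)

theorem prodSeq_update_zero {n : ℕ} (g : Fin (n + 1) → EInf W) (i : Fin (n + 1)) (w : W)
    (e : Fin (n + 1) → ℤ) : prodSeq (Function.update g i 0) w e = 0 := by
  obtain ⟨L, w', hL, -⟩ := exists_prodSeq_eq g i w e
  have := hL 0 (e i)
  rwa [Function.update_eq_self, coeffInf_zero, LinearMap.zero_apply, map_zero] at this

/-- The product `⋯ (Y(x(z), x_s) y)(z) ⋯ w`. -/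
def prodSeqExp {n : ℕ} (g : Fin (n + 1) → EInf W) (i : Fin (n + 1)) (x y : EInf W) (w : W) :
    FDist (n + 2) W := fun e =>
  prodSeq (Function.update g i (nthProd x (-e i.castSucc - 1) y)) w (i.castSucc.removeNth e)

theorem slice_prodSeqExp {n : ℕ} (g : Fin (n + 1) → EInf W) (i : Fin (n + 1)) (x y : EInf W) (w : W)
    (m : ℤ) : slice i.castSucc m (prodSeqExp g i x y w) =
      prodSeq (Function.update g i (nthProd x (-m - 1) y)) w := by
  funext e
  rw [slice_apply, prodSeqExp, Fin.insertNth_apply_same, Fin.removeNth_insertNth]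

/-- By uniqueness of expansions the shifted Vandermonde power times the expanded product is the
substitution of a Laurent series, whose slices are Laurent series. The factor of the adjacent pair
has become a power of the difference variable and is split off. -/
theorem slice_smul_prodSeqExp_mem {n : ℕ} {g : Fin (n + 1) → EInf W} {i : Fin (n + 1)} {x y :
    EInf W}
    (h : CompatPair x y) {k : ℕ} {w : W} (hk : vandPoly (n + 2) ^ k •
      prodSeq (i.castSucc.insertNth (α := fun _ => EInf W) x (Function.update g i y)) w ∈
        laurentInf (n + 2) W) {Q : MvPolynomial (Fin (n + 2)) ℂ}
    (hQ : vandPoly (n + 2) = (X i.castSucc - X i.succ) * Q) (r : MvPolynomial (Fin (n + 2)) ℂ)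
    (m : ℤ) : slice i.castSucc m ((r * shiftAlg i.castSucc i.succ (Q ^ k)) •
      (X i.castSucc ^ k : MvPolynomial (Fin (n + 2)) ℂ) • prodSeqExp g i x y w) ∈
        laurentInf (n + 1) W := by
  have hst : i.castSucc ≠ i.succ := Fin.castSucc_lt_succ.ne
  have hE : shiftAlg i.castSucc i.succ (vandPoly (n + 2) ^ k) • prodSeqExp g i x y w = _ :=
    ((isExp_prodSeq g i h w).smul hst (vandPoly (n + 2) ^ k)).unique
      (isExp_substVar hst (fib_mem_laurentInf hst hk))
  have hφ : shiftAlg i.castSucc i.succ (vandPoly (n + 2) ^ k) =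
      shiftAlg i.castSucc i.succ (Q ^ k) * X i.castSucc ^ k := by
    rw [hQ, mul_pow, map_mul, map_pow _ (_ - _), shiftAlg_X_sub_X hst, mul_comm]
  rw [hφ, mul_smul] at hE
  rw [mul_smul, hE]
  exact slice_smul_mem (fun m => slice_substVar_mem hst hk m) r m

/-- Products of adjacent elements preserve compatibility of a sequence. -/
theorem IsCompatibleSeq.nthProd {n : ℕ} {g : Fin (n + 1) → EInf W} {i : Fin (n + 1)} {x y : EInf W}
    (h : CompatPair x y)
    (hs : IsCompatibleSeq (i.castSucc.insertNth (α := fun _ => EInf W) x (Function.update g i y)))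
    (m : ℤ) : IsCompatibleSeq (Function.update g i (nthProd x m y)) := by
  obtain ⟨k, hk⟩ := isCompatibleSeq_iff.1 hs
  obtain ⟨Q, D, hQ, hD⟩ := exists_vandPoly_eq_mul i
  obtain ⟨R1, hR1⟩ := exists_eq_setZero_add i.castSucc (shiftAlg i.castSucc i.succ (Q ^ k))
  obtain ⟨b, hb⟩ := h.nthProd_eq_zero
  -- Coefficients in `W → W` treat all vectors at once, so that `slice_extract` gives an exponent
  -- `N` independent of `w`, as compatibility demands.
  let B : FDist (n + 2) (W → W) := fun e w => prodSeqExp g i x y w e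
  let pr (w : W) : (W → W) →ₗ[ℂ] W := LinearMap.proj w
  let Sp : AddSubgroup (FDist (n + 1) (W → W)) :=
    ⨅ w, ((laurentInf (n + 1) W).toAddSubgroup.comap (mapF (pr w)).toAddMonoidHom)
  have hmem : ∀ x, x ∈ Sp ↔ ∀ w, mapF (pr w) x ∈ laurentInf (n + 1) W := fun x => by
    simp only [Sp, AddSubgroup.mem_iInf]; rfl
  have hB : ∀ e : Fin (n + 2) → ℤ, e i.castSucc < -b + k →
      ((X i.castSucc ^ k : MvPolynomial (Fin (n + 2)) ℂ) • B) e = 0 := by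
    intro e he
    rw [X_pow_smul_apply]
    funext w
    simp only [B, prodSeqExp]
    rw [hb _ (by simp; omega), prodSeq_update_zero]
    rfl
  obtain ⟨N, hN⟩ := slice_extract (Sp := Sp)
    (fun x hx => (hmem _).2 fun w => by
      rw [mapF_smul]; exact (laurentInf (n + 1) W).smul_mem _ ((hmem x).1 hx w))
    ⊤ (Algebra.mem_top (x := R1)) hR1 hB (fun r _ m' => (hmem _).2 fun w => by
      have h1 := slice_smul_prodSeqExp_mem h (hk w) hQ r m'
      have h2 : mapF (pr w) B = prodSeqExp g i x y w := rfl
      rw [← h2, ← mapF_smul, ← mapF_smul] at h1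
      exact h1) (-m - 1 + k)
  -- The constant coefficient of the shifted Q^k divides the Vandermonde polynomial to the power D
  -- k, and `N` powers of that coefficient are needed.
  refine isCompatibleSeq_iff.2 ⟨D * k * N, fun w => ?_⟩
  have h1 := (hmem _).1 (hN 1 (Subalgebra.one_mem _)) w
  rw [one_smul, slice_X_pow_self_smul, mapF_smul] at h1
  have h2 : mapF (pr w) (slice i.castSucc (-m - 1 + k - k) B) =
      slice i.castSucc (-m - 1 + k - k) (prodSeqExp g i x y w) := rfl
  rw [h2, slice_prodSeqExp, show -(-m - 1 + (k : ℤ) - k) - 1 = m by ring] at h1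
  refine smul_mem_of_dvd ?_ h1
  rw [pow_mul, pow_mul, map_pow, map_pow]
  exact pow_dvd_pow_of_dvd (pow_dvd_pow_of_dvd hD k) N

end Products

end VAInf
end

noncomputable section
namespace VAInf

open MvPolynomial (X C)

/-! ### The closed subspace of elements compatible with a set -/

section ClosedSubspace

variable {W : Type*} [AddCommGroup W] [Module ℂ W]

/-- Compatibility of a sequence given as a list. -/
def CompatList (l : List (EInf W)) : Prop :=
  ∀ (r : ℕ) (a : Fin r → EInf W), List.ofFn a = l → IsCompatibleSeq a

theorem compatList_ofFn {r : ℕ} {a : Fin r → EInf W} :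
    CompatList (List.ofFn a) ↔ IsCompatibleSeq a := by
  refine ⟨fun h => h r a rfl, fun h r' a' h' => ?_⟩
  have h0 : r' = r := by simpa using congrArg List.length h'
  subst h0
  rwa [List.ofFn_injective h']

/-- Lists make it easy to replace one entry by two; this translates such a replacement back to
finite sequences, where compatibility is defined. -/
theorem exists_update_eq {α : Type*} {r : ℕ} {a : Fin r → α} {l1 l2 : List α} {c : α}
    (h : List.ofFn a = l1 ++ c :: l2) : ∃ (n : ℕ) (g : Fin (n + 1) → α) (i : Fin (n + 1)),
      (∀ y, List.ofFn (Function.update g i y) = l1 ++ y :: l2) ∧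
      (∀ x y, List.ofFn (i.castSucc.insertNth (α := fun _ => α) x (Function.update g i y)) =
        l1 ++ x :: y :: l2) := by
  have hlen : r = l1.length + (l2.length + 1) := by simpa using congrArg List.length h
  subst hlen
  refine ⟨l1.length + l2.length, a, ⟨l1.length, by omega⟩, fun y => ?_, fun x y => ?_⟩
  · rw [ofFn_update]
    erw [h]
    simp
  · rw [ofFn_insertNth_update]
    erw [h]
    simp

theorem CompatList.nthProd {l1 l2 : List (EInf W)} {x y : EInf W} (h : CompatPair x y)
    (hl : CompatList (l1 ++ x :: y :: l2)) (m : ℤ) :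
    CompatList (l1 ++ VAInf.nthProd x m y :: l2) := by
  intro r a ha
  obtain ⟨n, g, i, h1, h2⟩ := exists_update_eq ha
  rw [← h2, compatList_ofFn] at hl
  rw [← compatList_ofFn, ha, ← h1, compatList_ofFn]
  exact hl.nthProd h m

theorem prodSeq_update_add {n : ℕ} (g : Fin (n + 1) → EInf W) (i : Fin (n + 1)) (c c' : EInf W)
    (w : W) : prodSeq (Function.update g i (c + c')) w =
      prodSeq (Function.update g i c) w + prodSeq (Function.update g i c') w := by
  funext e
  obtain ⟨L, w', hL, -⟩ := exists_prodSeq_eq g i w e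
  have h := fun c => hL c (e i)
  simp only [Function.update_eq_self] at h
  rw [Pi.add_apply, h, h, h, coeffInf_add, LinearMap.add_apply, map_add]

theorem prodSeq_update_smul {n : ℕ} (g : Fin (n + 1) → EInf W) (i : Fin (n + 1)) (z : ℂ)
    (c : EInf W) (w : W) : prodSeq (Function.update g i (z • c)) w =
      z • prodSeq (Function.update g i c) w := by
  funext e
  obtain ⟨L, w', hL, -⟩ := exists_prodSeq_eq g i w e
  have h := fun c => hL c (e i)
  simp only [Function.update_eq_self] at h
  rw [Pi.smul_apply, h, h, coeffInf_smul, LinearMap.smul_apply, map_smul]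

theorem CompatList.add {l1 l2 : List (EInf W)} {c c' : EInf W} (h : CompatList (l1 ++ c :: l2))
    (h' : CompatList (l1 ++ c' :: l2)) : CompatList (l1 ++ (c + c') :: l2) := by
  intro r a ha
  obtain ⟨n, g, i, h1, -⟩ := exists_update_eq ha
  rw [← h1, compatList_ofFn] at h h'
  rw [← compatList_ofFn, ha, ← h1, compatList_ofFn]
  obtain ⟨k, hk⟩ := isCompatibleSeq_iff.1 h
  obtain ⟨k', hk'⟩ := isCompatibleSeq_iff.1 h'
  refine isCompatibleSeq_iff.2 ⟨max k k', fun w => ?_⟩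
  rw [prodSeq_update_add, smul_add]
  exact add_mem (smul_mem_of_dvd (pow_dvd_pow _ (le_max_left _ _)) (hk w))
    (smul_mem_of_dvd (pow_dvd_pow _ (le_max_right _ _)) (hk' w))

theorem CompatList.smul {l1 l2 : List (EInf W)} {c : EInf W} (h : CompatList (l1 ++ c :: l2))
    (z : ℂ) : CompatList (l1 ++ (z • c) :: l2) := by
  intro r a ha
  obtain ⟨n, g, i, h1, -⟩ := exists_update_eq ha
  rw [← h1, compatList_ofFn] at h
  rw [← compatList_ofFn, ha, ← h1, compatList_ofFn]
  obtain ⟨k, hk⟩ := isCompatibleSeq_iff.1 h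
  refine isCompatibleSeq_iff.2 ⟨k, fun w => ?_⟩
  rw [prodSeq_update_smul, smul_comm, ← C_smul]
  exact (laurentInf _ W).smul_mem _ (hk w)

theorem CompatList.zero (l1 l2 : List (EInf W)) : CompatList (l1 ++ (0 : EInf W) :: l2) := by
  intro r a ha
  obtain ⟨n, g, i, h1, -⟩ := exists_update_eq ha
  rw [← compatList_ofFn, ha, ← h1, compatList_ofFn]
  refine isCompatibleSeq_iff.2 ⟨0, fun w => ?_⟩
  have : prodSeq (Function.update g i 0) w = 0 := funext fun e => prodSeq_update_zero g i w e
  rw [this, smul_zero]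
  exact zero_mem _

/-- All sequences that consist of elements of `S` followed by `l` are compatible. -/
def CompatAfter (S : Set (EInf W)) (l : List (EInf W)) : Prop :=
  ∀ l1 : List (EInf W), (∀ c ∈ l1, c ∈ S) → CompatList (l1 ++ l)

/-- The elements that can be put before the sequences that are compatible with `S`. -/
def compatHull (S : Set (EInf W)) : Submodule ℂ (EInf W) where
  carrier := {c | ∀ l, CompatAfter S l → CompatAfter S (c :: l)}
  add_mem' h h' l hl l1 hl1 := (h l hl l1 hl1).add (h' l hl l1 hl1)
  zero_mem' l _ l1 _ := CompatList.zero l1 l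
  smul_mem' z _ h l hl l1 hl1 := (h l hl l1 hl1).smul z

/-- An element of `S` placed before `l` can be counted as the last element of the prefix from `S`.
-/
theorem subset_compatHull (S : Set (EInf W)) : S ⊆ compatHull S := by
  intro c hc l hl l1 hl1
  have := hl (l1 ++ [c]) (by
    intro d hd
    rcases List.mem_append.1 hd with h | h
    · exact hl1 d h
    · rw [List.mem_singleton.1 h]; exact hc)
  simpa using this

/-- The hull is defined by what may be prepended, so a list from the hull is built up from its right
end, starting with the compatibility of `S` itself. -/
theorem compatAfter_of_mem_compatHull {S : Set (EInf W)} (hS : IsCompatible S)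
    {l : List (EInf W)} (hl : ∀ c ∈ l, c ∈ compatHull S) : CompatAfter S l := by
  induction l with
  | nil =>
    intro l1 hl1 r a ha
    refine hS r a fun i => hl1 _ ?_
    rw [List.append_nil] at ha
    rw [← ha]
    exact (List.mem_ofFn' _ _).2 ⟨i, rfl⟩
  | cons c l ih =>
    exact hl c (by simp) l (ih fun d hd => hl d (by simp [hd]))

theorem isCompatible_compatHull {S : Set (EInf W)} (hS : IsCompatible S) :
    IsCompatible (compatHull S : Set (EInf W)) := by
  intro r a ha
  have := compatAfter_of_mem_compatHull hS (l := List.ofFn a) (by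
    intro c hc
    obtain ⟨i, rfl⟩ := (List.mem_ofFn' _ _).1 hc
    exact ha i) [] (by simp)
  exact compatList_ofFn.1 (by simpa using this)

theorem IsCompatible.compatPair {S : Set (EInf W)} (hS : IsCompatible S) {a b : EInf W}
    (ha : a ∈ S) (hb : b ∈ S) : CompatPair a b :=
  compatPair_iff.2 (hS 2 _ (fun i => by fin_cases i <;> assumption))

/-- Prepend `b`, then `a`, and merge the two neighbours; their pair is compatible because the whole
hull is. -/
theorem nthProd_mem_compatHull {S : Set (EInf W)} (hS : IsCompatible S) {a b : EInf W}
    (ha : a ∈ compatHull S) (hb : b ∈ compatHull S) (n : ℤ) : nthProd a n b ∈ compatHull S :=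
  fun l hl l1 hl1 =>
    CompatList.nthProd ((isCompatible_compatHull hS).compatPair ha hb)
      (ha _ (hb l hl) l1 hl1) n

theorem IsCompatible.isQuasiCompatible {S : Set (EInf W)} (hS : IsCompatible S) :
    IsQuasiCompatible S := by
  intro r a ha
  obtain ⟨k, hk⟩ := hS r a ha
  refine ⟨(X 0 - X 1) ^ k, pow_ne_zero _ (X_sub_X_ne_zero (by decide)), ?_⟩
  simpa using hk

theorem IsCompatible.mono {S T : Set (EInf W)} (hT : IsCompatible T) (h : S ⊆ T) : IsCompatible S :=
  fun r a ha => hT r a fun i => h (ha i)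

theorem compatHull_mem_closedSubspaces {U S : Set (EInf W)} (hS : IsCompatible S) (hU : U ⊆ S)
    (h1 : idInf W ∈ S) : compatHull S ∈ closedSubspaces U :=
  ⟨(isCompatible_compatHull hS).isQuasiCompatible,
    fun _ ha _ hb n => nthProd_mem_compatHull hS ha hb n, subset_compatHull S h1,
    hU.trans (subset_compatHull S)⟩

/-- One member `T` suffices: quasi-compatibility passes to smaller subspaces, and the remaining
conditions pass to intersections. -/
theorem isLeast_generated {U : Set (EInf W)} {T : Submodule ℂ (EInf W)}
    (hT : T ∈ closedSubspaces U) : IsLeast (closedSubspaces U) (generated U) := by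
  refine ⟨⟨?_, ?_, ?_, ?_⟩, fun T hT => sInf_le hT⟩
  · intro r a ha
    exact hT.1 r a fun i => (sInf_le hT : generated U ≤ T) (ha i)
  · intro a ha b hb n
    exact (Submodule.mem_sInf).2 fun T hT =>
      hT.2.1 a (Submodule.mem_sInf.1 ha T hT) b (Submodule.mem_sInf.1 hb T hT) n
  · exact (Submodule.mem_sInf).2 fun T hT => hT.2.2.1
  · exact fun a ha => (Submodule.mem_sInf).2 fun T hT => hT.2.2.2 ha

end ClosedSubspace

end VAInf
end

noncomputable section
namespace VAInf

open MvPolynomial (X C)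

/-! ### Multiplication by scalar series -/

section SeriesMul

variable {r : ℕ} {M : Type*} [AddCommGroup M] [Module ℂ M]

/-- The sums that define the coefficients of the product of `c` and `F` are finite. -/
def MulSummable (c : FDist r ℂ) (F : FDist r M) : Prop :=
  ∀ e, (Function.support fun d : Fin r → ℤ => c d • F (e - d)).Finite

theorem MulSummable.add_right {c : FDist r ℂ} {F G : FDist r M} (hF : MulSummable c F)
    (hG : MulSummable c G) : MulSummable c (F + G) := fun e =>
  ((hF e).union (hG e)).subset fun d hd => by
    by_contra h
    rw [Set.mem_union, not_or, Function.notMem_support, Function.notMem_support] at h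
    exact hd (by dsimp only; rw [Pi.add_apply, smul_add, h.1, h.2, add_zero])

theorem MulSummable.add_left {c c' : FDist r ℂ} {F : FDist r M} (hF : MulSummable c F)
    (hG : MulSummable c' F) : MulSummable (c + c') F := fun e =>
  ((hF e).union (hG e)).subset fun d hd => by
    by_contra h
    rw [Set.mem_union, not_or, Function.notMem_support, Function.notMem_support] at h
    exact hd (by dsimp only; rw [Pi.add_apply, add_smul, h.1, h.2, add_zero])

theorem summable_zero_right (c : FDist r ℂ) : MulSummable c (0 : FDist r M) := fun e => by
  simp

theorem summable_zero_left (F : FDist r M) : MulSummable (0 : FDist r ℂ) F := fun e => by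
  simp

theorem MulSummable.smul_right {c : FDist r ℂ} {F : FDist r M} (hF : MulSummable c F) (z : ℂ) :
    MulSummable c (z • F) := fun e =>
  (hF e).subset fun d hd h => hd (by
    dsimp only at h ⊢; rw [Pi.smul_apply, smul_comm, h, smul_zero])

theorem MulSummable.smul_left {c : FDist r ℂ} {F : FDist r M} (hF : MulSummable c F) (z : ℂ) :
    MulSummable (z • c) F := fun e =>
  (hF e).subset fun d hd h => hd (by
    dsimp only at h ⊢; rw [Pi.smul_apply, smul_eq_mul, mul_smul, h, smul_zero])

theorem seriesMul_add_right {c : FDist r ℂ} {F G : FDist r M} (hF : MulSummable c F)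
    (hG : MulSummable c G) : seriesMul c (F + G) = seriesMul c F + seriesMul c G := by
  funext e
  simp only [seriesMul, Pi.add_apply, smul_add]
  exact finsum_add_distrib (hF e) (hG e)

theorem seriesMul_add_left {c c' : FDist r ℂ} {F : FDist r M} (hF : MulSummable c F)
    (hG : MulSummable c' F) : seriesMul (c + c') F = seriesMul c F + seriesMul c' F := by
  funext e
  simp only [seriesMul, Pi.add_apply, add_smul]
  exact finsum_add_distrib (hF e) (hG e)

theorem seriesMul_smul_right {c : FDist r ℂ} {F : FDist r M} (hF : MulSummable c F) (z : ℂ) :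
    seriesMul c (z • F) = z • seriesMul c F := by
  funext e
  simp only [seriesMul, Pi.smul_apply]
  rw [smul_finsum' z (hF e)]
  exact finsum_congr fun d => smul_comm _ _ _

theorem seriesMul_smul_left {c : FDist r ℂ} {F : FDist r M} (hF : MulSummable c F) (z : ℂ) :
    seriesMul (z • c) F = z • seriesMul c F := by
  funext e
  simp only [seriesMul, Pi.smul_apply, smul_eq_mul, mul_smul]
  exact (smul_finsum' z (hF e)).symm

theorem MulSummable.X_smul_right {c : FDist r ℂ} {F : FDist r M} (hF : MulSummable c F) (i :
    Fin r) :
    MulSummable c ((X i : MvPolynomial (Fin r) ℂ) • F) := fun e => by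
  have : (fun d => c d • ((X i : MvPolynomial (Fin r) ℂ) • F) (e - d)) =
      fun d => c d • F (e - Pi.single i 1 - d) := by
    funext d; rw [X_smul_apply, sub_right_comm]
  rw [this]
  exact hF _

theorem MulSummable.X_smul_left {c : FDist r ℂ} {F : FDist r M} (hF : MulSummable c F) (i : Fin r) :
    MulSummable ((X i : MvPolynomial (Fin r) ℂ) • c) F := fun e => by
  refine ((hF (e - Pi.single i 1)).image fun d => d + Pi.single i 1).subset fun d hd => ?_
  refine ⟨d - Pi.single i 1, fun h => hd ?_, sub_add_cancel _ _⟩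
  dsimp only at h ⊢
  rwa [X_smul_apply, ← sub_sub_sub_cancel_right e d (Pi.single i 1)]

/-- The series that can be multiplied by `c`. -/
def summableRight (M : Type*) [AddCommGroup M] [Module ℂ M] (c : FDist r ℂ) :
    Submodule ℂ (FDist r M) where
  carrier := {F | MulSummable c F}
  add_mem' h h' := h.add_right h'
  zero_mem' := summable_zero_right c
  smul_mem' z _ h := h.smul_right z

/-- The scalar series that can be multiplied by `F`. -/
def summableLeft (F : FDist r M) : Submodule ℂ (FDist r ℂ) where
  carrier := {c | MulSummable c F}
  add_mem' h h' := h.add_left h'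
  zero_mem' := summable_zero_left F
  smul_mem' z _ h := h.smul_left z

theorem MulSummable.polySMul_right {c : FDist r ℂ} {F : FDist r M} (hF : MulSummable c F)
    (P : MvPolynomial (Fin r) ℂ) : MulSummable c (P • F) :=
  smul_mem_of_X_smul_mem (summableRight M c) (fun i _ h => MulSummable.X_smul_right h i) P hF

theorem seriesMul_polySMul_right {c : FDist r ℂ} {F : FDist r M} (hF : MulSummable c F)
    (P : MvPolynomial (Fin r) ℂ) : seriesMul c (P • F) = P • seriesMul c F :=
  map_smul_of_map_X_smul (summableRight M c) (fun i _ h => MulSummable.X_smul_right h i)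
    (seriesMul c) (AlgHom.id ℂ _) (fun _ h _ h' => seriesMul_add_right h h')
    (fun z _ h => seriesMul_smul_right h z) (fun i F _ => by
      funext e
      simp only [AlgHom.id_apply, X_smul_apply, seriesMul, sub_right_comm e]) P hF

theorem seriesMul_polySMul_left {c : FDist r ℂ} {F : FDist r M} (hF : MulSummable c F)
    (P : MvPolynomial (Fin r) ℂ) : seriesMul (P • c) F = P • seriesMul c F :=
  map_smul_of_map_X_smul (summableLeft F) (fun i _ h => MulSummable.X_smul_left h i)
    (fun c => seriesMul c F) (AlgHom.id ℂ _) (fun _ h _ h' => seriesMul_add_left h h')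
    (fun z _ h => seriesMul_smul_left h z) (fun i c _ => by
      funext e
      simp only [AlgHom.id_apply, X_smul_apply, seriesMul]
      rw [← finsum_comp_equiv (Equiv.addRight (Pi.single i 1))]
      refine finsum_congr fun d => ?_
      rw [Equiv.coe_addRight, add_sub_cancel_right, sub_add_eq_sub_sub, sub_right_comm]) P hF

theorem seriesMul_single_zero (F : FDist r M) : seriesMul (Pi.single 0 1) F = F := by
  funext e
  rw [seriesMul, finsum_eq_single _ 0]
  · simp
  · intro d hd
    rw [Pi.single_eq_of_ne hd, zero_smul]

theorem summable_single_zero (F : FDist r M) : MulSummable (Pi.single 0 1) F := fun e => by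
  refine (Set.finite_singleton 0).subset fun d hd => ?_
  by_contra h
  exact hd (by dsimp only; rw [Pi.single_eq_of_ne h, zero_smul])

/-- `B` is the product of `A` and the series `c` in the variables number `s` and `t`. -/
def IsSeriesMul (s t : Fin r) (c : FDist 2 ℂ) (A B : FDist r M) : Prop :=
  ∀ e, MulSummable c (fib s t e A) ∧ fib s t e B = seriesMul c (fib s t e A)

theorem IsSeriesMul.smul {s t : Fin r} (hst : s ≠ t) {c : FDist 2 ℂ} {A B : FDist r M}
    (h : IsSeriesMul s t c A B) (P : MvPolynomial (Fin r) ℂ) :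
    IsSeriesMul s t c (P • A) (P • B) := by
  induction P using MvPolynomial.induction_on with
  | C z =>
    intro e
    rw [C_smul, C_smul]
    exact ⟨(h e).1.smul_right z, (congrArg (z • ·) (h e).2).trans
      (seriesMul_smul_right (h e).1 z).symm⟩
  | add p q hp hq =>
    intro e
    rw [add_smul, add_smul, fib_add, fib_add, (hp e).2, (hq e).2,
      seriesMul_add_right (hp e).1 (hq e).1]
    exact ⟨(hp e).1.add_right (hq e).1, rfl⟩
  | mul_X p u hp =>
    intro e
    rw [mul_comm, mul_smul, mul_smul]
    by_cases hs : u = s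
    · subst hs
      rw [fib_X_left hst, fib_X_left hst, (hp e).2, seriesMul_polySMul_right (hp e).1]
      exact ⟨(hp e).1.X_smul_right _, rfl⟩
    · by_cases ht : u = t
      · subst ht
        rw [fib_X_right hst, fib_X_right hst, (hp e).2, seriesMul_polySMul_right (hp e).1]
        exact ⟨(hp e).1.X_smul_right _, rfl⟩
      · rw [fib_X_of_ne hs ht, fib_X_of_ne hs ht]
        exact hp _

/-- Multiplication by a series whose exponents of `x_s` are bounded above preserves this. -/
theorem IsSeriesMul.mem_bddVar {s t : Fin r} (hst : s ≠ t) {c : FDist 2 ℂ} {A B : FDist r M}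
    (h : IsSeriesMul s t c A B) {N : ℤ} (hc : ∀ d, N < d 0 → c d = 0) (hA : A ∈ bddVar M s) :
    B ∈ bddVar M s := by
  obtain ⟨N', hN'⟩ := hA
  refine ⟨N + N', fun e he => ?_⟩
  rw [← fib_self s t e B, (h e).2]
  refine finsum_eq_zero_of_forall_eq_zero fun d => ?_
  by_cases hd : N < d 0
  · rw [hc d hd, zero_smul]
  · rw [fib, hN', smul_zero]
    rw [ins_left hst]
    simp
    omega

end SeriesMul

/-! ### The expansion of `f(-x₁ + x₂)` -/

section ExpandLin

variable {M : Type*} [AddCommGroup M] [Module ℂ M]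

/-- `φ(-x₁ + x₂)` for `φ ∈ ℂ((x⁻¹))`, expanded in nonnegative powers of `x₂`. -/
def expandDiff (φ : LaurentField ℂ) : FDist 2 ℂ := expandLin (fun n => φ.coeff (-n)) (-1) 1

theorem expandDiff_apply (φ : LaurentField ℂ) (e : Fin 2 → ℤ) :
    expandDiff φ e = φ.coeff (-(e 0 + e 1)) * (bin (e 0 + e 1) (e 1) : ℂ) * (-1) ^ (e 0) := by
  rw [expandDiff, expandLin]
  split_ifs with h
  · rw [bin_of_nonneg _ h, one_zpow, mul_one]
  · rw [bin_of_neg _ (not_le.1 h)]; simp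

theorem expandDiff_eq_zero (φ : LaurentField ℂ) (d : Fin 2 → ℤ)
    (hd : d 1 < 0 ∨ -φ.order < d 0 + d 1) : expandDiff φ d = 0 := by
  rw [expandDiff_apply]
  rcases hd with h | h
  · rw [bin_of_neg _ h]; simp
  · rw [HahnSeries.coeff_eq_zero_of_lt_order (by omega)]; simp

/-- The bounds d₁ ≥ 0, d₀+d₁ ≤ -order of φ, and e₀-d₀ ≤ N confine the summation index to a box. -/
theorem summable_expandDiff (φ : LaurentField ℂ) {F : FDist 2 M} (hF : F ∈ bddVar M 0) :
    MulSummable (expandDiff φ) F := by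
  obtain ⟨N, hN⟩ := hF
  intro e
  refine (Set.finite_Icc (fun i => if i = 0 then e 0 - N else 0 : Fin 2 → ℤ)
    (fun i => if i = 0 then -φ.order else -φ.order - (e 0 - N))).subset fun d hd => ?_
  by_contra hcon
  apply hd
  dsimp only
  by_cases h1 : d 1 < 0 ∨ -φ.order < d 0 + d 1
  · rw [expandDiff_eq_zero φ d h1, zero_smul]
  · rw [hN, smul_zero]
    by_contra h2
    apply hcon
    simp only [Pi.sub_apply] at h2
    push Not at h1
    obtain ⟨h1, h3⟩ := h1
    refine Set.mem_Icc.2 ⟨fun i => ?_, fun i => ?_⟩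
    · fin_cases i
      · simp; omega
      · simpa using h1
    · fin_cases i
      · simp; omega
      · simp; omega

theorem expandDiff_add (φ ψ : LaurentField ℂ) :
    expandDiff (φ + ψ) = expandDiff φ + expandDiff ψ := by
  funext e
  simp only [expandDiff_apply, Pi.add_apply, HahnSeries.coeff_add]
  ring

theorem expandDiff_C_mul (z : ℂ) (φ : LaurentField ℂ) :
    expandDiff (HahnSeries.C z * φ) = z • expandDiff φ := by
  funext e
  simp only [expandDiff_apply, Pi.smul_apply, HahnSeries.C_apply, HahnSeries.coeff_single_zero_mul,
    smul_eq_mul]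
  ring

/-- Multiplying φ(x) by x multiplies φ(-x₁+x₂) by -x₁+x₂; on coefficients this is Pascal's rule. It
allows the denominator of a rational function to be cleared after expansion. -/
theorem expandDiff_varInf_mul (φ : LaurentField ℂ) :
    expandDiff (varInf * φ) = (X 1 - X 0 : MvPolynomial (Fin 2) ℂ) • expandDiff φ := by
  funext e
  rw [sub_smul, Pi.sub_apply, X_smul_apply, X_smul_apply]
  simp only [expandDiff_apply, Pi.sub_apply, Pi.single_eq_same]
  rw [Pi.single_eq_of_ne (by decide), Pi.single_eq_of_ne (by decide), HahnSeries.coeff_single_mul]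
  have h1 : e 0 - 0 + (e 1 - 1) = e 0 + e 1 - 1 := by ring
  have h2 : e 0 - 1 + (e 1 - 0) = e 0 + e 1 - 1 := by ring
  have h3 : -(e 0 + e 1) - -1 = -(e 0 + e 1 - 1) := by ring
  have h4 := bin_succ (e 0 + e 1 - 1) (e 1)
  rw [sub_add_cancel] at h4
  rw [h1, h2, h3, h4, sub_zero, sub_zero, zpow_sub_one₀ (by norm_num)]
  push_cast
  ring

theorem expandDiff_one : expandDiff 1 = Pi.single 0 1 := by
  funext e
  rw [expandDiff_apply, HahnSeries.coeff_one]
  by_cases h : e = 0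
  · subst h; simp [bin_zero_left]
  · rw [Pi.single_eq_of_ne h]
    by_cases h0 : e 0 + e 1 = 0
    · have h1 : e 1 ≠ 0 := by
        intro h1
        apply h
        funext j; fin_cases j
        · change e 0 = 0; omega
        · exact h1
      rw [h0, bin_zero_left, if_neg h1]
      simp
    · rw [if_neg (by omega)]; simp

theorem expandDiff_aeval_mul (p : Polynomial ℂ) (φ : LaurentField ℂ) :
    expandDiff (Polynomial.aeval varInf p * φ) =
      Polynomial.aeval (X 1 - X 0 : MvPolynomial (Fin 2) ℂ) p • expandDiff φ := by
  induction p using Polynomial.induction_on' with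
  | add p q hp hq => rw [map_add, map_add, add_mul, expandDiff_add, hp, hq, add_smul]
  | monomial n z =>
    have hz : algebraMap ℂ (LaurentField ℂ) z = HahnSeries.C z := by
      rw [HahnSeries.algebraMap_apply', PowerSeries.algebraMap_apply, HahnSeries.ofPowerSeries_C]
      rfl
    rw [Polynomial.aeval_monomial, Polynomial.aeval_monomial, hz, mul_assoc, expandDiff_C_mul,
      mul_smul]
    have : expandDiff (varInf ^ n * φ) =
        (X 1 - X 0 : MvPolynomial (Fin 2) ℂ) ^ n • expandDiff φ := by
      induction n with
      | zero => simp
      | succ n ih => rw [pow_succ', mul_assoc, expandDiff_varInf_mul, ih, pow_succ', mul_smul]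
    rw [this]
    exact (C_smul z _).symm

theorem aeval_varInf_coeff (p : Polynomial ℂ) (n : ℕ) :
    (Polynomial.aeval varInf p : LaurentField ℂ).coeff (-(n : ℤ)) = p.coeff n := by
  induction p using Polynomial.induction_on' with
  | add p q hp hq => rw [map_add, HahnSeries.coeff_add, hp, hq, Polynomial.coeff_add]
  | monomial m z =>
    have hz : algebraMap ℂ (LaurentField ℂ) z = HahnSeries.C z := by
      rw [HahnSeries.algebraMap_apply', PowerSeries.algebraMap_apply, HahnSeries.ofPowerSeries_C]
      rfl
    rw [Polynomial.aeval_monomial, hz, HahnSeries.single_pow, HahnSeries.C_apply,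
      HahnSeries.single_mul_single, HahnSeries.coeff_single, Polynomial.coeff_monomial]
    simp
    congr 1
    exact propext eq_comm

theorem iotaInf_mul_denom (f : RatFunc ℂ) :
    Polynomial.aeval varInf f.denom * iotaInf f = Polynomial.aeval varInf f.num := by
  have h : (Polynomial.aeval varInf f.denom : LaurentField ℂ) ≠ 0 := by
    intro h
    apply f.denom_ne_zero
    ext n
    rw [← aeval_varInf_coeff, h]
    simp
  exact mul_div_cancel₀ _ h

/-- Clearing denominators in `f(-x₁ + x₂) F(x₁, x₂)`. -/
theorem denom_smul_seriesMul (f : RatFunc ℂ) {F : FDist 2 M} (hF : F ∈ bddVar M 0) :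
    Polynomial.aeval (X 1 - X 0 : MvPolynomial (Fin 2) ℂ) f.denom •
        seriesMul (expandDiff (iotaInf f)) F =
      Polynomial.aeval (X 1 - X 0 : MvPolynomial (Fin 2) ℂ) f.num • F := by
  rw [← seriesMul_polySMul_left (summable_expandDiff _ hF), ← expandDiff_aeval_mul,
    iotaInf_mul_denom, ← mul_one (Polynomial.aeval varInf f.num), expandDiff_aeval_mul,
    expandDiff_one, seriesMul_polySMul_left (summable_single_zero F), seriesMul_single_zero]

end ExpandLin

end VAInf
end

noncomputable section
namespace VAInf

open MvPolynomial (X C)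

/-! ### `S`-local sets are compatible -/

section SLocal

variable {W : Type*} [AddCommGroup W] [Module ℂ W]

/-- `u(x₂) v(x₁) w`. -/
def prod2Rev (u v : EInf W) (w : W) : FDist 2 W := fun e => coeffInf u (e 1) (coeffInf v (e 0) w)

theorem prod2Rev_mem_bddVar (u v : EInf W) (w : W) : prod2Rev u v w ∈ bddVar W 0 := by
  obtain ⟨N, hN⟩ := coeffInf_bddAbove v w
  exact ⟨N, fun e he => by rw [prod2Rev, hN _ he, map_zero]⟩

theorem IsSLocal.exists_eq {U : Set (EInf W)} (hU : IsSLocal U) {a b : EInf W} (ha : a ∈ U)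
    (hb : b ∈ U) : ∃ (r : ℕ) (u v : Fin r → EInf W) (f : Fin r → RatFunc ℂ) (k : ℕ),
    (∀ i, u i ∈ U) ∧ (∀ i, v i ∈ U) ∧
    ∀ w : W, ((X 0 - X 1) ^ k : MvPolynomial (Fin 2) ℂ) • prod2 a b w =
      ((X 0 - X 1) ^ k : MvPolynomial (Fin 2) ℂ) •
        ∑ i, seriesMul (expandDiff (iotaInf (f i))) (prod2Rev (u i) (v i) w) := hU a ha b hb

/-- The bound `N` is required to be the same for all slices; boundedness of each slice alone would
not be enough. -/
theorem bddVar_of_slices {n : ℕ} {M : Type*} [AddCommGroup M] [Module ℂ M] {s : Fin (n + 1)}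
    {j : Fin n} {F : FDist (n + 1) M}
    (h : ∃ N : ℤ, ∀ m, ∀ e : Fin n → ℤ, N < e j → slice s m F e = 0) :
    F ∈ bddVar M (s.succAbove j) := by
  obtain ⟨N, hN⟩ := h
  refine ⟨N, fun e he => ?_⟩
  have := hN (e s) (s.removeNth e) he
  rwa [slice_apply, Fin.insertNth_self_removeNth] at this

/-- The product of the `x_0 - x_j` for `j > 0`. -/
def headDiff (m : ℕ) : MvPolynomial (Fin (m + 1)) ℂ := ∏ j : Fin m, (X 0 - X j.succ)

theorem headDiff_succ (m : ℕ) : headDiff (m + 1) =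
    (X 0 - X 1) * MvPolynomial.rename (Fin.succAbove 1) (headDiff m) := by
  rw [headDiff, Fin.prod_univ_succ, headDiff, map_prod]
  congr 1
  refine Finset.prod_congr rfl fun j _ => ?_
  rw [map_sub, MvPolynomial.rename_X, MvPolynomial.rename_X]
  congr 2

theorem vandPoly_succ (m : ℕ) : vandPoly (m + 1) =
    headDiff m * MvPolynomial.rename (Fin.succAbove 0) (vandPoly m) := by
  rw [vandPoly, Fin.prod_univ_succ, headDiff, vandPoly, map_prod]
  congr 1
  · rw [Fin.prod_Ioi_zero]
  · refine Finset.prod_congr rfl fun i _ => ?_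
    rw [map_prod, Fin.prod_Ioi_succ]
    refine Finset.prod_congr rfl fun j _ => ?_
    rw [map_sub, MvPolynomial.rename_X, MvPolynomial.rename_X]
    rfl

/-- The leftmost operator of a product of elements of an `S`-local set can be moved to the right. -/
theorem IsSLocal.exists_headDiff_smul_mem {U : Set (EInf W)} (hU : IsSLocal U) {m : ℕ} {a : EInf W}
    (ha : a ∈ U) {b : Fin m → EInf W} (hb : ∀ i, b i ∈ U) : ∃ k : ℕ, ∀ w,
      headDiff m ^ k • prodSeq (Fin.cons a b : Fin (m + 1) → EInf W) w ∈ bddVar W 0 := by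
  induction m generalizing a with
  | zero =>
    refine ⟨0, fun w => ?_⟩
    obtain ⟨N, hN⟩ := coeffInf_bddAbove a w
    rw [pow_zero, one_smul]
    exact ⟨N, fun e he => by rw [prodSeq_succ, prodSeq_zero]; exact hN _ he⟩
  | succ m ih =>
    -- One exchange produces terms u_i(x₁)v_i(x₀), so that v_i in place of `a` now heads the
    -- remaining shorter product. The induction is therefore over all head operators in `U`.
    obtain ⟨r, u, v, f, k, hu, hv, hloc⟩ := hU.exists_eq ha (hb 0)
    choose k' hk' using fun i => ih (hv i) (b := fun j => b j.succ) fun j => hb _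
    obtain ⟨K, hK⟩ := (Set.finite_range k').bddAbove
    have hK' : ∀ i w, headDiff m ^ K •
        prodSeq (Fin.cons (v i) fun j => b j.succ : Fin (m + 1) → EInf W) w ∈ bddVar W 0 :=
      fun i w => smul_mem_of_dvd (pow_dvd_pow _ (hK ⟨i, rfl⟩)) (hk' i w)
    -- For fixed exponents of the later variables the remaining factors are just a vector, to which
    -- the two-variable locality identity is applied.
    let tail (w : W) (e : Fin (m + 2) → ℤ) : W := prodSeq (fun j => b j.succ) w fun j =>
        e j.succ.succ
    let A (w : W) (i : Fin r) : FDist (m + 2) W := fun e => prod2Rev (u i) (v i)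
        (tail w e) ![e 0, e 1]
    let B (w : W) (i : Fin r) : FDist (m + 2) W := fun e =>
      seriesMul (expandDiff (iotaInf (f i))) (prod2Rev (u i) (v i) (tail w e)) ![e 0, e 1]
    have htail : ∀ w e g, tail w (ins 0 1 e g) = tail w e := by
      intro w e g
      simp only [tail]
      congr 1
    have h01 : (0 : Fin (m + 2)) ≠ 1 := by simp
    have hvec : ∀ g : Fin 2 → ℤ, ![g 0, g 1] = g := fun g => by
      funext i; fin_cases i <;> rfl
    have hfA : ∀ w i e, fib 0 1 e (A w i) = prod2Rev (u i) (v i) (tail w e) := by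
      intro w i e
      funext g
      simp only [fib, A]
      rw [htail, ins_left h01, ins_right, hvec]
    have hfB : ∀ w i e, fib 0 1 e (B w i) =
        seriesMul (expandDiff (iotaInf (f i))) (prod2Rev (u i) (v i) (tail w e)) := by
      intro w i e
      funext g
      simp only [fib, B]
      rw [htail, ins_left h01, ins_right, hvec]
    have hAB : ∀ w i, IsSeriesMul 0 1 (expandDiff (iotaInf (f i))) (A w i) (B w i) := by
      intro w i e
      rw [hfA, hfB]
      exact ⟨summable_expandDiff _ (prod2Rev_mem_bddVar _ _ _), rfl⟩
    have hfP : ∀ w e, fib 0 1 e (prodSeq (Fin.cons a b : Fin (m + 2) → EInf W) w) =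
        prod2 a (b 0) (tail w e) := by
      intro w e
      funext g
      rw [fib, prodSeq_succ, prodSeq_succ]
      change coeffInf a (ins 0 1 e g 0) (coeffInf (b 0) (ins 0 1 e g 1) (tail w (ins 0 1 e g))) = _
      rw [htail, ins_left h01, ins_right]
      rfl
    have hmain : ∀ w, MvPolynomial.rename ![(0 : Fin (m + 2)), 1] ((X 0 - X 1) ^ k :
        MvPolynomial (Fin 2) ℂ) •
        prodSeq (Fin.cons a b : Fin (m + 2) → EInf W) w =
        MvPolynomial.rename ![(0 : Fin (m + 2)), 1] ((X 0 - X 1) ^ k :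
            MvPolynomial (Fin 2) ℂ) • ∑ i, B w i := by
      intro w
      funext e
      have hsum : fib 0 1 e (∑ i, B w i) = ∑ i, fib 0 1 e (B w i) := by
        funext g
        simp only [fib, Finset.sum_apply]
      rw [← fib_self 0 1 e (_ • _), ← fib_self 0 1 e (_ • ∑ i, B w i), fib_smul h01, fib_smul h01,
        hfP, hloc, hsum]
      simp only [hfB]
    -- The operator u_i(x₁) stands on the left and acts coefficientwise, so the bound on x₀ for the
    -- shorter product holds uniformly in the exponent of x₁.
    have hA : ∀ w i, MvPolynomial.rename (Fin.succAbove 1) (headDiff m ^ K) • A w i ∈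
        bddVar W 0 := by
      intro w i
      obtain ⟨N, hN⟩ := hK' i w
      refine bddVar_of_slices (s := 1) (j := 0) ⟨N, fun m' e he => ?_⟩
      rw [slice_rename_smul]
      have : slice 1 m' (A w i) = mapF (coeffInf (u i) m')
          (prodSeq (Fin.cons (v i) fun j => b j.succ : Fin (m + 1) → EInf W) w) := by
        funext e
        rw [slice_apply, mapF_apply, prodSeq_succ]
        simp only [A, prod2Rev, tail]
        have h0 : ((1 : Fin (m + 2)).insertNth (α := fun _ => ℤ) m' e) 0 = e 0 :=
          Fin.insertNth_apply_succAbove (α := fun _ => ℤ) (1 : Fin (m + 2)) m' e 0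
        have h1 : ∀ j : Fin m, ((1 : Fin (m + 2)).insertNth (α := fun _ => ℤ) m' e) j.succ.succ =
            e j.succ :=
          fun j => Fin.insertNth_apply_succAbove (α := fun _ => ℤ) (1 : Fin (m + 2)) m' e j.succ
        simp [h0, h1]
      rw [this, ← mapF_smul, mapF_apply, hN e he, map_zero]
    refine ⟨k + K, fun w => ?_⟩
    have hren : MvPolynomial.rename ![(0 : Fin (m + 2)), 1] (X 0 - X 1 : MvPolynomial (Fin 2) ℂ) =
        X 0 - X 1 := by simp
    have hB : MvPolynomial.rename (Fin.succAbove 1) (headDiff m ^ K) •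
        MvPolynomial.rename ![(0 : Fin (m + 2)), 1] ((X 0 - X 1) ^ k : MvPolynomial (Fin 2) ℂ) •
          prodSeq (Fin.cons a b : Fin (m + 2) → EInf W) w ∈ bddVar W 0 := by
      rw [hmain, smul_comm]
      refine (bddVar W 0).smul_mem _ ?_
      rw [Finset.smul_sum]
      exact sum_mem fun i _ => ((hAB w i).smul h01 _).mem_bddVar h01
        (N := -(iotaInf (f i)).order) (fun d hd => expandDiff_eq_zero _ _ (by omega)) (hA w i)
    rw [smul_smul] at hB
    refine smul_mem_of_dvd ?_ hB
    rw [headDiff_succ, mul_pow, mul_comm, map_pow, map_pow, hren]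
    exact mul_dvd_mul (pow_dvd_pow _ (Nat.le_add_right _ _)) (pow_dvd_pow _ (Nat.le_add_left _ _))

/-- The variable of the leftmost factor is bounded by moving that factor to the right. For any other
variable the leftmost factor is a linear map applied to each slice of the shorter product, and
induction applies. -/
theorem IsSLocal.exists_vandPoly_smul_mem {U : Set (EInf W)} (hU : IsSLocal U) {r : ℕ}
    {a : Fin r → EInf W} (ha : ∀ i, a i ∈ U) (i : Fin r) :
    ∃ k : ℕ, ∀ w, vandPoly r ^ k • prodSeq a w ∈ bddVar W i := by
  induction r with
  | zero => exact i.elim0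
  | succ r ih =>
    refine Fin.cases ?_ (fun j => ?_) i
    · obtain ⟨k, hk⟩ := hU.exists_headDiff_smul_mem (ha 0) (b := fun j => a j.succ) fun j => ha _
      refine ⟨k, fun w => smul_mem_of_dvd (P := headDiff r ^ k) (pow_dvd_pow_of_dvd ?_ k) ?_⟩
      · rw [vandPoly_succ]; exact dvd_mul_right _ _
      · have := hk w
        rwa [show (Fin.cons (a 0) fun j => a j.succ : Fin (r + 1) → EInf W) = a from
          Fin.cons_self_tail a] at this
    · obtain ⟨k, hk⟩ := ih (a := fun j => a j.succ) (fun j => ha _) j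
      refine ⟨k, fun w => smul_mem_of_dvd (P := MvPolynomial.rename (Fin.succAbove 0)
          (vandPoly r) ^ k)
        (pow_dvd_pow_of_dvd ?_ k) ?_⟩
      · rw [vandPoly_succ]; exact dvd_mul_left _ _
      · obtain ⟨N, hN⟩ := hk w
        refine bddVar_of_slices (s := 0) (j := j) ⟨N, fun m e he => ?_⟩
        rw [← map_pow, slice_rename_smul]
        have : slice 0 m (prodSeq a w) =
            mapF (coeffInf (a 0) m) (prodSeq (fun j => a j.succ) w) := by
          funext e
          rw [slice_apply, mapF_apply, prodSeq_succ]
          simp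
        rw [this, ← mapF_smul, mapF_apply, hN e he, map_zero]

theorem IsSLocal.isCompatible {U : Set (EInf W)} (hU : IsSLocal U) : IsCompatible U := by
  intro r a ha
  choose k hk using hU.exists_vandPoly_smul_mem ha
  obtain ⟨K, hK⟩ := (Set.finite_range k).bddAbove
  exact isCompatibleSeq_iff.2 ⟨K, fun w => mem_laurentInf'.2 fun i =>
    smul_mem_of_dvd (pow_dvd_pow _ (hK ⟨i, rfl⟩)) (hk i w)⟩

theorem iotaInf_one : iotaInf 1 = 1 := RatFunc.eval_one _ _

/-- The identity commutes with everything, which is locality with one term, f = 1 and k = 0. -/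
theorem IsSLocal.insert_idInf {U : Set (EInf W)} (hU : IsSLocal U) :
    IsSLocal (insert (idInf W) U) := by
  have key : ∀ a b u v : EInf W, u ∈ insert (idInf W) U → v ∈ insert (idInf W) U →
      (∀ w, prod2 a b w = prod2Rev u v w) →
      ∃ (r : ℕ) (u v : Fin r → EInf W) (f : Fin r → RatFunc ℂ) (k : ℕ),
        (∀ i, u i ∈ insert (idInf W) U) ∧ (∀ i, v i ∈ insert (idInf W) U) ∧
        ∀ w : W, ((X 0 - X 1) ^ k : MvPolynomial (Fin 2) ℂ) • prod2 a b w =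
          ((X 0 - X 1) ^ k : MvPolynomial (Fin 2) ℂ) •
            ∑ i, seriesMul (expandDiff (iotaInf (f i))) (prod2Rev (u i) (v i) w) := by
    intro a b u v hu hv h
    refine ⟨1, fun _ => u, fun _ => v, fun _ => 1, 0, fun _ => hu, fun _ => hv, fun w => ?_⟩
    rw [Fin.sum_univ_one, iotaInf_one, expandDiff_one, seriesMul_single_zero, h]
  rintro a (rfl | ha) b hb
  · refine key _ _ b (idInf W) hb (Set.mem_insert _ _) fun w => ?_
    funext e
    rw [prod2_idInf_left, prod2Rev, coeffInf_idInf]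
    split_ifs <;> simp
  · rcases hb with rfl | hb
    · refine key _ _ (idInf W) a (Set.mem_insert _ _) (Set.mem_insert_of_mem _ ha) fun w => ?_
      funext e
      rw [prod2_idInf_right, prod2Rev, coeffInf_idInf]
      split_ifs <;> rfl
    · obtain ⟨r, u, v, f, k, hu, hv, h⟩ := hU.exists_eq ha hb
      exact ⟨r, u, v, f, k, fun i => Set.mem_insert_of_mem _ (hu i),
        fun i => Set.mem_insert_of_mem _ (hv i), h⟩

end SLocal

end VAInf
end

noncomputable section
namespace VAInf

open MvPolynomial (X C)

/-! ### Locality with polynomial denominators -/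

section JoinVar

variable {M M' : Type*} [AddCommGroup M] [Module ℂ M] [AddCommGroup M'] [Module ℂ M']

/-- The series `φ(x_k) A(x_i, x_j)` in three variables. -/
def joinVar (i j k : Fin 3) (φ : ℤ → M →ₗ[ℂ] M') : FDist 2 M →ₗ[ℂ] FDist 3 M' where
  toFun A e := φ (e k) (A ![e i, e j])
  map_add' A B := by funext e; exact map_add _ _ _
  map_smul' z A := by funext e; exact map_smul _ _ _

theorem joinVar_apply (i j k : Fin 3) (φ : ℤ → M →ₗ[ℂ] M') (A : FDist 2 M) (e : Fin 3 → ℤ) :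
    joinVar i j k φ A e = φ (e k) (A ![e i, e j]) := rfl

theorem joinVar_smul {i j k : Fin 3} (hij : i ≠ j) (hik : i ≠ k) (hjk : j ≠ k)
    (φ : ℤ → M →ₗ[ℂ] M') (P : MvPolynomial (Fin 2) ℂ) (A : FDist 2 M) :
    joinVar i j k φ (P • A) = MvPolynomial.rename ![i, j] P • joinVar i j k φ A := by
  refine reindex_smul (joinVar i j k φ) (MvPolynomial.rename ![i, j]) (fun u F => ?_) P A
  rw [MvPolynomial.rename_X]
  funext e
  rw [joinVar_apply, X_smul_apply, X_smul_apply, joinVar_apply]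
  fin_cases u
  · simp [hij.symm, hik.symm, Matrix.vecHead, Matrix.vecTail]
  · simp [hij, hjk.symm, Matrix.vecHead, Matrix.vecTail]

end JoinVar

/-! ### Extraction of slices relative to a subspace stable under few polynomials -/

section SliceStab

variable {n : ℕ} {M : Type*} [AddCommGroup M] [Module ℂ M]

/-- The polynomials that preserve the series whose slices all lie in `Sp`. -/
def sliceStab (s : Fin (n + 1)) (Sp : Submodule ℂ (FDist n M)) :
    Subalgebra ℂ (MvPolynomial (Fin (n + 1)) ℂ) where
  carrier := {P | ∀ B : FDist (n + 1) M, (∀ m, slice s m B ∈ Sp) → ∀ m, slice s m (P • B) ∈ Sp}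
  mul_mem' {P Q} hP hQ B hB := by
    rw [mul_smul]; exact hP _ (hQ B hB)
  add_mem' {P Q} hP hQ B hB m := by
    rw [add_smul, map_add]; exact Sp.add_mem (hP B hB m) (hQ B hB m)
  algebraMap_mem' z B hB m := by
    rw [algebraMap_smul, map_smul]; exact Sp.smul_mem _ (hB m)

theorem X_mem_sliceStab (s : Fin (n + 1)) (Sp : Submodule ℂ (FDist n M)) :
    X s ∈ sliceStab s Sp := fun B hB m => by
  rw [slice_X_self_smul]; exact hB _

theorem rename_mem_sliceStab {s : Fin (n + 1)} {Sp : Submodule ℂ (FDist n M)}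
    {P : MvPolynomial (Fin n) ℂ} (hP : ∀ x ∈ Sp, P • x ∈ Sp) :
    MvPolynomial.rename s.succAbove P ∈ sliceStab s Sp := fun B hB m => by
  rw [slice_rename_smul]; exact hP _ (hB _)

/-- If `h(y) h'(y ± x_s)` moves all slices of `B` into `Sp`, then a polynomial in `y` moves a given
slice of `B` into `Sp`. -/
theorem exists_aeval_smul_slice_mem {s : Fin (n + 1)} {Sp : Submodule ℂ (FDist n M)}
    {y : MvPolynomial (Fin n) ℂ} (hy : ∀ x ∈ Sp, y • x ∈ Sp) {h h' : Polynomial ℂ} (hh : h ≠ 0)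
    (hh' : h' ≠ 0) {ε : ℂ} {B : FDist (n + 1) M} {b : ℤ}
    (hB : ∀ e : Fin (n + 1) → ℤ, e s < b → B e = 0)
    (H : ∀ m, slice s m ((Polynomial.aeval (MvPolynomial.rename s.succAbove y) h *
      Polynomial.aeval (MvPolynomial.rename s.succAbove y + ε • X s) h') • B) ∈ Sp) (m : ℤ) :
    ∃ g : Polynomial ℂ, g ≠ 0 ∧ Polynomial.aeval y g • slice s m B ∈ Sp := by
  have hmem : ∀ g : Polynomial ℂ, ∀ x ∈ Sp, Polynomial.aeval y g • x ∈ Sp := by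
    intro g x hx
    induction g using Polynomial.induction_on' with
    | add p q hp hq => rw [map_add, add_smul]; exact Sp.add_mem hp hq
    | monomial k z =>
      rw [Polynomial.aeval_monomial, mul_smul, algebraMap_smul]
      refine Sp.smul_mem _ ?_
      induction k with
      | zero => rwa [pow_zero, one_smul]
      | succ k ih => rw [pow_succ', mul_smul]; exact hy _ ih
  -- `Sp` is stable only under certain polynomials. The difference h'(y+εx_s) - h'(y) is therefore
  -- divided by εx_s inside the subalgebra `R0`, so that the quotient again preserves the condition
  -- on slices, as `slice_extract` needs.
  let R0 := sliceStab s Sp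
  let Y : R0 := ⟨_, rename_mem_sliceStab (s := s) hy⟩
  let Z : R0 := ⟨X s, X_mem_sliceStab s Sp⟩
  obtain ⟨R1, hR1⟩ : ε • Z ∣ Polynomial.aeval (Y + ε • Z) h' - Polynomial.aeval Y h' := by
    have := Polynomial.sub_dvd_eval_sub (Y + ε • Z) Y (h'.map (algebraMap ℂ R0))
    rwa [add_sub_cancel_left, Polynomial.eval_map_algebraMap, Polynomial.eval_map_algebraMap]
      at this
  have hval : ∀ (g : Polynomial ℂ) (t : R0), ((Polynomial.aeval t g : R0) :
      MvPolynomial (Fin (n + 1)) ℂ) = Polynomial.aeval (t : MvPolynomial (Fin (n + 1)) ℂ) g :=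
    fun g t => (Polynomial.aeval_algHom_apply R0.val t g).symm
  have hP : Polynomial.aeval (MvPolynomial.rename s.succAbove y) h *
      Polynomial.aeval (MvPolynomial.rename s.succAbove y + ε • X s) h' =
      MvPolynomial.rename s.succAbove (Polynomial.aeval y (h * h')) +
        X s * ((ε • (Polynomial.aeval Y h * R1) : R0) : MvPolynomial (Fin (n + 1)) ℂ) := by
    have h2 := congrArg (Subtype.val) hR1
    have h3 : Polynomial.aeval (MvPolynomial.rename s.succAbove y + ε • X s) h' -
      Polynomial.aeval (MvPolynomial.rename s.succAbove y) h' = (ε • X s) * (R1 :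
          MvPolynomial (Fin (n + 1)) ℂ) := by
      have e1 := hval h' (Y + ε • Z)
      have e2 := hval h' Y
      change _ = Polynomial.aeval (MvPolynomial.rename s.succAbove y + ε • X s) h' at e1
      change _ = Polynomial.aeval (MvPolynomial.rename s.succAbove y) h' at e2
      rw [← e1, ← e2]
      exact h2
    rw [sub_eq_iff_eq_add] at h3
    have h4 : ((ε • (Polynomial.aeval Y h * R1) : R0) : MvPolynomial (Fin (n + 1)) ℂ) =
        ε • (Polynomial.aeval (MvPolynomial.rename s.succAbove y) h * R1) := by
      have e2 := hval h Y
      change _ = Polynomial.aeval (MvPolynomial.rename s.succAbove y) h at e2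
      rw [← e2]; rfl
    rw [h3, h4, map_mul, map_mul, ← Polynomial.aeval_algHom_apply, ← Polynomial.aeval_algHom_apply]
    simp only [MvPolynomial.smul_eq_C_mul]
    ring
  obtain ⟨N, hN⟩ := slice_extract (Sp := Sp.toAddSubgroup) (hmem (h * h')) R0 (SetLike.coe_mem _)
    hP hB (fun r hr m => by
      rw [mul_smul]
      exact hr _ H m) m
  refine ⟨(h * h') ^ N, pow_ne_zero _ (mul_ne_zero hh hh'), ?_⟩
  have := hN 1 (one_mem _)
  rwa [one_smul, ← map_pow] at this

end SliceStab

/-! ### Locality up to polynomials in the difference of the variables -/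

section PolyLocal

variable {W : Type*} [AddCommGroup W] [Module ℂ W]

/-- `a(x₁) b(x₂)`. -/
def opPair (a b : EInf W) : FDist 2 (Module.End ℂ W) := fun e => coeffInf a (e 0) * coeffInf b (e 1)

/-- `u(x₂) v(x₁)`. -/
def opPairRev (u v : EInf W) : FDist 2 (Module.End ℂ W) :=
  fun e => coeffInf u (e 1) * coeffInf v (e 0)

/-- The span of the `g(x₂ - x₁) u(x₂) v(x₁)` with `u ∈ S`, `v ∈ T` and `g` a polynomial. -/
def revSpan (S T : Set (EInf W)) : Submodule ℂ (FDist 2 (Module.End ℂ W)) :=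
  Submodule.span ℂ {F | ∃ (g : Polynomial ℂ) (u v : EInf W), u ∈ S ∧ v ∈ T ∧
    F = Polynomial.aeval (X 1 - X 0 : MvPolynomial (Fin 2) ℂ) g • opPairRev u v}

theorem aeval_smul_opPairRev_mem {S T : Set (EInf W)} (g : Polynomial ℂ) {u v : EInf W} (hu : u ∈ S)
    (hv : v ∈ T) :
    Polynomial.aeval (X 1 - X 0 : MvPolynomial (Fin 2) ℂ) g • opPairRev u v ∈ revSpan S T :=
  Submodule.subset_span ⟨g, u, v, hu, hv, rfl⟩

theorem opPairRev_mem {S T : Set (EInf W)} {u v : EInf W} (hu : u ∈ S) (hv : v ∈ T) :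
    opPairRev u v ∈ revSpan S T := by
  have := aeval_smul_opPairRev_mem 1 hu hv
  rwa [map_one, one_smul] at this

theorem revSpan_mono {S S' T T' : Set (EInf W)} (hS : S ⊆ S') (hT : T ⊆ T') :
    revSpan S T ≤ revSpan S' T' := by
  refine Submodule.span_mono ?_
  rintro _ ⟨g, u, v, hu, hv, rfl⟩
  exact ⟨g, u, v, hS hu, hT hv, rfl⟩

theorem aeval_smul_mem_revSpan {S T : Set (EInf W)} (g : Polynomial ℂ)
    {F : FDist 2 (Module.End ℂ W)} (hF : F ∈ revSpan S T) :
    Polynomial.aeval (X 1 - X 0 : MvPolynomial (Fin 2) ℂ) g • F ∈ revSpan S T := by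
  induction hF using Submodule.span_induction with
  | mem F hF =>
    obtain ⟨g', u, v, hu, hv, rfl⟩ := hF
    rw [smul_smul, ← map_mul]
    exact aeval_smul_opPairRev_mem _ hu hv
  | zero => rw [smul_zero]; exact zero_mem _
  | add F G _ _ hF hG => rw [smul_add]; exact add_mem hF hG
  | smul z F _ hF => rw [smul_comm]; exact Submodule.smul_mem _ _ hF

theorem X_sub_X_smul_mem_revSpan {S T : Set (EInf W)}
    {F : FDist 2 (Module.End ℂ W)} (hF : F ∈ revSpan S T) :
    (X 1 - X 0 : MvPolynomial (Fin 2) ℂ) • F ∈ revSpan S T := by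
  have := aeval_smul_mem_revSpan Polynomial.X hF
  rwa [Polynomial.aeval_X] at this

/-- Locality of `a(x₁) b(x₂)` up to a polynomial in `x₂ - x₁`. -/
def PolyLocal (S T : Set (EInf W)) (a b : EInf W) : Prop :=
  ∃ h : Polynomial ℂ, h ≠ 0 ∧
    Polynomial.aeval (X 1 - X 0 : MvPolynomial (Fin 2) ℂ) h • opPair a b ∈ revSpan S T

theorem PolyLocal.mono {S S' T T' : Set (EInf W)} (hS : S ⊆ S') (hT : T ⊆ T') {a b : EInf W}
    (h : PolyLocal S T a b) : PolyLocal S' T' a b := by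
  obtain ⟨g, hg, h⟩ := h
  exact ⟨g, hg, revSpan_mono hS hT h⟩

/-- The product of the two denominators serves both summands. -/
theorem exists_smul_add_mem {r : ℕ} {M : Type*} [AddCommGroup M] [Module ℂ M]
    {y : MvPolynomial (Fin r) ℂ} {Sp : Submodule ℂ (FDist r M)}
    (hy : ∀ (g : Polynomial ℂ), ∀ F ∈ Sp, Polynomial.aeval y g • F ∈ Sp) {F G : FDist r M}
    (hF : ∃ h : Polynomial ℂ, h ≠ 0 ∧ Polynomial.aeval y h • F ∈ Sp)
    (hG : ∃ h : Polynomial ℂ, h ≠ 0 ∧ Polynomial.aeval y h • G ∈ Sp) :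
    ∃ h : Polynomial ℂ, h ≠ 0 ∧ Polynomial.aeval y h • (F + G) ∈ Sp := by
  obtain ⟨h, hh, hF⟩ := hF
  obtain ⟨h', hh', hG⟩ := hG
  refine ⟨h * h', mul_ne_zero hh hh', ?_⟩
  rw [smul_add]
  refine add_mem ?_ ?_
  · rw [mul_comm, map_mul, mul_smul]; exact hy _ _ hF
  · rw [map_mul, mul_smul]; exact hy _ _ hG

theorem PolyLocal.add_left {S T : Set (EInf W)} {a a' b : EInf W} (h : PolyLocal S T a b)
    (h' : PolyLocal S T a' b) : PolyLocal S T (a + a') b := by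
  have : opPair (a + a') b = opPair a b + opPair a' b := by
    funext e; simp [opPair, coeffInf_add, add_mul]
  rw [PolyLocal, this]
  exact exists_smul_add_mem (fun g F => aeval_smul_mem_revSpan g) h h'

theorem PolyLocal.add_right {S T : Set (EInf W)} {a b b' : EInf W} (h : PolyLocal S T a b)
    (h' : PolyLocal S T a b') : PolyLocal S T a (b + b') := by
  have : opPair a (b + b') = opPair a b + opPair a b' := by
    funext e; simp [opPair, coeffInf_add, mul_add]
  rw [PolyLocal, this]
  exact exists_smul_add_mem (fun g F => aeval_smul_mem_revSpan g) h h'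

theorem PolyLocal.smul_left {S T : Set (EInf W)} {a b : EInf W} (h : PolyLocal S T a b) (z : ℂ) :
    PolyLocal S T (z • a) b := by
  have : opPair (z • a) b = z • opPair a b := by
    funext e; simp [opPair, coeffInf_smul]
  obtain ⟨g, hg, h⟩ := h
  refine ⟨g, hg, ?_⟩
  rw [this, smul_comm]
  exact Submodule.smul_mem _ _ h

theorem PolyLocal.smul_right {S T : Set (EInf W)} {a b : EInf W} (h : PolyLocal S T a b) (z : ℂ) :
    PolyLocal S T a (z • b) := by
  have : opPair a (z • b) = z • opPair a b := by
    funext e; simp [opPair, coeffInf_smul]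
  obtain ⟨g, hg, h⟩ := h
  refine ⟨g, hg, ?_⟩
  rw [this, smul_comm]
  exact Submodule.smul_mem _ _ h

theorem PolyLocal.zero_left (S T : Set (EInf W)) (b : EInf W) : PolyLocal S T 0 b := by
  have : opPair 0 b = 0 := by funext e; simp [opPair, coeffInf_zero]
  exact ⟨1, one_ne_zero, by rw [this, smul_zero]; exact zero_mem _⟩

theorem PolyLocal.zero_right (S T : Set (EInf W)) (a : EInf W) : PolyLocal S T a 0 := by
  have : opPair a 0 = 0 := by funext e; simp [opPair, coeffInf_zero]
  exact ⟨1, one_ne_zero, by rw [this, smul_zero]; exact zero_mem _⟩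

theorem mapF_applyₗ_opPair (a b : EInf W) (w : W) :
    mapF (LinearMap.applyₗ w) (opPair a b) = prod2 a b w := rfl

theorem mapF_applyₗ_opPairRev (u v : EInf W) (w : W) :
    mapF (LinearMap.applyₗ w) (opPairRev u v) = prod2Rev u v w := rfl

theorem mapF_applyₗ_ext {r : ℕ} {F G : FDist r (Module.End ℂ W)}
    (h : ∀ w, mapF (LinearMap.applyₗ w) F = mapF (LinearMap.applyₗ w) G) : F = G := by
  funext e
  ext w
  exact congrFun (h w) e

/-- Multiplication by all denominators turns the rational functions f_i into polynomials in x₂-x₁.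
The factor (x₁-x₂)^k appears as (-X)^k evaluated at x₂-x₁. -/
theorem IsSLocal.polyLocal {U : Set (EInf W)} (hU : IsSLocal U) {a b : EInf W} (ha : a ∈ U)
    (hb : b ∈ U) : PolyLocal U U a b := by
  obtain ⟨r, u, v, f, k, hu, hv, h⟩ := hU.exists_eq ha hb
  refine ⟨(∏ i, (f i).denom) * (-Polynomial.X) ^ k, mul_ne_zero
    (Finset.prod_ne_zero_iff.2 fun i _ => RatFunc.denom_ne_zero _)
    (pow_ne_zero _ (neg_ne_zero.2 Polynomial.X_ne_zero)), ?_⟩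
  have key : Polynomial.aeval (X 1 - X 0 : MvPolynomial (Fin 2) ℂ)
      ((∏ i, (f i).denom) * (-Polynomial.X) ^ k) • opPair a b =
      ∑ i, Polynomial.aeval (X 1 - X 0 : MvPolynomial (Fin 2) ℂ)
        ((-Polynomial.X) ^ k * ((∏ j ∈ Finset.univ.erase i, (f j).denom) * (f i).num)) •
          opPairRev (u i) (v i) := by
    refine mapF_applyₗ_ext fun w => ?_
    rw [mapF_smul, map_sum]
    simp only [mapF_smul, mapF_applyₗ_opPair, mapF_applyₗ_opPairRev]
    have hk : Polynomial.aeval (X 1 - X 0 : MvPolynomial (Fin 2) ℂ)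
        ((-Polynomial.X : Polynomial ℂ) ^ k) = (X 0 - X 1) ^ k := by simp
    rw [map_mul, mul_smul, hk, h, smul_comm, Finset.smul_sum, Finset.smul_sum]
    refine Finset.sum_congr rfl fun i _ => ?_
    rw [map_mul, mul_smul, hk, map_mul, mul_smul,
      ← denom_smul_seriesMul _ (prod2Rev_mem_bddVar _ _ _),
      ← Finset.prod_erase_mul _ _ (Finset.mem_univ i), map_mul, mul_smul]
  rw [key]
  refine sum_mem fun i _ => ?_
  exact aeval_smul_opPairRev_mem _ (hu i) (hv i)

end PolyLocal

end VAInf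
end

noncomputable section
namespace VAInf

open MvPolynomial (X C)

/-! ### Polynomial locality of generated spaces -/

section PolyLocalGenerated

variable {W : Type*} [AddCommGroup W] [Module ℂ W]

/-- `IsExp`, read on every vector. -/
def IsExpOp (s t : Fin 3) (A B : FDist 3 (Module.End ℂ W)) : Prop :=
  ∀ w, IsExp s t (mapF (LinearMap.applyₗ w) A) (mapF (LinearMap.applyₗ w) B)

theorem IsExpOp.add {s t : Fin 3} {A B A' B' : FDist 3 (Module.End ℂ W)} (h : IsExpOp s t A B)
    (h' : IsExpOp s t A' B') : IsExpOp s t (A + A') (B + B') := fun w => by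
  rw [map_add, map_add]; exact (h w).add (h' w)

theorem IsExpOp.unique {s t : Fin 3} {A B B' : FDist 3 (Module.End ℂ W)} (h : IsExpOp s t A B)
    (h' : IsExpOp s t A B') : B = B' := mapF_applyₗ_ext fun w => (h w).unique (h' w)

theorem isExpOp_zero (s t : Fin 3) : IsExpOp s t (0 : FDist 3 (Module.End ℂ W)) 0 := fun w => by
  rw [map_zero]; exact isExp_zero s t

theorem IsExpOp.smul {s t : Fin 3} (hst : s ≠ t) {A B : FDist 3 (Module.End ℂ W)}
    (h : IsExpOp s t A B) (P : MvPolynomial (Fin 3) ℂ) :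
    IsExpOp s t (P • A) (shiftAlg s t P • B) := fun w => by
  rw [mapF_smul, mapF_smul]; exact (h w).smul hst P

/-- The series whose expansion at `x_s = x_t + z` has all its coefficients in `Sp`. -/
def expSliceMem {s t : Fin 3} (hst : s ≠ t) (Sp : Submodule ℂ (FDist 2 (Module.End ℂ W))) :
    Submodule ℂ (FDist 3 (Module.End ℂ W)) where
  carrier := {A | ∃ B, IsExpOp s t A B ∧ ∀ m, slice s m B ∈ Sp}
  zero_mem' := ⟨0, isExpOp_zero s t, fun m => by rw [map_zero]; exact zero_mem _⟩
  add_mem' := by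
    rintro A A' ⟨B, h, hB⟩ ⟨B', h', hB'⟩
    exact ⟨B + B', h.add h', fun m => by rw [map_add]; exact add_mem (hB m) (hB' m)⟩
  smul_mem' := by
    rintro z A ⟨B, h, hB⟩
    refine ⟨(C z : MvPolynomial (Fin 3) ℂ) • B, ?_, fun m => ?_⟩
    · have := h.smul hst (C z)
      rwa [C_smul, MvPolynomial.algHom_C, MvPolynomial.algebraMap_eq] at this
    · rw [C_smul, map_smul]; exact Submodule.smul_mem _ _ (hB m)

theorem smul_mem_expSliceMem {s t : Fin 3} (hst : s ≠ t)
    {Sp : Submodule ℂ (FDist 2 (Module.End ℂ W))} {P : MvPolynomial (Fin 3) ℂ}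
    (hP : shiftAlg s t P ∈ sliceStab s Sp) {A : FDist 3 (Module.End ℂ W)}
    (hA : A ∈ expSliceMem hst Sp) : P • A ∈ expSliceMem hst Sp := by
  obtain ⟨B, h, hB⟩ := hA
  exact ⟨_, h.smul hst P, hP B hB⟩

theorem aeval_mem_sliceStab {n : ℕ} {M : Type*} [AddCommGroup M] [Module ℂ M] {s : Fin (n + 1)}
    {Sp : Submodule ℂ (FDist n M)} {y : MvPolynomial (Fin (n + 1)) ℂ} (hy : y ∈ sliceStab s Sp)
    (g : Polynomial ℂ) : Polynomial.aeval y g ∈ sliceStab s Sp :=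
  Subalgebra.aeval_coe (sliceStab s Sp) ⟨y, hy⟩ g ▸ SetLike.coe_mem _

theorem shiftAlg_aeval {r : ℕ} (s t : Fin r) (y : MvPolynomial (Fin r) ℂ) (g : Polynomial ℂ) :
    shiftAlg s t (Polynomial.aeval y g) = Polynomial.aeval (shiftAlg s t y) g :=
  (Polynomial.aeval_algHom_apply _ _ _).symm

/-- A factor in the third variable is passive: on the left it is a linear map applied to the
expansion, on the right it only changes the vector. -/
theorem isExpOp_prod3_one_two (L : ℤ → Module.End ℂ W) {x y : EInf W} (h : CompatPair x y) :
    IsExpOp 1 2 (fun e => L (e 0) * (coeffInf x (e 1) * coeffInf y (e 2)))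
      (fun e => L (e 0) * coeffInf (nthProd x (-e 1 - 1) y) (e 2)) := by
  intro w e
  have h0 : ∀ f, ins (1 : Fin 3) 2 e f 0 = e 0 := fun f => ins_of_ne (by decide) (by decide) _ _
  have h1 : ∀ f, ins (1 : Fin 3) 2 e f 1 = f 0 := fun f => ins_left (by decide) _ _
  have h2 : ∀ f, ins (1 : Fin 3) 2 e f 2 = f 1 := fun f => ins_right _ _ _ _
  have := (h.isExp2 w).map (L (e 0))
  convert this using 1
  · funext f; simp only [fib, mapF_apply, h0, h1, h2]; rfl
  · funext f; simp only [fib, mapF_apply, h0, h1, h2]; rfl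

theorem isExpOp_prod3_one_two_rev (R : ℤ → Module.End ℂ W) {x y : EInf W} (h : CompatPair x y) :
    IsExpOp 1 2 (fun e => coeffInf x (e 1) * (coeffInf y (e 2) * R (e 0)))
      (fun e => coeffInf (nthProd x (-e 1 - 1) y) (e 2) * R (e 0)) := by
  intro w e
  have h0 : ∀ f, ins (1 : Fin 3) 2 e f 0 = e 0 := fun f => ins_of_ne (by decide) (by decide) _ _
  have h1 : ∀ f, ins (1 : Fin 3) 2 e f 1 = f 0 := fun f => ins_left (by decide) _ _
  have h2 : ∀ f, ins (1 : Fin 3) 2 e f 2 = f 1 := fun f => ins_right _ _ _ _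
  have := h.isExp2 (R (e 0) w)
  convert this using 1
  · funext f; simp only [fib, mapF_apply, h0, h1, h2]; rfl
  · funext f; simp only [fib, mapF_apply, h0, h1, h2]; rfl

theorem isExpOp_prod3_zero_one (R : ℤ → Module.End ℂ W) {x y : EInf W} (h : CompatPair x y) :
    IsExpOp 0 1 (fun e => coeffInf x (e 0) * (coeffInf y (e 1) * R (e 2)))
      (fun e => coeffInf (nthProd x (-e 0 - 1) y) (e 1) * R (e 2)) := by
  intro w e
  have h0 : ∀ f, ins (0 : Fin 3) 1 e f 0 = f 0 := fun f => ins_left (by decide) _ _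
  have h1 : ∀ f, ins (0 : Fin 3) 1 e f 1 = f 1 := fun f => ins_right _ _ _ _
  have h2 : ∀ f, ins (0 : Fin 3) 1 e f 2 = e 2 := fun f => ins_of_ne (by decide) (by decide) _ _
  have := h.isExp2 (R (e 2) w)
  convert this using 1
  · funext f; simp only [fib, mapF_apply, h0, h1, h2]; rfl
  · funext f; simp only [fib, mapF_apply, h0, h1, h2]; rfl

theorem isExpOp_prod3_zero_one_rev (L : ℤ → Module.End ℂ W) {x y : EInf W} (h : CompatPair x y) :
    IsExpOp 0 1 (fun e => L (e 2) * (coeffInf x (e 0) * coeffInf y (e 1)))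
      (fun e => L (e 2) * coeffInf (nthProd x (-e 0 - 1) y) (e 1)) := by
  intro w e
  have h0 : ∀ f, ins (0 : Fin 3) 1 e f 0 = f 0 := fun f => ins_left (by decide) _ _
  have h1 : ∀ f, ins (0 : Fin 3) 1 e f 1 = f 1 := fun f => ins_right _ _ _ _
  have h2 : ∀ f, ins (0 : Fin 3) 1 e f 2 = e 2 := fun f => ins_of_ne (by decide) (by decide) _ _
  have := (h.isExp2 w).map (L (e 2))
  convert this using 1
  · funext f; simp only [fib, mapF_apply, h0, h1, h2]; rfl
  · funext f; simp only [fib, mapF_apply, h0, h1, h2]; rfl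

/-- A family of conditions `∃ h ≠ 0, h(y) J(x) ∈ T` follows on a span from the generators. -/
theorem exists_aeval_smul_map_mem_of_span {T : Submodule ℂ (FDist 3 (Module.End ℂ W))}
    {y : MvPolynomial (Fin 3) ℂ} (hy : ∀ (g : Polynomial ℂ), ∀ F ∈ T, Polynomial.aeval y g • F ∈ T)
    (J : FDist 2 (Module.End ℂ W) →ₗ[ℂ] FDist 3 (Module.End ℂ W)) {S :
        Set (FDist 2 (Module.End ℂ W))}
    (hS : ∀ x ∈ S, ∃ h : Polynomial ℂ, h ≠ 0 ∧ Polynomial.aeval y h • J x ∈ T)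
    {x : FDist 2 (Module.End ℂ W)} (hx : x ∈ Submodule.span ℂ S) :
    ∃ h : Polynomial ℂ, h ≠ 0 ∧ Polynomial.aeval y h • J x ∈ T := by
  induction hx using Submodule.span_induction with
  | mem x hx => exact hS x hx
  | zero => exact ⟨1, one_ne_zero, by rw [map_zero, smul_zero]; exact zero_mem _⟩
  | add x x' _ _ h h' => rw [map_add]; exact exists_smul_add_mem hy h h'
  | smul z x _ h =>
    obtain ⟨g, hg, h⟩ := h
    refine ⟨g, hg, ?_⟩
    rw [map_smul, smul_comm]
    exact Submodule.smul_mem _ _ h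

theorem map_mem_of_span {T : Submodule ℂ (FDist 3 (Module.End ℂ W))}
    (J : FDist 2 (Module.End ℂ W) →ₗ[ℂ] FDist 3 (Module.End ℂ W)) {S :
        Set (FDist 2 (Module.End ℂ W))}
    (hS : ∀ x ∈ S, J x ∈ T) {x : FDist 2 (Module.End ℂ W)} (hx : x ∈ Submodule.span ℂ S) :
    J x ∈ T :=
  (Submodule.span_le (p := T.comap J)).2 hS hx

theorem rename_aeval {q r : ℕ} (f : Fin q → Fin r) (y : MvPolynomial (Fin q) ℂ) (g : Polynomial ℂ) :
    MvPolynomial.rename f (Polynomial.aeval y g) =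
      Polynomial.aeval (MvPolynomial.rename f y) g :=
  (Polynomial.aeval_algHom_apply _ _ _).symm

theorem rename_X_sub_X {r : ℕ} (i j : Fin r) :
    MvPolynomial.rename ![i, j] (X 1 - X 0 : MvPolynomial (Fin 2) ℂ) = X j - X i := by simp

theorem slice_zero_apply {M : Type*} [AddCommGroup M] [Module ℂ M] (m : ℤ) (B : FDist 3 M)
    (e : Fin 2 → ℤ) : slice 0 m B e = B ![m, e 0, e 1] := by
  rw [slice_apply]
  congr 1
  funext i
  fin_cases i <;> rfl

theorem slice_one_apply {M : Type*} [AddCommGroup M] [Module ℂ M] (m : ℤ) (B : FDist 3 M)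
    (e : Fin 2 → ℤ) : slice 1 m B e = B ![e 0, m, e 1] := by
  rw [slice_apply]
  congr 1
  funext i
  fin_cases i <;> rfl

/-- The series `b` such that all `a ∈ A` are local to `b` up to a polynomial. -/
def polyLocalRight (S T A : Set (EInf W)) : Submodule ℂ (EInf W) where
  carrier := {b | ∀ a ∈ A, PolyLocal S T a b}
  zero_mem' a _ := PolyLocal.zero_right _ _ a
  add_mem' hb hb' a ha := (hb a ha).add_right (hb' a ha)
  smul_mem' z _ hb a ha := (hb a ha).smul_right z

/-- The series `a` that are local to all `b ∈ B` up to a polynomial. -/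
def polyLocalLeft (S T B : Set (EInf W)) : Submodule ℂ (EInf W) where
  carrier := {a | ∀ b ∈ B, PolyLocal S T a b}
  zero_mem' b _ := PolyLocal.zero_left _ _ b
  add_mem' ha ha' b hb := (ha b hb).add_left (ha' b hb)
  smul_mem' z _ ha b hb := (ha b hb).smul_left z

/-- In a(x₀)b(x₁)c(x₂) the operator in x₀ is moved past b, becoming some v ∈ S, and then past c;
this leaves terms u(x₁)u'(x₂)v'(x₀). Expanding at x₁ = x₂+z turns uu' into the products u_n u' ∈ V.
The operator in x₀ never leaves `S`, where alone locality with `c` is assumed. -/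
theorem PolyLocal.nthProd_right {S V : Set (EInf W)} (hV : ∀ x ∈ V, ∀ y ∈ V, CompatPair x y)
    (hcl : ∀ x ∈ V, ∀ y ∈ V, ∀ n, nthProd x n y ∈ V) {a b c : EInf W} (hb : b ∈ V) (hc : c ∈ V)
    (hab : PolyLocal V S a b) (hSc : ∀ v ∈ S, PolyLocal V S v c) (n : ℤ) :
    PolyLocal V S a (nthProd b n c) := by
  have h12 : (1 : Fin 3) ≠ 2 := by decide
  let Sp := revSpan V S
  let T := expSliceMem h12 Sp
  have hX1 : X 1 ∈ sliceStab 1 Sp := X_mem_sliceStab 1 Sp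
  have hy : (X 2 - X 0 : MvPolynomial (Fin 3) ℂ) ∈ sliceStab 1 Sp := by
    have := rename_mem_sliceStab (s := (1 : Fin 3)) (Sp := Sp) (P := X 1 - X 0)
      fun x hx => X_sub_X_smul_mem_revSpan hx
    simpa using this
  have s1 : shiftAlg (1 : Fin 3) 2 (X 1 - X 0) = X 2 - X 0 + X 1 := by
    rw [map_sub, shiftAlg_X_self, shiftAlg_X_of_ne 2 (by decide)]; ring
  have s2 : shiftAlg (1 : Fin 3) 2 (X 2 - X 0) = X 2 - X 0 := by
    rw [map_sub, shiftAlg_X_of_ne 2 (by decide), shiftAlg_X_of_ne 2 (by decide)]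
  have hT1 : ∀ (g : Polynomial ℂ), ∀ F ∈ T,
      Polynomial.aeval (X 1 - X 0 : MvPolynomial (Fin 3) ℂ) g • F ∈ T := fun g F hF => by
    refine smul_mem_expSliceMem h12 ?_ hF
    rw [shiftAlg_aeval, s1]
    exact aeval_mem_sliceStab (add_mem hy hX1) g
  have hT2 : ∀ (g : Polynomial ℂ), ∀ F ∈ T,
      Polynomial.aeval (X 2 - X 0 : MvPolynomial (Fin 3) ℂ) g • F ∈ T := fun g F hF => by
    refine smul_mem_expSliceMem h12 ?_ hF
    rw [shiftAlg_aeval, s2]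
    exact aeval_mem_sliceStab hy g
  -- After both exchanges u(x₁) stands next to u'(x₂), and the coefficients of their expansion lie
  -- in `V` by closedness.
  have hgen : ∀ u ∈ V, ∀ y ∈ Sp, joinVar 0 2 1 (fun m =>
      LinearMap.mulLeft ℂ (coeffInf u m)) y ∈ T := by
    intro u hu y hy'
    refine map_mem_of_span _ ?_ hy'
    rintro _ ⟨g, u', v, hu', hv, rfl⟩
    rw [joinVar_smul (by decide) (by decide) (by decide), rename_aeval, rename_X_sub_X]
    refine hT2 _ _ ⟨_, isExpOp_prod3_one_two_rev (coeffInf v) (hV u hu u' hu'), fun m => ?_⟩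
    convert opPairRev_mem (hcl u hu u' hu' (-m - 1)) hv using 1
    funext e
    rw [slice_one_apply]
    rfl
  have hspan : ∀ x ∈ Sp, ∃ h' : Polynomial ℂ, h' ≠ 0 ∧
      Polynomial.aeval (X 2 - X 0 : MvPolynomial (Fin 3) ℂ) h' •
        joinVar 0 1 2 (fun m => LinearMap.mulRight ℂ (coeffInf c m)) x ∈ T := by
    intro x hx
    refine exists_aeval_smul_map_mem_of_span hT2 _ ?_ hx
    rintro _ ⟨g, u, v, hu, hv, rfl⟩
    obtain ⟨h', hh', hvc⟩ := hSc v hv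
    refine ⟨h', hh', ?_⟩
    rw [joinVar_smul (by decide) (by decide) (by decide), rename_aeval, rename_X_sub_X, smul_comm]
    refine hT1 _ _ ?_
    have := hgen u hu _ hvc
    rw [joinVar_smul (by decide) (by decide) (by decide), rename_aeval, rename_X_sub_X] at this
    rwa [show joinVar 0 1 2 (fun m => LinearMap.mulRight ℂ (coeffInf c m)) (opPairRev u v) =
      joinVar 0 2 1 (fun m => LinearMap.mulLeft ℂ (coeffInf u m)) (opPair v c) from
      funext fun e => mul_assoc _ _ _]
  obtain ⟨h, hh, hab⟩ := hab
  obtain ⟨h', hh', x', hx', hsl⟩ := hspan _ hab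
  rw [joinVar_smul (by decide) (by decide) (by decide), rename_aeval, rename_X_sub_X] at hx'
  set B : FDist 3 (Module.End ℂ W) := fun e =>
      coeffInf a (e 0) * coeffInf (nthProd b (-e 1 - 1) c) (e 2)
  have hexp : IsExpOp 1 2 (joinVar 0 1 2 (fun m => LinearMap.mulRight ℂ (coeffInf c m))
      (opPair a b)) B :=
    isExpOp_prod3_one_two (coeffInf a) (hV b hb c hc)
  have hx'' :=
      (hexp.smul h12 (Polynomial.aeval (X 1 - X 0) h)).smul h12 (Polynomial.aeval (X 2 - X 0) h')
  -- The same series has been expanded after the exchanges and directly, as a(x₀) times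
  -- (Y(b,z)c)(x₂); the results agree.
  obtain rfl := hx'.unique hx''
  obtain ⟨N, hN⟩ := (hV b hb c hc).nthProd_eq_zero
  have hBb : ∀ e : Fin 3 → ℤ, e 1 < -N → B e = 0 := by
    intro e he
    simp only [B]
    rw [hN _ (by omega), coeffInf_zero, mul_zero]
  -- The two denominators have become h'(x₂-x₀) and h(x₂-x₀+z). Removing the variable z renumbers x₂
  -- as variable 1, so x₂-x₀ is `X 1 - X 0`.
  have hfin := exists_aeval_smul_slice_mem (s := (1 : Fin 3)) (Sp := Sp) (y := X 1 - X 0)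
      (h := h') (h' := h)
    (ε := 1) (fun x hx => X_sub_X_smul_mem_revSpan hx) hh' hh hBb (fun m => by
      have := hsl m
      rw [smul_smul, shiftAlg_aeval, shiftAlg_aeval, s1, s2] at this
      simpa using this) (-n - 1)
  have : slice 1 (-n - 1) B = opPair a (nthProd b n c) := by
    funext e
    have : -(-n - 1) - 1 = n := by ring
    rw [slice_one_apply]
    change coeffInf a (e 0) * coeffInf (nthProd b (-(-n - 1) - 1) c) (e 1) = _
    rw [this]; rfl
  rwa [this] at hfin

/-- In a(x₀)b(x₁)c(x₂) the operator in x₂ is moved to the left past b and then past a, leaving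
u'(x₂)v'(x₀)v(x₁), which is expanded at x₀ = x₁+z. The operator met by `a` in the second exchange is
an arbitrary element of `V`, hence the hypothesis on all of `V`. -/
theorem PolyLocal.nthProd_left {V : Set (EInf W)} (hV : ∀ x ∈ V, ∀ y ∈ V, CompatPair x y)
    (hcl : ∀ x ∈ V, ∀ y ∈ V, ∀ n, nthProd x n y ∈ V) {a b c : EInf W} (ha : a ∈ V) (hb : b ∈ V)
    (hbc : PolyLocal V V b c) (hav : ∀ v ∈ V, PolyLocal V V a v) (n : ℤ) :
    PolyLocal V V (nthProd a n b) c := by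
  have h01 : (0 : Fin 3) ≠ 1 := by decide
  let Sp := revSpan V V
  let T := expSliceMem h01 Sp
  have hX0 : X 0 ∈ sliceStab 0 Sp := X_mem_sliceStab 0 Sp
  have hy : (X 2 - X 1 : MvPolynomial (Fin 3) ℂ) ∈ sliceStab 0 Sp := by
    have := rename_mem_sliceStab (s := (0 : Fin 3)) (Sp := Sp) (P := X 1 - X 0)
      fun x hx => X_sub_X_smul_mem_revSpan hx
    simpa using this
  have s1 : shiftAlg (0 : Fin 3) 1 (X 2 - X 0) = X 2 - X 1 + (-1 : ℂ) • X 0 := by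
    rw [map_sub, shiftAlg_X_self, shiftAlg_X_of_ne 1 (by decide), neg_one_smul]; ring
  have s2 : shiftAlg (0 : Fin 3) 1 (X 2 - X 1) = X 2 - X 1 := by
    rw [map_sub, shiftAlg_X_of_ne 1 (by decide), shiftAlg_X_of_ne 1 (by decide)]
  have hT1 : ∀ (g : Polynomial ℂ), ∀ F ∈ T,
      Polynomial.aeval (X 2 - X 0 : MvPolynomial (Fin 3) ℂ) g • F ∈ T := fun g F hF => by
    refine smul_mem_expSliceMem h01 ?_ hF
    rw [shiftAlg_aeval, s1]
    exact aeval_mem_sliceStab (add_mem hy (Subalgebra.smul_mem _ hX0 _)) g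
  have hT2 : ∀ (g : Polynomial ℂ), ∀ F ∈ T,
      Polynomial.aeval (X 2 - X 1 : MvPolynomial (Fin 3) ℂ) g • F ∈ T := fun g F hF => by
    refine smul_mem_expSliceMem h01 ?_ hF
    rw [shiftAlg_aeval, s2]
    exact aeval_mem_sliceStab hy g
  have hgen : ∀ v ∈ V, ∀ y ∈ Sp, joinVar 0 2 1 (fun m =>
      LinearMap.mulRight ℂ (coeffInf v m)) y ∈ T := by
    intro v hv y hy'
    refine map_mem_of_span _ ?_ hy'
    rintro _ ⟨g, u, v', hu, hv', rfl⟩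
    rw [joinVar_smul (by decide) (by decide) (by decide), rename_aeval, rename_X_sub_X]
    refine hT1 _ _ ⟨_, isExpOp_prod3_zero_one_rev (coeffInf u) (hV v' hv' v hv), fun m => ?_⟩
    convert opPairRev_mem hu (hcl v' hv' v hv (-m - 1)) using 1
    funext e
    rw [slice_zero_apply]
    rfl
  have hspan : ∀ x ∈ Sp, ∃ h' : Polynomial ℂ, h' ≠ 0 ∧
      Polynomial.aeval (X 2 - X 0 : MvPolynomial (Fin 3) ℂ) h' •
        joinVar 1 2 0 (fun m => LinearMap.mulLeft ℂ (coeffInf a m)) x ∈ T := by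
    intro x hx
    refine exists_aeval_smul_map_mem_of_span hT1 _ ?_ hx
    rintro _ ⟨g, u, v, hu, hv, rfl⟩
    obtain ⟨h', hh', hvc⟩ := hav u hu
    refine ⟨h', hh', ?_⟩
    rw [joinVar_smul (by decide) (by decide) (by decide), rename_aeval, rename_X_sub_X, smul_comm]
    refine hT2 _ _ ?_
    have := hgen v hv _ hvc
    rw [joinVar_smul (by decide) (by decide) (by decide), rename_aeval, rename_X_sub_X] at this
    rwa [show joinVar 1 2 0 (fun m => LinearMap.mulLeft ℂ (coeffInf a m)) (opPairRev u v) =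
      joinVar 0 2 1 (fun m => LinearMap.mulRight ℂ (coeffInf v m)) (opPair a u) from
      funext fun e => (mul_assoc _ _ _).symm]
  obtain ⟨h, hh, hbc⟩ := hbc
  obtain ⟨h', hh', x', hx', hsl⟩ := hspan _ hbc
  rw [joinVar_smul (by decide) (by decide) (by decide), rename_aeval, rename_X_sub_X] at hx'
  set B : FDist 3 (Module.End ℂ W) := fun e => coeffInf (nthProd a (-e 0 - 1) b)
      (e 1) * coeffInf c (e 2)
  have hexp : IsExpOp 0 1 (joinVar 1 2 0 (fun m => LinearMap.mulLeft ℂ (coeffInf a m))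
      (opPair b c)) B :=
    isExpOp_prod3_zero_one (coeffInf c) (hV a ha b hb)
  have hx'' :=
      (hexp.smul h01 (Polynomial.aeval (X 2 - X 1) h)).smul h01 (Polynomial.aeval (X 2 - X 0) h')
  obtain rfl := hx'.unique hx''
  obtain ⟨N, hN⟩ := (hV a ha b hb).nthProd_eq_zero
  have hBb : ∀ e : Fin 3 → ℤ, e 0 < -N → B e = 0 := by
    intro e he
    simp only [B]
    rw [hN _ (by omega), coeffInf_zero, zero_mul]
  -- Here x₂-x₀ becomes x₂-x₁-z, which is the case ε = -1.
  have hfin := exists_aeval_smul_slice_mem (s := (0 : Fin 3)) (Sp := Sp) (y := X 1 - X 0)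
      (h := h) (h' := h')
    (ε := -1) (fun x hx => X_sub_X_smul_mem_revSpan hx) hh hh' hBb (fun m => by
      have := hsl m
      rw [smul_smul, shiftAlg_aeval, shiftAlg_aeval, s1, s2, mul_comm] at this
      simpa using this) (-n - 1)
  have : slice 0 (-n - 1) B = opPair (nthProd a n b) c := by
    funext e
    have : -(-n - 1) - 1 = n := by ring
    rw [slice_zero_apply]
    change coeffInf (nthProd a (-(-n - 1) - 1) b) (e 0) * coeffInf c (e 1) = _
    rw [this]; rfl
  rwa [this] at hfin

/-- `⟨U⟩` for a set of local series consists of series that are pairwise local up to polynomials. -/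
theorem polyLocal_generated {U : Set (EInf W)} (hU : IsSLocal U) {a b : EInf W}
    (ha : a ∈ generated U) (hb : b ∈ generated U) :
    PolyLocal (generated U) (generated U) a b := by
  have hS := hU.insert_idInf
  set S := insert (idInf W) U
  have hL := isLeast_generated
    (compatHull_mem_closedSubspaces hS.isCompatible (Set.subset_insert _ _) (Set.mem_insert _ _))
  obtain ⟨⟨_, hcl, h1, hUg⟩, hmin⟩ := hL
  have hle : (generated U : Set (EInf W)) ⊆ compatHull S := hmin
    (compatHull_mem_closedSubspaces hS.isCompatible (Set.subset_insert _ _) (Set.mem_insert _ _))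
  have hcomp : IsCompatible (generated U : Set (EInf W)) :=
    (isCompatible_compatHull hS.isCompatible).mono hle
  have hV : ∀ x ∈ (generated U : Set (EInf W)), ∀ y ∈ (generated U : Set (EInf W)),
      CompatPair x y :=
    fun x hx y hy => hcomp.compatPair hx hy
  have hSg : S ⊆ generated U := Set.insert_subset h1 hUg
  -- Minimality of ⟨U⟩ serves as an induction principle: a closed subspace of ⟨U⟩ containing the
  -- generators is everything.
  have ind : ∀ T : Submodule ℂ (EInf W), S ⊆ T → (T : Set (EInf W)) ⊆ generated U →
      (∀ x ∈ T, ∀ y ∈ T, ∀ n, nthProd x n y ∈ T) → (generated U : Set (EInf W)) ⊆ T :=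
    fun T hST hT hT' => hmin ⟨(hcomp.mono hT).isQuasiCompatible, hT', hST (Set.mem_insert _ _),
      (Set.subset_insert _ _).trans hST⟩
  -- The second argument is enlarged first, with the first one in `S`. Keeping `S` as the place of
  -- the moved operators makes the condition closed under products in `b`.
  have right : ∀ b ∈ generated U, ∀ a ∈ S, PolyLocal (generated U) S a b := by
    have := ind (generated U ⊓ polyLocalRight (generated U) S S)
      (fun b hb => ⟨hSg hb, fun a ha => (hS.polyLocal ha hb).mono hSg subset_rfl⟩)
      (fun b hb => hb.1) fun x hx y hy n => ⟨hcl x hx.1 y hy.1 n, fun a ha =>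
        PolyLocal.nthProd_right hV hcl hx.1 hy.1 (hx.2 a ha) hy.2 n⟩
    exact fun b hb => (this hb).2
  -- Now the first argument is enlarged; locality with all of ⟨U⟩ at once is what is stable under
  -- products in `a`.
  have := ind (generated U ⊓ polyLocalLeft (generated U) (generated U) (generated U))
    (fun a ha => ⟨hSg ha, fun b hb => (right b hb a ha).mono subset_rfl hSg⟩)
    (fun a ha => ha.1) fun x hx y hy n => ⟨hcl x hx.1 y hy.1 n, fun b hb =>
      PolyLocal.nthProd_left hV hcl hx.1 hy.1 (hy.2 b hb) hx.2 n⟩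
  exact (this ha).2 b hb

end PolyLocalGenerated

end VAInf
end

noncomputable section
namespace VAInf

open MvPolynomial (X C)

/-! ### The substitution `x₁ = x₀ + x₂` -/

section SubstAssoc

variable {M M' : Type*} [AddCommGroup M] [Module ℂ M] [AddCommGroup M'] [Module ℂ M']

/-- The sum over naturals is extended by zero to the integers, so that index shifts become
bijections. -/
theorem substAssoc_apply (A : FDist 2 M) (e : Fin 2 → ℤ) :
    substAssoc A e = ∑ᶠ i : ℤ, bin (e 0 + i) i • A ![e 0 + i, e 1 - i] := by
  have : ∀ i : ℤ, bin (e 0 + i) i • A ![e 0 + i, e 1 - i] =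
      ∑ᶠ (_ : i ∈ Set.range ((↑) : ℕ → ℤ)), bin (e 0 + i) i • A ![e 0 + i, e 1 - i] := by
    intro i
    by_cases h : i ∈ Set.range ((↑) : ℕ → ℤ)
    · simp only [h, finsum_true]
    · have hi : i < 0 := by
        by_contra hi
        exact h ⟨i.toNat, by omega⟩
      simp only [h, finsum_false, bin_of_neg _ hi, zero_smul]
  rw [finsum_congr this, finsum_mem_range Nat.cast_injective, substAssoc]
  exact finsum_congr fun i => by rw [bin_natCast]

/-- The series in two variables whose exponents of the second variable are bounded below. -/
def bddBelowSnd (M : Type*) [AddCommGroup M] [Module ℂ M] : Submodule ℂ (FDist 2 M) where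
  carrier := {A | ∃ N : ℤ, ∀ e : Fin 2 → ℤ, e 1 < N → A e = 0}
  zero_mem' := ⟨0, fun _ _ => rfl⟩
  add_mem' := by
    rintro A B ⟨N, hN⟩ ⟨N', hN'⟩
    exact ⟨min N N', fun e he => by rw [Pi.add_apply, hN _ (by omega), hN' _ (by omega), add_zero]⟩
  smul_mem' := by
    rintro z A ⟨N, hN⟩
    exact ⟨N, fun e he => by rw [Pi.smul_apply, hN _ he, smul_zero]⟩

theorem X_smul_mem_bddBelowSnd (i : Fin 2) {A : FDist 2 M} (hA : A ∈ bddBelowSnd M) :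
    (X i : MvPolynomial (Fin 2) ℂ) • A ∈ bddBelowSnd M := by
  obtain ⟨N, hN⟩ := hA
  refine ⟨N, fun e he => smul_apply_eq_zero_of_lt hN _ he⟩

theorem polySMul_mem_bddBelowSnd (P : MvPolynomial (Fin 2) ℂ) {A : FDist 2 M}
    (hA : A ∈ bddBelowSnd M) : P • A ∈ bddBelowSnd M :=
  smul_mem_of_X_smul_mem _ (fun i _ h => X_smul_mem_bddBelowSnd i h) P hA

theorem finite_support_substAssoc {A : FDist 2 M} (hA : A ∈ bddBelowSnd M) (c : ℤ → ℤ)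
    (hc : ∀ i < 0, c i = 0) (f g : ℤ → ℤ) (n : ℤ) (hg : ∀ i, g i = n - i) :
    (Function.support fun i : ℤ => c i • A ![f i, g i]).Finite := by
  obtain ⟨N, hN⟩ := hA
  refine (Set.finite_Icc 0 (n - N)).subset fun i hi => ?_
  by_contra h
  rw [Set.mem_Icc, not_and_or, not_le, not_le] at h
  apply hi
  dsimp only
  rcases h with h | h
  · rw [hc _ h, zero_smul]
  · rw [hN, smul_zero]
    simp [hg]; omega

theorem substAssoc_add {A B : FDist 2 M} (hA : A ∈ bddBelowSnd M) (hB : B ∈ bddBelowSnd M) :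
    substAssoc (A + B) = substAssoc A + substAssoc B := by
  funext e
  simp only [Pi.add_apply, substAssoc_apply, smul_add]
  exact finsum_add_distrib
    (finite_support_substAssoc hA _ (fun i hi => bin_of_neg _ hi) _ _ _ fun _ => rfl)
    (finite_support_substAssoc hB _ (fun i hi => bin_of_neg _ hi) _ _ _ fun _ => rfl)

theorem substAssoc_const_smul (z : ℂ) {A : FDist 2 M} (hA : A ∈ bddBelowSnd M) :
    substAssoc (z • A) = z • substAssoc A := by
  funext e
  simp only [Pi.smul_apply, substAssoc_apply]
  rw [smul_finsum' z
    (finite_support_substAssoc hA _ (fun i hi => bin_of_neg _ hi) _ _ _ fun _ => rfl)]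
  exact finsum_congr fun i => smul_comm _ _ _

theorem substAssoc_X_one_smul (A : FDist 2 M) :
    substAssoc ((X 1 : MvPolynomial (Fin 2) ℂ) • A) = (X 1 : MvPolynomial (Fin 2) ℂ) •
        substAssoc A := by
  funext e
  rw [X_smul_apply, substAssoc_apply, substAssoc_apply]
  refine finsum_congr fun i => ?_
  rw [X_smul_apply, vec2_sub_single_one]
  simp [sub_right_comm]

theorem substAssoc_X_zero_smul {A : FDist 2 M} (hA : A ∈ bddBelowSnd M) :
    substAssoc ((X 0 : MvPolynomial (Fin 2) ℂ) • A) =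
      (X 0 + X 1 : MvPolynomial (Fin 2) ℂ) • substAssoc A := by
  funext e
  rw [add_smul, Pi.add_apply, X_smul_apply, X_smul_apply]
  simp only [substAssoc_apply]
  have h0 : (e - Pi.single 0 1 : Fin 2 → ℤ) 0 = e 0 - 1 := by simp
  have h1 : (e - Pi.single 0 1 : Fin 2 → ℤ) 1 = e 1 := by simp
  have h2 : (e - Pi.single 1 1 : Fin 2 → ℤ) 0 = e 0 := by simp
  have h3 : (e - Pi.single 1 1 : Fin 2 → ℤ) 1 = e 1 - 1 := by simp
  rw [h0, h1, h2, h3]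
  have hre : ∑ᶠ i : ℤ, bin (e 0 + i) i • A ![e 0 + i, e 1 - 1 - i] =
      ∑ᶠ i : ℤ, bin (e 0 - 1 + i) (i - 1) • A ![e 0 - 1 + i, e 1 - i] := by
    rw [← finsum_comp_equiv (Equiv.subRight (1 : ℤ))]
    refine finsum_congr fun i => ?_
    rw [Equiv.subRight_apply, show e 0 + (i - 1) = e 0 - 1 + i by ring,
      show e 1 - 1 - (i - 1) = e 1 - i by ring]
  rw [hre, ← finsum_add_distrib
    (finite_support_substAssoc hA _ (fun i hi => bin_of_neg _ hi) _ _ _ fun _ => rfl)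
    (finite_support_substAssoc hA _ (fun i hi => bin_of_neg _ (by omega)) _ _ _ fun _ => rfl)]
  refine finsum_congr fun i => ?_
  rw [X_smul_apply, vec2_sub_single_zero, ← add_smul, add_comm (bin _ i), ← bin_succ]
  congr 2
  · ring
  · congr 1; ring

/-- The same polynomial substitution as for `substShift`, but with powers expanded in the second
variable; finiteness now comes from a lower bound on its exponents. -/
theorem substAssoc_smul (P : MvPolynomial (Fin 2) ℂ) {A : FDist 2 M} (hA : A ∈ bddBelowSnd M) :
    substAssoc (P • A) = shiftAlg 0 1 P • substAssoc A := by
  refine map_smul_of_map_X_smul (bddBelowSnd M) (fun i _ h => X_smul_mem_bddBelowSnd i h) substAssoc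
    (shiftAlg 0 1) (fun _ hF _ hG => substAssoc_add hF hG)
    (fun c _ hF => substAssoc_const_smul c hF) (fun i F hF => ?_) P hA
  fin_cases i
  · change substAssoc ((X 0 : MvPolynomial (Fin 2) ℂ) • F) = shiftAlg 0 1 (X 0) • _
    rw [shiftAlg_X_self, substAssoc_X_zero_smul hF]
  · change substAssoc ((X 1 : MvPolynomial (Fin 2) ℂ) • F) = shiftAlg 0 1 (X 1) • _
    rw [shiftAlg_X_of_ne 1 (by decide), substAssoc_X_one_smul]

theorem joinVar_substAssoc (φ : ℤ → M →ₗ[ℂ] M') {A : FDist 2 M} (hA : A ∈ bddBelowSnd M) :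
    joinVar 0 1 2 φ (substAssoc A) = assocVar (joinVar 0 1 2 φ A) := by
  funext e
  rw [joinVar_apply, assocVar, substAssoc]
  have hfin : (Function.support fun i : ℕ =>
      (Ring.choose (e 0 + i) i : ℤ) • A ![e 0 + i, e 1 - i]).Finite := by
    obtain ⟨N, hN⟩ := hA
    refine (Set.finite_Iic (e 1 - N).toNat).subset fun i hi => ?_
    rw [Set.mem_Iic]
    by_contra h
    exact hi (by dsimp only; rw [hN _ (by simp; omega), smul_zero])
  have := (φ (e 2)).toAddMonoidHom.map_finsum hfin
  refine this.trans (finsum_congr fun i => ?_)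
  exact map_zsmul _ _ _

end SubstAssoc

/-! ### Expansions of products of three series -/

section Triple

variable {W : Type*} [AddCommGroup W] [Module ℂ W]

/-- `a(x₀) b(x₁) c(x₂) w`. -/
def prod3 (a b c : EInf W) (w : W) : FDist 3 W := fun e =>
  coeffInf a (e 0) (coeffInf b (e 1) (coeffInf c (e 2) w))

/-- `u(x₁) v(x₀) c(x₂) w`. -/
def prod3Rev (u v c : EInf W) (w : W) : FDist 3 W := fun e =>
  coeffInf u (e 1) (coeffInf v (e 0) (coeffInf c (e 2) w))

theorem isExp_prod3_one_two (a : EInf W) {b c : EInf W} (h : CompatPair b c) (w : W) :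
    IsExp 1 2 (prod3 a b c w) fun e => coeffInf a (e 0) (coeffInf (nthProd b (-e 1 - 1) c)
        (e 2) w) :=
  isExpOp_prod3_one_two (coeffInf a) h w

theorem isExp_prod3_zero_one {a b : EInf W} (c : EInf W) (h : CompatPair a b) (w : W) :
    IsExp 0 1 (prod3 a b c w) fun e => coeffInf (nthProd a (-e 0 - 1) b) (e 1)
        (coeffInf c (e 2) w) :=
  isExpOp_prod3_zero_one (coeffInf c) h w

theorem isExp_zero_two_family {a : EInf W} {d : ℤ → EInf W} (h : ∀ m, CompatPair a (d m)) (w : W) :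
    IsExp (0 : Fin 3) 2 (fun e => coeffInf a (e 0) (coeffInf (d (e 1)) (e 2) w))
      fun e => coeffInf (nthProd a (-e 0 - 1) (d (e 1))) (e 2) w := by
  intro e
  have h0 : ∀ f, ins (0 : Fin 3) 2 e f 0 = f 0 := fun f => ins_left (by decide) _ _
  have h1 : ∀ f, ins (0 : Fin 3) 2 e f 1 = e 1 := fun f => ins_of_ne (by decide) (by decide) _ _
  have h2 : ∀ f, ins (0 : Fin 3) 2 e f 2 = f 1 := fun f => ins_right _ _ _ _
  convert (h (e 1)).isExp2 w using 1 <;>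
  · funext f; simp only [fib, h0, h1, h2]; rfl

theorem isExp_one_two_family {d : ℤ → EInf W} {c : EInf W} (h : ∀ m, CompatPair (d m) c) (w : W) :
    IsExp (1 : Fin 3) 2 (fun e => coeffInf (d (e 0)) (e 1) (coeffInf c (e 2) w))
      fun e => coeffInf (nthProd (d (e 0)) (-e 1 - 1) c) (e 2) w := by
  intro e
  have h0 : ∀ f, ins (1 : Fin 3) 2 e f 0 = e 0 := fun f => ins_of_ne (by decide) (by decide) _ _
  have h1 : ∀ f, ins (1 : Fin 3) 2 e f 1 = f 0 := fun f => ins_left (by decide) _ _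
  have h2 : ∀ f, ins (1 : Fin 3) 2 e f 2 = f 1 := fun f => ins_right _ _ _ _
  convert (h (e 0)).isExp2 w using 1 <;>
  · funext f; simp only [fib, h0, h1, h2]; rfl

theorem isExp_prod3Rev_zero_two (u : EInf W) {v c : EInf W} (h : CompatPair v c) (w : W) :
    IsExp 0 2 (prod3Rev u v c w)
      fun e => coeffInf u (e 1) (coeffInf (nthProd v (-e 0 - 1) c) (e 2) w) := by
  intro e
  have h0 : ∀ f, ins (0 : Fin 3) 2 e f 0 = f 0 := fun f => ins_left (by decide) _ _
  have h1 : ∀ f, ins (0 : Fin 3) 2 e f 1 = e 1 := fun f => ins_of_ne (by decide) (by decide) _ _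
  have h2 : ∀ f, ins (0 : Fin 3) 2 e f 2 = f 1 := fun f => ins_right _ _ _ _
  convert (h.isExp2 w).map (coeffInf u (e 1)) using 1 <;>
  · funext f; simp only [fib, mapF_apply, prod3Rev, h0, h1, h2]; rfl

theorem isExp_one_two_family_rev {u : EInf W} {d : ℤ → EInf W} (h : ∀ m, CompatPair u (d m))
    (w : W) :
    IsExp (1 : Fin 3) 2 (fun e => coeffInf u (e 1) (coeffInf (d (e 0)) (e 2) w))
      fun e => coeffInf (nthProd u (-e 1 - 1) (d (e 0))) (e 2) w := by
  intro e
  have h0 : ∀ f, ins (1 : Fin 3) 2 e f 0 = e 0 := fun f => ins_of_ne (by decide) (by decide) _ _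
  have h1 : ∀ f, ins (1 : Fin 3) 2 e f 1 = f 0 := fun f => ins_left (by decide) _ _
  have h2 : ∀ f, ins (1 : Fin 3) 2 e f 2 = f 1 := fun f => ins_right _ _ _ _
  convert (h (e 0)).isExp2 w using 1 <;>
  · funext f; simp only [fib, h0, h1, h2]; rfl

/-- Once a polynomial has cleared the poles, each step of an iterated expansion is an honest
substitution, by uniqueness applied twice. -/
theorem substVar_substVar_eq {s t s' t' : Fin 3} (hst : s ≠ t) (hst' : s' ≠ t')
    (hfib : ∀ F ∈ laurentInf 3 W, ∀ e, fib s' t' e (substVar s t F) ∈ laurentInf 2 W)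
    {F Z B : FDist 3 W} (hF : F ∈ laurentInf 3 W) (h : IsExp s t F Z) (h' : IsExp s' t' Z B) :
    substVar s' t' (substVar s t F) = B := by
  have := (isExp_substVar hst (fib_mem_laurentInf hst hF)).unique h
  subst this
  exact (isExp_substVar hst' (hfib F hF)).unique h'

theorem vandPoly_three : vandPoly 3 = (X 0 - X 1) * (X 0 - X 2) * (X 1 - X 2) := by
  rw [vandPoly, Fin.prod_univ_three, show Finset.Ioi (0 : Fin 3) = {1, 2} from rfl,
    show Finset.Ioi (1 : Fin 3) = {2} from rfl, show Finset.Ioi (2 : Fin 3) = ∅ from rfl,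
    Finset.prod_pair (by decide), Finset.prod_singleton, Finset.prod_empty, mul_one]

end Triple

/-! ### The vertex operator map of a closed compatible space -/

section VertexMap

variable {W : Type*} [AddCommGroup W] [Module ℂ W]

/-- A compatible subspace, closed under all products `a(x)_n b(x)`, that contains `1_W`. -/
structure IsClosedCompatible (V : Submodule ℂ (EInf W)) : Prop where
  compat : IsCompatible (V : Set (EInf W))
  closed : ∀ a ∈ V, ∀ b ∈ V, ∀ n : ℤ, nthProd a n b ∈ V
  one_mem : idInf W ∈ V

variable {V : Submodule ℂ (EInf W)} (hV : IsClosedCompatible V)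
include hV

theorem IsClosedCompatible.pair (a b : V) : CompatPair (a : EInf W) b :=
  hV.compat.compatPair a.2 b.2

/-- The coefficient of `x^n` in `Y(a, x)`. -/
def vertexCoeff (a : V) (n : ℤ) : Module.End ℂ V where
  toFun b := ⟨nthProd a (-n - 1) b, hV.closed a a.2 b b.2 _⟩
  map_add' b b' := Subtype.ext
    (nthProd_add_right (hV.pair a b) (hV.pair a b') (hV.pair a (b + b')) _)
  map_smul' z b := Subtype.ext (nthProd_smul_right z (hV.pair a b) (hV.pair a (z • b)) _)

/-- The vertex operator map `Y`. -/
def vertexMap : V →ₗ[ℂ] VertexOperator ℂ V where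
  toFun a := VertexOperator.of_coeff (vertexCoeff hV a) fun b => by
    obtain ⟨N, hN⟩ := (hV.pair a b).nthProd_eq_zero
    refine ⟨-N, fun n hn => ?_⟩
    by_contra h
    exact hn (Subtype.ext (hN _ (by omega)))
  map_add' a a' := HVertexOperator.coeff_inj (funext fun n => LinearMap.ext fun b => Subtype.ext
    (nthProd_add_left (hV.pair a b) (hV.pair a' b) (hV.pair (a + a') b) _))
  map_smul' z a := HVertexOperator.coeff_inj (funext fun n => LinearMap.ext fun b => Subtype.ext
    (nthProd_smul_left z (hV.pair a b) (hV.pair (z • a) b) _))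

theorem coe_coeff_vertexMap (a : V) (n : ℤ) (b : V) :
    ((HVertexOperator.coeff (vertexMap hV a) n b : V) : EInf W) = nthProd a (-n - 1) b := rfl

theorem coe_ncoeff_vertexMap (a : V) (n : ℤ) (b : V) :
    ((VertexOperator.ncoeff (vertexMap hV a) n b : V) : EInf W) = nthProd a n b := by
  rw [VertexOperator.ncoeff_apply, coe_coeff_vertexMap, show -(-n - 1) - 1 = n by ring]

theorem hasVacuum_vertexMap : HasVacuum (vertexMap hV) ⟨idInf W, hV.one_mem⟩ := by
  have hl : ∀ (b : V) (n m : ℤ) (w : W),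
      coeffInf (nthProd (idInf W) (-n - 1) b) m w = if n = 0 then coeffInf (b :
          EInf W) m w else 0 := by
    intro b n m w
    have := congrFun (yser_idInf_left (b : EInf W) w) ![n, m]
    rwa [prod2_idInf_left] at this
  have hr : ∀ (b : V) (n m : ℤ) (w : W),
      coeffInf (nthProd (b : EInf W) (-n - 1) (idInf W)) m w =
        bin (m + n) n • coeffInf (b : EInf W) (m + n) w := by
    intro b n m w
    exact yser_idInf_right (b : EInf W) w ![n, m]
  refine ⟨fun v => ?_, fun v n hn => ?_, fun v n hn => ?_, fun v => ?_⟩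
  · refine Subtype.ext (eInf_ext fun m w => ?_)
    rw [coe_coeff_vertexMap, hl, if_pos rfl]
  · refine Subtype.ext (eInf_ext fun m w => ?_)
    rw [coe_coeff_vertexMap, hl, if_neg hn]
    simp [coeffInf_zero]
  · refine Subtype.ext (eInf_ext fun m w => ?_)
    rw [coe_coeff_vertexMap, hr, bin_of_neg _ hn, zero_smul]
    simp [coeffInf_zero]
  · refine Subtype.ext (eInf_ext fun m w => ?_)
    rw [coe_coeff_vertexMap, hr, bin_zero_right, one_smul, add_zero]

/-- This is `isExp2_with_of_mem` read in the notation of modules, since (x₁-x₂)^k becomes x₀^k. -/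
theorem isModuleAtInfinity_vertexMap :
    IsModuleAtInfinity (vertexMap hV) ⟨idInf W, hV.one_mem⟩ V.subtype := by
  have key : ∀ a b : V, ∃ k : ℕ,
      AssocAtInfinity (vertexMap hV) V.subtype a b ((X 0 - X 1) ^ k) := by
    intro a b
    obtain ⟨k, hk⟩ := hV.pair a b
    refine ⟨k, isHomLaurentInf_iff.2 fun w => ?_, fun w => ?_⟩
    · exact (appVec_opProd_pair _ (a : EInf W) b w).symm ▸ hk w
    · refine Eq.trans ?_ ((isExp2_with_of_mem hk w).symm.trans
        (congrArg substShift (appVec_opProd_pair _ (a : EInf W) b w).symm))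
      rw [← shiftAlg_zero_one, map_pow, shiftAlg_X_sub_X (by decide)]
      rfl
  refine ⟨⟨rfl, fun a b => ?_⟩, key⟩
  obtain ⟨k, hk⟩ := key a b
  exact ⟨_, pow_ne_zero _ (X_sub_X_ne_zero (by decide)), hk⟩

/-- `Y(a, x₁) Y(b, x₂) c`. -/
def vprod (a b c : V) : FDist 2 V := fun e =>
  HVertexOperator.coeff (vertexMap hV a) (e 0) (HVertexOperator.coeff (vertexMap hV b) (e 1) c)

/-- `Y(a, x₂) Y(b, x₁) c`. -/
def vprodRev (a b c : V) : FDist 2 V := fun e =>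
  HVertexOperator.coeff (vertexMap hV a) (e 1) (HVertexOperator.coeff (vertexMap hV b) (e 0) c)

/-- `Y(Y(a, x₀) b, x₂) c`. -/
def viter (a b c : V) : FDist 2 V := fun e =>
  HVertexOperator.coeff (vertexMap hV (HVertexOperator.coeff (vertexMap hV a) (e 0) b)) (e 1) c

end VertexMap

/-! ### Weak associativity from expansions of triple products -/

section VertexIdentities

variable {W : Type*} [AddCommGroup W] [Module ℂ W] {L : Type*} [AddCommGroup L] [Module ℂ L]

/-- The coefficients of the series parametrized by `L`, applied to `w`. -/
def evCoeff (ι : L →ₗ[ℂ] EInf W) (w : W) (m : ℤ) : L →ₗ[ℂ] W where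
  toFun a := coeffInf (ι a) m w
  map_add' a b := by rw [map_add, coeffInf_add]; rfl
  map_smul' z a := by rw [map_smul, coeffInf_smul]; rfl

/-- A series with coefficients in `L` as a series in one more variable with coefficients in `W`. -/
abbrev evSeries (ι : L →ₗ[ℂ] EInf W) (w : W) : FDist 2 L →ₗ[ℂ] FDist 3 W :=
  joinVar 0 1 2 (evCoeff ι w)

theorem evSeries_smul (ι : L →ₗ[ℂ] EInf W) (w : W) (P : MvPolynomial (Fin 2) ℂ) (A : FDist 2 L) :
    evSeries ι w (P • A) =
      MvPolynomial.rename ![(0 : Fin 3), 1] P • evSeries ι w A :=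
  joinVar_smul (by decide) (by decide) (by decide) _ _ _

theorem evSeries_apply_ext {ι : L →ₗ[ℂ] EInf W} (hι : Function.Injective ι) {A B : FDist 2 L}
    {e : Fin 2 → ℤ} (h : ∀ w m, evSeries ι w A ![e 0, e 1, m] = evSeries ι w B ![e 0, e 1, m]) :
    A e = B e := by
  have he : e = ![e 0, e 1] := by
    funext i; fin_cases i <;> rfl
  rw [he]
  exact hι (eInf_ext fun m w => h w m)

theorem evSeries_ext {ι : L →ₗ[ℂ] EInf W} (hι : Function.Injective ι) {A B : FDist 2 L}
    (h : ∀ w, evSeries ι w A = evSeries ι w B) : A = B :=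
  funext fun _ => evSeries_apply_ext hι fun w _ => congrFun (h w) _

variable {V : Submodule ℂ (EInf W)}
variable (hV : IsClosedCompatible V)
include hV

theorem vprod_mem_bddBelowSnd (a b c : V) : vprod hV a b c ∈ bddBelowSnd V := by
  obtain ⟨N, hN⟩ := (hV.pair b c).nthProd_eq_zero
  refine ⟨-N, fun e he => ?_⟩
  have : HVertexOperator.coeff (vertexMap hV b) (e 1) c = 0 := Subtype.ext (hN _ (by omega))
  rw [vprod, this, map_zero]

theorem exists_vandPoly_smul_prod3 (a b c : V) : ∃ k : ℕ, ∀ w,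
    ((X 0 - X 1) * (X 0 - X 2) * (X 1 - X 2) : MvPolynomial (Fin 3) ℂ) ^ k • prod3 (a :
        EInf W) b c w ∈
      laurentInf 3 W := by
  obtain ⟨k, hk⟩ := isCompatibleSeq_iff.1 (hV.compat 3 ![(a : EInf W), b, c] fun i => by
    fin_cases i
    exacts [a.2, b.2, c.2])
  refine ⟨k, fun w => ?_⟩
  have := hk w
  rw [vandPoly_three] at this
  convert this using 2
  funext e
  rw [prodSeq_succ, prodSeq_succ, prodSeq_succ, prodSeq_zero]
  rfl

/-- Expanding b(x₁)c(x₂) at x₁ = x₂+z₁ gives Y(b,z₁)c; expanding a(x₀) against its coefficients at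
x₀ = x₂+z₀ then gives Y(a,z₀)Y(b,z₁)c. -/
theorem substVar_smul_prod3_eq_vprod (a b c : V) {P : MvPolynomial (Fin 3) ℂ}
    {Q : MvPolynomial (Fin 2) ℂ} (hPQ : shiftAlg 0 2 (shiftAlg 1 2 P) =
      MvPolynomial.rename ![(0 : Fin 3), 1] Q) {w : W}
    (hP : P • prod3 (a : EInf W) b c w ∈ laurentInf 3 W) :
    substVar 0 2 (substVar 1 2 (P • prod3 (a : EInf W) b c w)) =
      evSeries V.subtype w (Q • vprod hV a b c) := by
  have := substVar_substVar_eq (by decide) (by decide)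
    (fun _ h => fib_zero_two_substVar_one_two h) hP
    ((isExp_prod3_one_two (a : EInf W) (hV.pair b c) w).smul (by decide) _)
    ((isExp_zero_two_family (d := fun m => nthProd (b : EInf W) (-m - 1) c)
      (fun m => hV.pair a ⟨_, hV.closed b b.2 c c.2 (-m - 1)⟩) w).smul (by decide) _)
  rw [this, evSeries_smul, hPQ]
  rfl

theorem substVar_smul_prod3_eq_viter (a b c : V) {P : MvPolynomial (Fin 3) ℂ}
    {Q : MvPolynomial (Fin 2) ℂ} (hPQ : shiftAlg 1 2 (shiftAlg 0 1 P) =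
      MvPolynomial.rename ![(0 : Fin 3), 1] Q) {w : W}
    (hP : P • prod3 (a : EInf W) b c w ∈ laurentInf 3 W) :
    substVar 1 2 (substVar 0 1 (P • prod3 (a : EInf W) b c w)) =
      evSeries V.subtype w (Q • viter hV a b c) := by
  have := substVar_substVar_eq (by decide) (by decide)
    (fun _ h => fib_one_two_substVar_zero_one h) hP
    ((isExp_prod3_zero_one (c : EInf W) (hV.pair a b) w).smul (by decide) _)
    ((isExp_one_two_family (d := fun m => nthProd (a : EInf W) (-m - 1) b)
      (fun m => hV.pair ⟨_, hV.closed a a.2 b b.2 (-m - 1)⟩ c) w).smul (by decide) _)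
  rw [this, evSeries_smul, hPQ]
  rfl

/-- Weak associativity, together with the polynomial behaviour of the clearing of denominators. -/
theorem exists_assoc_data (a b c : V) : ∃ (k : ℕ) (G : FDist 2 V),
    ((X 0 - X 1) * X 0 * X 1 : MvPolynomial (Fin 2) ℂ) ^ k • vprod hV a b c = G ∧
    (∀ e : Fin 2 → ℤ, e 0 < 0 ∨ e 1 < 0 → G e = 0) ∧
    (X 0 * (X 0 + X 1) * X 1 : MvPolynomial (Fin 2) ℂ) ^ k • viter hV a b c = substAssoc G := by
  obtain ⟨k, hk⟩ := exists_vandPoly_smul_prod3 hV a b c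
  have h12 : (1 : Fin 3) ≠ 2 := by decide
  have h02 : (0 : Fin 3) ≠ 2 := by decide
  have h01 : (0 : Fin 3) ≠ 1 := by decide
  -- Along this route the three differences become z₀-z₁, z₀, z₁; along the other one they become
  -- z₀, z₀+z₁, z₁. In neither case does the base variable remain.
  have hQ : shiftAlg (0 : Fin 3) 2 (shiftAlg 1 2 ((X 0 - X 1) * (X 0 - X 2) * (X 1 - X 2))) =
      MvPolynomial.rename ![(0 : Fin 3), 1] ((X 0 - X 1) * X 0 * X 1) := by
    simp only [map_mul, map_sub, map_add, shiftAlg_X_self, shiftAlg_X_of_ne 2 h01,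
      shiftAlg_X_of_ne 2 h01.symm, shiftAlg_X_of_ne 2 h02.symm, shiftAlg_X_of_ne 2 h12.symm,
      MvPolynomial.rename_X, Matrix.cons_val_zero, Matrix.cons_val_one]
    ring
  have hQ' : shiftAlg (1 : Fin 3) 2 (shiftAlg 0 1 ((X 0 - X 1) * (X 0 - X 2) * (X 1 - X 2))) =
      MvPolynomial.rename ![(0 : Fin 3), 1] (X 0 * (X 0 + X 1) * X 1) := by
    simp only [map_mul, map_sub, map_add, shiftAlg_X_self, shiftAlg_X_of_ne 2 h01,
      shiftAlg_X_of_ne 1 h01.symm, shiftAlg_X_of_ne 1 h02.symm, shiftAlg_X_of_ne 2 h12.symm,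
      MvPolynomial.rename_X, Matrix.cons_val_zero, Matrix.cons_val_one]
    ring
  have hA := fun w => substVar_smul_prod3_eq_vprod hV a b c (Q := ((X 0 - X 1) * X 0 * X 1) ^ k)
    (by rw [map_pow, map_pow, map_pow, hQ]) (hk w)
  have hC := fun w => substVar_smul_prod3_eq_viter hV a b c (Q := (X 0 * (X 0 + X 1) * X 1) ^ k)
    (by rw [map_pow, map_pow, map_pow, hQ']) (hk w)
  have hmem := polySMul_mem_bddBelowSnd (((X 0 - X 1) * X 0 * X 1) ^ k)
    (vprod_mem_bddBelowSnd hV a b c)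
  refine ⟨k, _, rfl, fun e he => evSeries_apply_ext (B := 0) V.injective_subtype fun w m => ?_,
    evSeries_ext V.injective_subtype fun w => ?_⟩
  -- The substitution yields only nonnegative powers of both new variables.
  · rw [← hA, map_zero]
    rcases he with he | he
    · exact substVar_apply_eq_zero_of_neg he
    · exact substVar_one_two_neg _ he
  · rw [← hC, joinVar_substAssoc _ hmem, ← hA, assocVar_substVar (hk w)]

/-- Both sides of the cleared identity carry the same powers of x₀ and x₂; cancelling these leaves
exactly the factor (x₀+x₂)^k. -/
theorem isNonlocalVertexAlgebra_vertexMap :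
    IsNonlocalVertexAlgebra (vertexMap hV) ⟨idInf W, hV.one_mem⟩ := by
  refine ⟨hasVacuum_vertexMap hV, fun u v w => ?_⟩
  obtain ⟨k, G, hG, -, hassoc⟩ := exists_assoc_data hV u v w
  refine ⟨k, ?_⟩
  change ((X 0 + X 1) ^ k : MvPolynomial (Fin 2) ℂ) • substAssoc (vprod hV u v w) =
    ((X 0 + X 1) ^ k : MvPolynomial (Fin 2) ℂ) • viter hV u v w
  rw [← hG, substAssoc_smul _ (vprod_mem_bddBelowSnd hV u v w)] at hassoc
  refine X_pow_smul_injective 0 k (X_pow_smul_injective 1 k ?_)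
  dsimp only
  simp only [smul_smul]
  simp only [map_pow, map_mul, shiftAlg_X_sub_X (show (0 : Fin 2) ≠ 1 by decide), shiftAlg_X_self,
    shiftAlg_X_of_ne 1 (show (1 : Fin 2) ≠ 0 by decide)] at hassoc
  convert hassoc.symm using 2 <;> (rw [mul_pow, mul_pow]; ring)

end VertexIdentities

end VAInf
end

noncomputable section
namespace VAInf

open MvPolynomial (X C)

/-! ### From locality of operators to locality of vertex operators -/

section Locality

variable {W : Type*} [AddCommGroup W] [Module ℂ W]

theorem sum_polySMul {q r : ℕ} {M : Type*} [AddCommGroup M] [Module ℂ M]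
    (R : MvPolynomial (Fin q) ℂ) (f : Fin r → FDist q M) : ∑ i, R • f i = R • ∑ i, f i :=
  Finset.smul_sum.symm

theorem joinVar_mem_bddVar {M M' : Type*} [AddCommGroup M] [Module ℂ M] [AddCommGroup M']
    [Module ℂ M'] (i j k : Fin 3) (φ : ℤ → M →ₗ[ℂ] M') {A : FDist 2 M} (hA : A ∈ laurentInf 2 M) :
    joinVar i j k φ A ∈ bddVar M' i ∧ joinVar i j k φ A ∈ bddVar M' j := by
  obtain ⟨N, hN⟩ := mem_laurentInf.1 hA
  refine ⟨⟨N, fun e he => ?_⟩, ⟨N, fun e he => ?_⟩⟩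
  · rw [joinVar_apply, hN _ ⟨0, he⟩, map_zero]
  · rw [joinVar_apply, hN _ ⟨1, he⟩, map_zero]

theorem exists_eq_sum_of_mem_revSpan {S T : Set (EInf W)} {F : FDist 2 (Module.End ℂ W)}
    (hF : F ∈ revSpan S T) : ∃ (r : ℕ) (g : Fin r → Polynomial ℂ) (u : Fin r → S) (v : Fin r → T),
      F = ∑ i, Polynomial.aeval (X 1 - X 0 : MvPolynomial (Fin 2) ℂ) (g i) •
        opPairRev (u i : EInf W) (v i) := by
  obtain ⟨r, z, x, rfl⟩ := Submodule.mem_span_set'.1 hF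
  choose g u v hu hv hx using fun i => (x i).2
  refine ⟨r, fun i => z i • g i, fun i => ⟨u i, hu i⟩, fun i => ⟨v i, hv i⟩,
    Finset.sum_congr rfl fun i _ => ?_⟩
  rw [hx, map_smul, smul_assoc]

variable {V : Submodule ℂ (EInf W)} (hV : IsClosedCompatible V)
include hV

theorem IsClosedCompatible.exists_pole_order (c : V) {r : ℕ} (v : Fin r → V) : ∃ K : ℕ, ∀ i w,
    ((X 0 - X 1) ^ K : MvPolynomial (Fin 2) ℂ) • prod2 (v i : EInf W) c w ∈ laurentInf 2 W := by
  choose k hk using fun i => hV.pair (v i) c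
  obtain ⟨K, hK⟩ := (Set.finite_range k).bddAbove
  exact ⟨K, fun i w => smul_mem_of_dvd (pow_dvd_pow _ (hK ⟨i, rfl⟩)) (hk i w)⟩

theorem substVar_sum_prod3Rev_eq_vprodRev {r : ℕ} (u v : Fin r → V) (c : V)
    {P : Fin r → MvPolynomial (Fin 3) ℂ} {Q : Fin r → MvPolynomial (Fin 2) ℂ}
    (hPQ : ∀ i, shiftAlg 1 2 (shiftAlg 0 2 (P i)) = MvPolynomial.rename ![(0 : Fin 3), 1] (Q i))
    {w : W} (hP : ∑ i, P i • prod3Rev (u i : EInf W) (v i) c w ∈ laurentInf 3 W) :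
    substVar 1 2 (substVar 0 2 (∑ i, P i • prod3Rev (u i : EInf W) (v i) c w)) =
      evSeries V.subtype w (∑ i, Q i • vprodRev hV (u i) (v i) c) := by
  have := substVar_substVar_eq (by decide) (by decide)
    (fun _ h => fib_one_two_substVar_zero_two h) hP
    (IsExp.sum Finset.univ fun i =>
      (isExp_prod3Rev_zero_two (u i : EInf W) (hV.pair (v i) c) w).smul (by decide) (P i))
    (IsExp.sum Finset.univ fun i =>
      (isExp_one_two_family_rev (d := fun m => nthProd (v i : EInf W) (-m - 1) c)
        (fun m => hV.pair (u i) ⟨_, hV.closed _ (v i).2 c c.2 (-m - 1)⟩) w).smul (by decide)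
          (shiftAlg 0 2 (P i)))
  rw [this, map_sum]
  refine Finset.sum_congr rfl fun i _ => ?_
  rw [evSeries_smul, hPQ]
  rfl

/-- Polynomial locality of `a(x₁) b(x₂)` gives polynomial locality of `Y(a, x₁) Y(b, x₂)`. -/
theorem PolyLocal.exists_vprod_eq {a b : V} (h : PolyLocal (V : Set (EInf W)) V a b) :
    ∃ (p : Polynomial ℂ) (r : ℕ) (g : Fin r → Polynomial ℂ) (u v : Fin r → V), p ≠ 0 ∧ ∀ c : V,
      Polynomial.aeval (X 1 - X 0 : MvPolynomial (Fin 2) ℂ) p • vprod hV a b c =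
        ∑ i, Polynomial.aeval (X 1 - X 0 : MvPolynomial (Fin 2) ℂ) (g i) •
          vprodRev hV (u i) (v i) c := by
  obtain ⟨p, hp, hab⟩ := h
  obtain ⟨r, g, u, v, hab⟩ := exists_eq_sum_of_mem_revSpan hab
  -- None of these data depends on `c`; only the auxiliary exponent `K` below does. The Jacobi
  -- identity requires this independence.
  refine ⟨p, r, g, u, v, hp, fun c => ?_⟩
  obtain ⟨k1, hk1⟩ := hV.pair b c
  obtain ⟨k2, hk2⟩ := hV.exists_pole_order c v
  let K := max k1 k2
  have hbc : ∀ w, ((X 0 - X 1) ^ K : MvPolynomial (Fin 2) ℂ) • prod2 (b : EInf W) c w ∈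
      laurentInf 2 W := fun w => smul_mem_of_dvd (pow_dvd_pow _ (le_max_left _ _)) (hk1 w)
  have hvc : ∀ i w, ((X 0 - X 1) ^ K : MvPolynomial (Fin 2) ℂ) • prod2 (v i : EInf W) c w ∈
      laurentInf 2 W := fun i w => smul_mem_of_dvd (pow_dvd_pow _ (le_max_right _ _)) (hk2 i w)
  have h12 : (1 : Fin 3) ≠ 2 := by decide
  have h02 : (0 : Fin 3) ≠ 2 := by decide
  have h01 : (0 : Fin 3) ≠ 1 := by decide
  -- No power of x₀-x₁ is included beyond q(x₁-x₀): extra denominators there would not cancel as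
  -- monomials. The factors x₀-x₂ and x₁-x₂ become the variables z₀ and z₁.
  let P : Polynomial ℂ → MvPolynomial (Fin 3) ℂ := fun q =>
    ((X 0 - X 2) * (X 1 - X 2)) ^ K * Polynomial.aeval (X 1 - X 0) q
  let Q : Polynomial ℂ → MvPolynomial (Fin 2) ℂ := fun q =>
    (X 0 * X 1) ^ K * Polynomial.aeval (X 1 - X 0) q
  have hdiff : shiftAlg (0 : Fin 3) 2 (shiftAlg 1 2 (X 1 - X 0)) = X 1 - X 0 := by
    simp only [map_sub, map_add, shiftAlg_X_self, shiftAlg_X_of_ne 2 h01,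
      shiftAlg_X_of_ne 2 h01.symm, shiftAlg_X_of_ne 2 h02.symm]
    ring
  have hdiff' : shiftAlg (1 : Fin 3) 2 (shiftAlg 0 2 (X 1 - X 0)) = X 1 - X 0 := by
    simp only [map_sub, map_add, shiftAlg_X_self, shiftAlg_X_of_ne 2 h01,
      shiftAlg_X_of_ne 2 h01.symm, shiftAlg_X_of_ne 2 h12.symm]
    ring
  have hPQ : ∀ q, shiftAlg 0 2 (shiftAlg 1 2 (P q)) = MvPolynomial.rename ![(0 : Fin 3),
      1] (Q q) := by
    intro q
    simp only [P, Q, map_mul, map_pow, shiftAlg_aeval, rename_aeval, rename_X_sub_X, hdiff]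
    simp only [map_sub, shiftAlg_X_self, shiftAlg_X_of_ne 2 h01,
      shiftAlg_X_of_ne 2 h01.symm, shiftAlg_X_of_ne 2 h02.symm, shiftAlg_X_of_ne 2 h12.symm,
      MvPolynomial.rename_X, Matrix.cons_val_zero, Matrix.cons_val_one, add_sub_cancel_right]
  have hPQ' : ∀ q, shiftAlg 1 2 (shiftAlg 0 2 (P q)) = MvPolynomial.rename ![(0 : Fin 3),
      1] (Q q) := by
    intro q
    simp only [P, Q, map_mul, map_pow, shiftAlg_aeval, rename_aeval, rename_X_sub_X, hdiff']
    simp only [map_sub, shiftAlg_X_self, shiftAlg_X_of_ne 2 h01,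
      shiftAlg_X_of_ne 2 h01.symm, shiftAlg_X_of_ne 2 h02.symm, shiftAlg_X_of_ne 2 h12.symm,
      MvPolynomial.rename_X, Matrix.cons_val_zero, Matrix.cons_val_one, add_sub_cancel_right]
  have hop : ∀ w, P p • prod3 (a : EInf W) b c w = ∑ i, P (g i) • prod3Rev (u i : EInf W)
      (v i) c w := by
    intro w
    have := congrArg (joinVar 0 1 2 fun m => LinearMap.applyₗ (coeffInf (c : EInf W) m w)) hab
    rw [map_sum, joinVar_smul h01 h02 h12, rename_aeval, rename_X_sub_X] at this
    simp only [P, mul_smul]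
    rw [← Finset.smul_sum]
    refine congrArg _ (this.trans (Finset.sum_congr rfl fun i _ => ?_))
    rw [joinVar_smul h01 h02 h12, rename_aeval, rename_X_sub_X]
    rfl
  have hleft : ∀ w, P p • prod3 (a : EInf W) b c w ∈ bddVar W 1 ∧
      P p • prod3 (a : EInf W) b c w ∈ bddVar W 2 := by
    intro w
    have := joinVar_mem_bddVar 1 2 0 (coeffInf (a : EInf W)) (hbc w)
    rw [joinVar_smul h12 h01.symm h02.symm, map_pow,
      show MvPolynomial.rename ![(1 : Fin 3), 2] (X 0 - X 1 : MvPolynomial (Fin 2) ℂ) = X 1 - X 2 by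
        simp] at this
    have hd : ((X 1 - X 2) ^ K : MvPolynomial (Fin 3) ℂ) ∣ P p :=
      dvd_mul_of_dvd_left (pow_dvd_pow_of_dvd (dvd_mul_left _ _) _) _
    exact ⟨smul_mem_of_dvd hd this.1, smul_mem_of_dvd hd this.2⟩
  have hright : ∀ w, ∑ i, P (g i) • prod3Rev (u i : EInf W) (v i) c w ∈ bddVar W 0 := by
    intro w
    refine sum_mem fun i _ => ?_
    have := (joinVar_mem_bddVar 0 2 1 (coeffInf (u i : EInf W)) (hvc i w)).1
    rw [joinVar_smul h02 h01 h12.symm, map_pow,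
      show MvPolynomial.rename ![(0 : Fin 3), 2] (X 0 - X 1 : MvPolynomial (Fin 2) ℂ) = X 0 - X 2 by
        simp] at this
    have hd : ((X 0 - X 2) ^ K : MvPolynomial (Fin 3) ℂ) ∣ P (g i) :=
      dvd_mul_of_dvd_left (pow_dvd_pow_of_dvd (dvd_mul_right _ _) _) _
    exact smul_mem_of_dvd hd this
  -- The order abc bounds x₁ and x₂, since b and c act first; the reversed order bounds x₀, since
  -- there v_i and c act first. Equality of the two expressions gives all three bounds.
  have hmem : ∀ w, P p • prod3 (a : EInf W) b c w ∈ laurentInf 3 W := by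
    intro w
    refine mem_laurentInf'.2 fun i => ?_
    fin_cases i
    · exact hop w ▸ hright w
    · exact (hleft w).1
    · exact (hleft w).2
  have hfin : Q p • vprod hV a b c = ∑ i, Q (g i) • vprodRev hV (u i) (v i) c := by
    refine evSeries_ext V.injective_subtype fun w => ?_
    -- The products ab and ba require the substitutions in opposite orders, which agree on series
    -- without poles.
    rw [← substVar_smul_prod3_eq_vprod hV a b c (hPQ p) (hmem w), substVar_comm (hmem w), hop,
      substVar_sum_prod3Rev_eq_vprodRev hV u v c (fun i => hPQ' (g i)) (hop w ▸ hmem w)]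
  simp only [Q, mul_smul, mul_pow] at hfin
  have hsum : ∀ (R : MvPolynomial (Fin 2) ℂ) (f : Fin r → FDist 2 V), ∑ i, R • f i = R • ∑ i, f i :=
    fun R f => sum_polySMul R f
  rw [hsum, hsum] at hfin
  exact X_pow_smul_injective 1 K (X_pow_smul_injective 0 K hfin)

end Locality

end VAInf
end

noncomputable section
namespace VAInf

open MvPolynomial (X C)

/-! ### Formal delta series -/

section Delta

variable {M : Type*} [AddCommGroup M] [Module ℂ M]

theorem deltaSeries_apply (z x y : Fin 3) (α β γ : ℂ) (e : Fin 3 → ℤ) :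
    deltaSeries z x y α β γ e = if e z + e x + e y + 1 = 0 then
      (bin (e x + e y) (e y) : ℂ) * α ^ (e x) * β ^ (e y) * γ ^ (-(e x + e y)) else 0 := by
  rw [deltaSeries]
  by_cases h : 0 ≤ e y
  · simp only [h, and_true, bin_of_nonneg _ h]
  · simp [h, bin_of_neg _ (not_le.1 h)]

theorem deltaSeries_eq_zero {z x y : Fin 3} {α β γ : ℂ} {e : Fin 3 → ℤ}
    (h : e z + e x + e y + 1 ≠ 0 ∨ e y < 0) : deltaSeries z x y α β γ e = 0 :=
  if_neg fun h' => by omega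

/-- Under the delta series γz may be replaced by αx+βy; coefficientwise this is Pascal's rule. -/
theorem deltaSeries_relation {z x y : Fin 3} (hzx : z ≠ x) (hzy : z ≠ y) (hxy : x ≠ y) {α β γ : ℂ}
    (hα : α ≠ 0) (hβ : β ≠ 0) (hγ : γ ≠ 0) :
    (C γ * X z : MvPolynomial (Fin 3) ℂ) • deltaSeries z x y α β γ =
      (C α * X x + C β * X y : MvPolynomial (Fin 3) ℂ) • deltaSeries z x y α β γ := by
  funext e
  simp only [add_smul, mul_smul, C_smul, Pi.add_apply, Pi.smul_apply, X_smul_apply,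
    deltaSeries_apply, Pi.sub_apply, Pi.single_eq_same, Pi.single_eq_of_ne hzx,
    Pi.single_eq_of_ne hzy, Pi.single_eq_of_ne hxy, Pi.single_eq_of_ne hzx.symm,
    Pi.single_eq_of_ne hzy.symm, Pi.single_eq_of_ne hxy.symm, sub_zero, smul_eq_mul]
  by_cases h : e z + e x + e y = 0
  · rw [if_pos (by omega), if_pos (by omega), if_pos (by omega)]
    have h4 := bin_succ (e x + e y - 1) (e y)
    rw [sub_add_cancel] at h4
    rw [show e x - 1 + e y = e x + e y - 1 by ring, show e x + (e y - 1) =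
        e x + e y - 1 by ring, h4,
      show -(e x + e y - 1) = -(e x + e y) + 1 by ring, zpow_add_one₀ hγ, zpow_sub_one₀ hα,
      zpow_sub_one₀ hβ]
    push_cast
    field_simp
    ring
  · rw [if_neg (by omega), if_neg (by omega), if_neg (by omega)]
    simp

theorem bin_natCast_symm (n : ℕ) {i j : ℤ} (h : i + j = n) : bin n i = bin n j := by
  rcases lt_or_ge i 0 with hi | hi
  · obtain ⟨j, rfl⟩ := Int.eq_ofNat_of_zero_le (show 0 ≤ j by omega)
    rw [bin_of_neg _ hi, bin_natCast, Ring.choose_natCast, Nat.choose_eq_zero_of_lt (by omega)]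
    rfl
  · obtain ⟨i, rfl⟩ := Int.eq_ofNat_of_zero_le hi
    rcases lt_or_ge j 0 with hj | hj
    · rw [bin_of_neg _ hj, bin_natCast, Ring.choose_natCast, Nat.choose_eq_zero_of_lt (by omega)]
      rfl
    · obtain ⟨j, rfl⟩ := Int.eq_ofNat_of_zero_le hj
      rw [bin_natCast, bin_natCast, Ring.choose_natCast, Ring.choose_natCast,
        Nat.choose_symm_of_eq_add (show n = i + j by omega)]

theorem bin_neg_eq (n j : ℤ) : (bin (-n) j : ℂ) = (-1) ^ j * (bin (n + j - 1) j : ℂ) := by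
  rcases lt_or_ge j 0 with hj | hj
  · rw [bin_of_neg _ hj, bin_of_neg _ hj]; simp
  · obtain ⟨j, rfl⟩ := Int.eq_ofNat_of_zero_le hj
    rw [bin_natCast, bin_natCast, Ring.choose_neg]
    simp [Int.negOnePow_def, Units.smul_def]

/-- The three-term identity for formal delta series. -/
theorem deltaSeries_sub : deltaSeries 0 1 2 1 (-1) 1 - deltaSeries 0 2 1 1 (-1) (-1) =
    deltaSeries 2 1 0 1 (-1) 1 := by
  funext e
  simp only [Pi.sub_apply, deltaSeries_apply, one_zpow, mul_one]
  generalize e 0 = a, e 1 = b, e 2 = c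
  by_cases h : a + b + c + 1 = 0
  · rw [if_pos h, if_pos (by omega), if_pos (by omega)]
    have hsq : ∀ n : ℤ, ((-1 : ℂ) ^ n) * (-1) ^ n = 1 := fun n => by
      rw [← mul_zpow]; simp
    have h2 : (-1 : ℂ) ^ b * (-1) ^ (-(c + b)) = (-1) ^ c := by
      rw [← zpow_add₀ (by norm_num), show b + -(c + b) = -c by ring, zpow_neg]
      exact inv_eq_of_mul_eq_one_left (hsq c)
    have h1 : (-1 : ℂ) ^ a = -((-1) ^ b * (-1) ^ c) := by
      rw [show a = -(b + c + 1) by omega, zpow_neg, zpow_add_one₀ (by norm_num),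
        zpow_add₀ (by norm_num)]
      apply inv_eq_of_mul_eq_one_left
      linear_combination (hsq b) * ((-1 : ℂ) ^ c * (-1) ^ c) + hsq c
    rw [mul_assoc (_ : ℂ) ((-1) ^ b), h2]
    -- For b+c ≥ 0 the first two terms cancel by symmetry of binomials, and a < 0 kills the third.
    -- For b+c < 0 the upper arguments are made nonnegative by reflection; the signs of b and c then
    -- decide which one of the first two terms matches the third, or that all vanish.
    rcases le_or_gt 0 (b + c) with hn | hn
    · obtain ⟨n, hn'⟩ := Int.eq_ofNat_of_zero_le hn
      rw [bin_of_neg (b + a) (by omega), add_comm c b, hn', bin_natCast_symm n (i := b) (j :=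
          c) hn']
      simp
    · obtain ⟨n, rfl⟩ := Int.eq_ofNat_of_zero_le (show 0 ≤ a by omega)
      rw [add_comm c b, show b + c = -((n : ℤ) + 1) by omega, bin_neg_eq, bin_neg_eq]
      rw [show (n : ℤ) + 1 + c - 1 = n + c by ring, show (n : ℤ) + 1 + b - 1 = n + b by ring,
        add_comm b (n : ℤ)]
      rcases le_or_gt 0 c with hc | hc
      · obtain ⟨c, rfl⟩ := Int.eq_ofNat_of_zero_le hc
        rw [bin_of_neg _ (show b < 0 by omega), show (n : ℤ) + b = -((c : ℤ) + 1) by omega,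
          bin_neg_eq, show (c : ℤ) + 1 + n - 1 = ((n + c : ℕ) : ℤ) by push_cast; ring,
          show (n : ℤ) + c = ((n + c : ℕ) : ℤ) by push_cast; ring,
          bin_natCast_symm (n + c) (i := n) (j := c) (by push_cast; ring)]
        linear_combination ((bin ((n + c : ℕ) : ℤ) c : ℤ) : ℂ) * (hsq c - hsq n)
      · rw [bin_of_neg _ hc]
        rcases le_or_gt 0 b with hb | hb
        · obtain ⟨b, rfl⟩ := Int.eq_ofNat_of_zero_le hb
          rw [show (n : ℤ) + b = ((n + b : ℕ) : ℤ) by push_cast; ring,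
            bin_natCast_symm (n + b) (i := n) (j := b) (by push_cast; ring)]
          linear_combination (-((bin ((n + b : ℕ) : ℤ) b : ℤ) : ℂ)) * h1
        · rw [bin_of_neg _ hb]
          obtain ⟨m, hm⟩ := Int.eq_ofNat_of_zero_le (show 0 ≤ (n : ℤ) + b by omega)
          rw [hm, bin_natCast, Ring.choose_natCast, Nat.choose_eq_zero_of_lt (by omega)]
          simp
  · rw [if_neg h, if_neg (by omega), if_neg (by omega), sub_zero]

end Delta

/-! ### Scalar Laurent series in a third variable -/

section Lift

variable {M : Type*} [AddCommGroup M] [Module ℂ M]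

/-- The series `f(x_k) A(x_i, x_j)` for a scalar series `f`. -/
abbrev liftVar (i j k : Fin 3) (f : ℤ → ℂ) : FDist 2 M →ₗ[ℂ] FDist 3 M :=
  joinVar i j k fun m => f m • LinearMap.id

theorem liftVar_apply (i j k : Fin 3) (f : ℤ → ℂ) (A : FDist 2 M) (e : Fin 3 → ℤ) :
    liftVar i j k f A e = f (e k) • A ![e i, e j] := rfl

theorem liftVar_single_apply (i j k : Fin 3) (A : FDist 2 M) (e : Fin 3 → ℤ) :
    liftVar i j k (Pi.single 0 1) A e = if e k = 0 then A ![e i, e j] else 0 := by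
  rw [liftVar_apply, Pi.single_apply, ite_smul, one_smul, zero_smul]

/-- The coefficients of `f(-x)`. -/
def negCoeff (f : LaurentSeries ℂ) (m : ℤ) : ℂ := f.coeff m * (-1) ^ m

theorem negCoeff_one : negCoeff 1 = Pi.single 0 1 := by
  funext m
  rw [negCoeff, HahnSeries.coeff_one, Pi.single_apply]
  split_ifs with h
  · simp [h]
  · simp

theorem negCoeff_eq_zero (f : LaurentSeries ℂ) : ∃ N : ℤ, ∀ m < N, negCoeff f m = 0 :=
  ⟨f.order, fun m hm => by rw [negCoeff, HahnSeries.coeff_eq_zero_of_lt_order hm, zero_mul]⟩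

/-- The indeterminate of `ℂ((x))`. -/
abbrev laurentVar : LaurentSeries ℂ := HahnSeries.single 1 1

theorem algebraMap_laurentSeries (z : ℂ) : algebraMap ℂ (LaurentSeries ℂ) z = HahnSeries.C z := by
  rw [HahnSeries.algebraMap_apply', PowerSeries.algebraMap_apply, HahnSeries.ofPowerSeries_C]
  rfl

theorem aeval_laurentVar_coeff (p : Polynomial ℂ) (n : ℕ) :
    (Polynomial.aeval laurentVar p : LaurentSeries ℂ).coeff n = p.coeff n := by
  induction p using Polynomial.induction_on' with
  | add p q hp hq => rw [map_add, HahnSeries.coeff_add, hp, hq, Polynomial.coeff_add]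
  | monomial m z =>
    rw [Polynomial.aeval_monomial, algebraMap_laurentSeries, HahnSeries.single_pow,
      HahnSeries.C_apply, HahnSeries.single_mul_single, HahnSeries.coeff_single,
      Polynomial.coeff_monomial]
    simp
    congr 1
    exact propext eq_comm

theorem aeval_laurentVar_ne_zero {p : Polynomial ℂ} (hp : p ≠ 0) :
    (Polynomial.aeval laurentVar p : LaurentSeries ℂ) ≠ 0 := by
  intro h
  apply hp
  ext n
  rw [← aeval_laurentVar_coeff, h]
  simp

/-- The passage to f(-x_k) turns multiplication by the indeterminate into multiplication by -x_k;
this is how the denominators of the f_i are cleared. -/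
theorem liftVar_negCoeff_aeval_mul (i j k : Fin 3) (hik : i ≠ k) (hjk : j ≠ k) (p : Polynomial ℂ)
    (f : LaurentSeries ℂ) (B : FDist 2 M) :
    liftVar i j k (negCoeff (Polynomial.aeval laurentVar p * f)) B =
      Polynomial.aeval (-X k : MvPolynomial (Fin 3) ℂ) p • liftVar i j k (negCoeff f) B := by
  induction p using Polynomial.induction_on' with
  | add p q hp hq =>
    rw [map_add, map_add, add_mul, add_smul, ← hp, ← hq]
    funext e
    rw [Pi.add_apply, liftVar_apply, liftVar_apply, liftVar_apply, ← add_smul]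
    simp only [negCoeff, HahnSeries.coeff_add, add_mul]
  | monomial n z =>
    rw [Polynomial.aeval_monomial, Polynomial.aeval_monomial, algebraMap_laurentSeries, mul_assoc,
      mul_smul, algebraMap_smul]
    have h1 : ∀ f : LaurentSeries ℂ, liftVar i j k (negCoeff (HahnSeries.C z * f)) B =
        z • liftVar i j k (negCoeff f) B := by
      intro f
      funext e
      rw [Pi.smul_apply, liftVar_apply, liftVar_apply, smul_smul]
      simp only [negCoeff, HahnSeries.C_apply, HahnSeries.coeff_single_zero_mul, mul_assoc]
    have h2 : ∀ f : LaurentSeries ℂ, liftVar i j k (negCoeff (laurentVar * f)) B =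
        (-X k : MvPolynomial (Fin 3) ℂ) • liftVar i j k (negCoeff f) B := by
      intro f
      funext e
      rw [neg_smul, Pi.neg_apply, X_smul_apply, liftVar_apply, liftVar_apply, ← neg_smul]
      simp only [negCoeff, HahnSeries.coeff_single_mul, Pi.sub_apply, Pi.single_eq_same,
        Pi.single_eq_of_ne hik, Pi.single_eq_of_ne hjk, sub_zero]
      congr 1
      rw [zpow_sub_one₀ (by norm_num)]
      ring
    rw [h1]
    congr 1
    induction n with
    | zero => simp
    | succ n ih => rw [pow_succ', mul_assoc, h2, ih, pow_succ', mul_smul]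

end Lift

/-! ### Finiteness of products with delta series and cancellation of polynomials -/

section Summability

variable {M : Type*} [AddCommGroup M] [Module ℂ M]

theorem finite_of_box {r : ℕ} {S : Set (Fin r → ℤ)} (l u : Fin r → ℤ)
    (h : ∀ d ∈ S, ∀ i, l i ≤ d i ∧ d i ≤ u i) : S.Finite :=
  (Set.finite_Icc l u).subset fun d hd => ⟨fun i => (h d hd i).1, fun i => (h d hd i).2⟩

/-- The exponent of x₀ is fixed, that of x₂ lies between zero and a bound from `A`, and homogeneity
of the delta series fixes the last one. -/
theorem summable_delta_vprod {A : FDist 2 M} (hA : A ∈ bddBelowSnd M) (β γ : ℂ) :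
    MulSummable (deltaSeries 0 1 2 1 β γ) (liftVar 1 2 0 (Pi.single 0 1) A) := by
  obtain ⟨N, hN⟩ := hA
  intro e
  refine finite_of_box ![e 0, -1 - e 0 - (e 2 - N), 0] ![e 0, -1 - e 0, e 2 - N] fun d hd => ?_
  have h1 : ¬(d 0 + d 1 + d 2 + 1 ≠ 0 ∨ d 2 < 0) := fun h => hd (by
    dsimp only; rw [deltaSeries_eq_zero h, zero_smul])
  have h2 : (e - d) 0 = 0 := by
    by_contra h
    exact hd (by dsimp only; rw [liftVar_single_apply, if_neg h, smul_zero])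
  have h3 : ¬ (e - d) 2 < N := fun h => hd (by
    dsimp only; rw [liftVar_apply, hN _ (by simpa using h), smul_zero, smul_zero])
  simp only [Pi.sub_apply] at h2 h3
  intro i
  fin_cases i
  · change e 0 ≤ d 0 ∧ d 0 ≤ e 0; omega
  · change -1 - e 0 - (e 2 - N) ≤ d 1 ∧ d 1 ≤ -1 - e 0; omega
  · change 0 ≤ d 2 ∧ d 2 ≤ e 2 - N; omega

theorem summable_delta_viter {A : FDist 2 M} (hA : ∃ N : ℤ, ∀ e : Fin 2 → ℤ, e 0 < N → A e = 0)
    (β γ : ℂ) : MulSummable (deltaSeries 2 1 0 1 β γ) (liftVar 0 2 1 (Pi.single 0 1) A) := by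
  obtain ⟨N, hN⟩ := hA
  intro e
  refine finite_of_box ![0, e 1, -1 - e 1 - (e 0 - N)] ![e 0 - N, e 1, -1 - e 1] fun d hd => ?_
  have h1 : ¬(d 2 + d 1 + d 0 + 1 ≠ 0 ∨ d 0 < 0) := fun h => hd (by
    dsimp only; rw [deltaSeries_eq_zero h, zero_smul])
  have h2 : (e - d) 1 = 0 := by
    by_contra h
    exact hd (by dsimp only; rw [liftVar_single_apply, if_neg h, smul_zero])
  have h3 : ¬ (e - d) 0 < N := fun h => hd (by
    dsimp only; rw [liftVar_apply, hN _ (by simpa using h), smul_zero, smul_zero])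
  simp only [Pi.sub_apply] at h2 h3
  intro i
  fin_cases i
  · change 0 ≤ d 0 ∧ d 0 ≤ e 0 - N; omega
  · change e 1 ≤ d 1 ∧ d 1 ≤ e 1; omega
  · change -1 - e 1 - (e 0 - N) ≤ d 2 ∧ d 2 ≤ -1 - e 1; omega

/-- The exponents of `x₁` are bounded below, and those of `x₂` are for each exponent of `x₁`. -/
def IsLowerBdd (B : FDist 2 M) : Prop :=
  (∃ N : ℤ, ∀ e : Fin 2 → ℤ, e 0 < N → B e = 0) ∧
    ∀ m : ℤ, ∃ N : ℤ, ∀ n < N, B ![m, n] = 0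

theorem IsLowerBdd.delta_bounds {B : FDist 2 M} (hB : IsLowerBdd B) {f : ℤ → ℂ}
    (hf : ∃ N : ℤ, ∀ m < N, f m = 0) (β γ : ℂ) (b c : ℤ) : ∃ N0 N1 N2 : ℤ, ∀ e d : Fin 3 → ℤ,
      e 1 = b → e 2 = c →
      deltaSeries 0 2 1 1 β γ d • liftVar 1 2 0 f B (e - d) ≠ 0 →
        d 0 + d 1 + d 2 + 1 = 0 ∧ 0 ≤ d 1 ∧ N0 ≤ e 0 - d 0 ∧ d 1 ≤ N1 ∧ d 2 ≤ N2 := by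
  obtain ⟨⟨N, hN⟩, hB⟩ := hB
  obtain ⟨N0, hN0⟩ := hf
  choose n hn using hB
  -- The lower bound for x₂ depends on the exponent of x₁, but only the finitely many exponents from
  -- `N` to `b` occur.
  obtain ⟨n0, hn0⟩ := ((Set.finite_Icc N b).image n).bddBelow
  refine ⟨N0, b - N, c - n0, fun e d hb hc hd => ?_⟩
  have h1 : ¬(d 0 + d 2 + d 1 + 1 ≠ 0 ∨ d 1 < 0) := fun h => hd (by
    rw [deltaSeries_eq_zero h, zero_smul])
  have h2 : ¬ (e - d) 0 < N0 := fun h => hd (by rw [liftVar_apply, hN0 _ h, zero_smul, smul_zero])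
  have h3 : ¬ (e - d) 1 < N := fun h => hd (by
    rw [liftVar_apply, hN _ (by simpa using h), smul_zero, smul_zero])
  have h4 : ¬ (e - d) 2 < n ((e - d) 1) := fun h => hd (by
    rw [liftVar_apply, hn _ _ h, smul_zero, smul_zero])
  simp only [Pi.sub_apply] at h2 h3 h4
  have h5 := hn0 (Set.mem_image_of_mem n (Set.mem_Icc.2 ⟨not_lt.1 h3, by omega⟩))
  omega

theorem IsLowerBdd.summable {B : FDist 2 M} (hB : IsLowerBdd B) {f : ℤ → ℂ}
    (hf : ∃ N : ℤ, ∀ m < N, f m = 0) (β γ : ℂ) :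
    MulSummable (deltaSeries 0 2 1 1 β γ) (liftVar 1 2 0 f B) := by
  intro e
  obtain ⟨N0, N1, N2, h⟩ := hB.delta_bounds hf β γ (e 1) (e 2)
  refine finite_of_box ![-1 - N1 - N2, 0, -1 - (e 0 - N0) - N1] ![e 0 - N0, N1, N2] fun d hd => ?_
  have := h e d rfl rfl hd
  intro i
  fin_cases i
  · change -1 - N1 - N2 ≤ d 0 ∧ d 0 ≤ e 0 - N0; omega
  · change 0 ≤ d 1 ∧ d 1 ≤ N1; omega
  · change -1 - (e 0 - N0) - N1 ≤ d 2 ∧ d 2 ≤ N2; omega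

/-- The series in three variables whose exponents of `x₀` are bounded below when those of the other
variables are fixed. -/
def lowerBddZero (M : Type*) [AddCommGroup M] [Module ℂ M] : Submodule ℂ (FDist 3 M) where
  carrier := {F | ∀ b c : ℤ, ∃ N : ℤ, ∀ m < N, F ![m, b, c] = 0}
  zero_mem' _ _ := ⟨0, fun _ _ => rfl⟩
  add_mem' {F G} hF hG b c := by
    obtain ⟨N, hN⟩ := hF b c
    obtain ⟨N', hN'⟩ := hG b c
    exact ⟨min N N', fun m hm => by rw [Pi.add_apply, hN _ (by omega), hN' _ (by omega), add_zero]⟩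
  smul_mem' z F hF b c := by
    obtain ⟨N, hN⟩ := hF b c
    exact ⟨N, fun m hm => by rw [Pi.smul_apply, hN _ hm, smul_zero]⟩

theorem polySMul_mem_lowerBddZero (P : MvPolynomial (Fin 3) ℂ) {F : FDist 3 M}
    (hF : F ∈ lowerBddZero M) : P • F ∈ lowerBddZero M := by
  refine smul_mem_of_X_smul_mem _ (fun i F hF b c => ?_) P hF
  have hi : ∀ m, ∃ m' b' c' : ℤ, m' ≤ m ∧ (b' = b ∨ b' = b - 1) ∧ (c' = c ∨ c' = c - 1) ∧
      (![m, b, c] - Pi.single i 1 : Fin 3 → ℤ) = ![m', b', c'] := by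
    intro m
    fin_cases i
    · refine ⟨m - 1, b, c, by omega, .inl rfl, .inl rfl, ?_⟩
      funext j; fin_cases j <;> simp
    · refine ⟨m, b - 1, c, by omega, .inr rfl, .inl rfl, ?_⟩
      funext j; fin_cases j <;> simp
    · refine ⟨m, b, c - 1, by omega, .inl rfl, .inr rfl, ?_⟩
      funext j; fin_cases j <;> simp
  obtain ⟨N1, h1⟩ := hF b c
  obtain ⟨N2, h2⟩ := hF (b - 1) c
  obtain ⟨N3, h3⟩ := hF b (c - 1)
  obtain ⟨N4, h4⟩ := hF (b - 1) (c - 1)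
  refine ⟨min (min N1 N2) (min N3 N4), fun m hm => ?_⟩
  rw [X_smul_apply]
  obtain ⟨m', b', c', hm', hb, hc, h⟩ := hi m
  rw [h]
  rcases hb with rfl | rfl <;> rcases hc with rfl | rfl
  · exact h1 _ (by omega)
  · exact h3 _ (by omega)
  · exact h2 _ (by omega)
  · exact h4 _ (by omega)

theorem IsLowerBdd.seriesMul_mem {B : FDist 2 M} (hB : IsLowerBdd B) {f : ℤ → ℂ}
    (hf : ∃ N : ℤ, ∀ m < N, f m = 0) (β γ : ℂ) :
    seriesMul (deltaSeries 0 2 1 1 β γ) (liftVar 1 2 0 f B) ∈ lowerBddZero M := by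
  intro b c
  obtain ⟨N0, N1, N2, h⟩ := hB.delta_bounds hf β γ b c
  refine ⟨N0 - 1 - N1 - N2, fun m hm => finsum_eq_zero_of_forall_eq_zero fun d => ?_⟩
  by_contra hd
  have := h ![m, b, c] d rfl rfl hd
  simp at this
  omega

/-- For fixed exponents of the other variables there is a lowest power of x₀, and its product with
the lowest term of p cannot cancel. This fails for series unbounded in both directions, hence the
care taken with lower bounds. -/
theorem eq_zero_of_aeval_smul_eq_zero {p : Polynomial ℂ} (hp : p ≠ 0) {F : FDist 3 M}
    (hF : F ∈ lowerBddZero M) (h : Polynomial.aeval (-X 0 : MvPolynomial (Fin 3) ℂ) p • F = 0) :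
    F = 0 := by
  by_contra hne
  obtain ⟨e, he⟩ := Function.ne_iff.1 hne
  have hvec : ∀ e : Fin 3 → ℤ, e = ![e 0, e 1, e 2] := fun e => by
    funext i; fin_cases i <;> rfl
  obtain ⟨N, hN⟩ := hF (e 1) (e 2)
  have hex : ∃ n : ℕ, F ![N + n, e 1, e 2] ≠ 0 := by
    refine ⟨(e 0 - N).toNat, ?_⟩
    have : N ≤ e 0 := by
      by_contra hlt
      exact he (hvec e ▸ hN _ (not_le.1 hlt))
    rw [show N + ((e 0 - N).toNat : ℤ) = e 0 by omega, ← hvec]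
    exact he
  classical
  set n := Nat.find hex
  have hmin : ∀ m < N + (n : ℤ), F ![m, e 1, e 2] = 0 := by
    intro m hm
    rcases lt_or_ge m N with h' | h'
    · exact hN _ h'
    · have := Nat.find_min hex (m := (m - N).toNat) (by omega)
      rwa [not_not, show N + ((m - N).toNat : ℤ) = m by omega] at this
  have hterm : ∀ (i : ℕ) (z : ℂ) (m : ℤ),
      ((algebraMap ℂ _ z * (-X 0) ^ i : MvPolynomial (Fin 3) ℂ) • F : FDist 3 M) ![m, e 1, e 2] =
        (z * (-1) ^ i) • F ![m - i, e 1, e 2] := by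
    intro i z m
    rw [neg_pow, show ((-1) ^ i : MvPolynomial (Fin 3) ℂ) = C ((-1) ^ i) by simp,
      MvPolynomial.algebraMap_eq, mul_smul, mul_smul, C_smul, C_smul, Pi.smul_apply, Pi.smul_apply,
      X_pow_smul_apply, smul_smul]
    congr 2
    funext j; fin_cases j <;> simp
  -- At this exponent only the trailing term of `p` contributes: lower coefficients of `p` vanish,
  -- and higher ones meet coefficients of `F` below its lowest power.
  have hcoef := congrFun h ![N + n + p.natTrailingDegree, e 1, e 2]
  rw [Polynomial.aeval_eq_sum_range, Finset.sum_smul, Finset.sum_apply,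
    Finset.sum_eq_single p.natTrailingDegree] at hcoef
  · rw [Algebra.smul_def, hterm, add_sub_cancel_right] at hcoef
    refine (smul_ne_zero (mul_ne_zero ?_ (pow_ne_zero _ (by norm_num))) (Nat.find_spec hex)) hcoef
    exact mt Polynomial.trailingCoeff_eq_zero.1 hp
  · intro i _ hi
    rw [Algebra.smul_def, hterm]
    rcases lt_or_gt_of_ne hi with hi | hi
    · rw [Polynomial.coeff_eq_zero_of_lt_natTrailingDegree hi, zero_mul, zero_smul]
    · rw [hmin _ (by omega), smul_zero]
  · intro hi
    exact absurd (Finset.mem_range_succ_iff.2 (Polynomial.natTrailingDegree_le_natDegree p)) hi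

end Summability

end VAInf
end

noncomputable section
namespace VAInf

open MvPolynomial (X C)

/-! ### The `S`-Jacobi identity -/

section Jacobi

variable {M : Type*} [AddCommGroup M] [Module ℂ M]

/-- Commuting polynomials that act equally on `J` may be exchanged inside any polynomial; it is
applied to the replacement rules of the delta series. -/
theorem aeval_smul_eq_of_smul_eq {r : ℕ} {P Q : MvPolynomial (Fin r) ℂ} {J : FDist r M}
    (h : P • J = Q • J) (p : Polynomial ℂ) : Polynomial.aeval P p • J = Polynomial.aeval Q p •
        J := by
  have hpow : ∀ n : ℕ, P ^ n • J = Q ^ n • J := by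
    intro n
    induction n with
    | zero => simp
    | succ n ih => rw [pow_succ', mul_smul, ih, smul_comm, h, ← mul_smul, ← pow_succ]
  induction p using Polynomial.induction_on' with
  | add p q hp hq => rw [map_add, map_add, add_smul, add_smul, hp, hq]
  | monomial n z =>
    rw [Polynomial.aeval_monomial, Polynomial.aeval_monomial, mul_smul, mul_smul, hpow]

theorem mul_pow_smul_eq_of_smul_eq {r : ℕ} {P Q : MvPolynomial (Fin r) ℂ} {J : FDist r M}
    (h : P • J = Q • J) (R : MvPolynomial (Fin r) ℂ) (k : ℕ) : (P * R) ^ k • J = (Q * R) ^ k •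
        J := by
  have := aeval_smul_eq_of_smul_eq h (Polynomial.X ^ k)
  rw [map_pow, map_pow, Polynomial.aeval_X, Polynomial.aeval_X] at this
  rw [mul_pow, mul_pow, mul_comm, mul_comm (Q ^ k), mul_smul, mul_smul, this]

theorem seriesMul_relation {r : ℕ} {P Q : MvPolynomial (Fin r) ℂ} {c : FDist r ℂ} {F : FDist r M}
    (hF : MulSummable c F) (h : P • c = Q • c) : P • seriesMul c F = Q • seriesMul c F := by
  rw [← seriesMul_polySMul_left hF, h, seriesMul_polySMul_left hF]

theorem MulSummable.sum {r : ℕ} {ι : Type*} (I : Finset ι) {c : FDist r ℂ} {F : ι → FDist r M}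
    (hF : ∀ i, MulSummable c (F i)) : MulSummable c (∑ i ∈ I, F i) := by
  classical
  induction I using Finset.induction_on with
  | empty => exact summable_zero_right c
  | insert i I hi ih => rw [Finset.sum_insert hi]; exact (hF i).add_right ih

theorem seriesMul_sum {r : ℕ} {ι : Type*} (I : Finset ι) {c : FDist r ℂ} {F : ι → FDist r M}
    (hF : ∀ i, MulSummable c (F i)) : seriesMul c (∑ i ∈ I, F i) = ∑ i ∈ I, seriesMul c (F i) := by
  classical
  induction I using Finset.induction_on with
  | empty => funext e; simp [seriesMul]
  | insert i I hi ih =>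
    rw [Finset.sum_insert hi, Finset.sum_insert hi, seriesMul_add_right (hF i)
        (MulSummable.sum I hF),
      ih]

theorem deltaOne_relation : (X 0 : MvPolynomial (Fin 3) ℂ) • deltaSeries 0 1 2 1 (-1) 1 =
    (X 1 - X 2 : MvPolynomial (Fin 3) ℂ) • deltaSeries 0 1 2 1 (-1) 1 := by
  have := deltaSeries_relation (z := 0) (x := 1) (y := 2) (by decide) (by decide) (by decide)
    (one_ne_zero : (1 : ℂ) ≠ 0) (neg_ne_zero.2 one_ne_zero : (-1 : ℂ) ≠ 0)
    (one_ne_zero : (1 : ℂ) ≠ 0)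
  simpa [sub_eq_add_neg] using this

theorem deltaTwo_relation : (-X 0 : MvPolynomial (Fin 3) ℂ) • deltaSeries 0 2 1 1 (-1) (-1) =
    (X 2 - X 1 : MvPolynomial (Fin 3) ℂ) • deltaSeries 0 2 1 1 (-1) (-1) := by
  have := deltaSeries_relation (z := 0) (x := 2) (y := 1) (by decide) (by decide) (by decide)
    (one_ne_zero : (1 : ℂ) ≠ 0) (neg_ne_zero.2 one_ne_zero : (-1 : ℂ) ≠ 0)
    (neg_ne_zero.2 one_ne_zero : (-1 : ℂ) ≠ 0)
  simpa [sub_eq_add_neg] using this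

theorem deltaThree_relation : (X 1 : MvPolynomial (Fin 3) ℂ) • deltaSeries 2 1 0 1 (-1) 1 =
    (X 0 + X 2 : MvPolynomial (Fin 3) ℂ) • deltaSeries 2 1 0 1 (-1) 1 := by
  have := deltaSeries_relation (z := 2) (x := 1) (y := 0) (by decide) (by decide) (by decide)
    (one_ne_zero : (1 : ℂ) ≠ 0) (neg_ne_zero.2 one_ne_zero : (-1 : ℂ) ≠ 0)
    (one_ne_zero : (1 : ℂ) ≠ 0)
  rw [add_smul, add_comm]
  simp only [MvPolynomial.C_1, one_mul, map_neg, neg_mul, add_smul, neg_smul] at this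
  rw [this]
  abel

theorem seriesMul_single_right {r : ℕ} (c : FDist r ℂ) (v : M) :
    MulSummable c (Pi.single 0 v : FDist r M) ∧
      ∀ e, seriesMul c (Pi.single 0 v : FDist r M) e = c e • v := by
  have h : ∀ e d : Fin r → ℤ, d ≠ e → c d • (Pi.single 0 v : FDist r M) (e - d) = 0 := by
    intro e d hd
    rw [Pi.single_eq_of_ne (sub_ne_zero.2 hd.symm), smul_zero]
  refine ⟨fun e => (Set.finite_singleton e).subset fun d hd => ?_, fun e => ?_⟩
  · by_contra hne
    exact hd (h e d hne)
  · rw [seriesMul, finsum_eq_single _ e (h e), sub_self, Pi.single_eq_same]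

theorem substAssoc_single_zero (v : M) :
    substAssoc (Pi.single 0 v : FDist 2 M) = Pi.single 0 v := by
  funext e
  rw [substAssoc, finsum_eq_single _ 0]
  · have : ![e 0 + ((0 : ℕ) : ℤ), e 1 - ((0 : ℕ) : ℤ)] = e := by
      funext i; fin_cases i <;> simp
    rw [this, Ring.choose_zero_right, one_smul]
  · intro i hi
    by_cases h : ![e 0 + (i : ℤ), e 1 - i] = 0
    · have h0 : e 0 + (i : ℤ) = 0 := congrFun h 0
      rw [h0, Ring.choose_zero_ite, if_neg hi, zero_smul]
    · rw [Pi.single_eq_of_ne h, smul_zero]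

theorem liftVar_single_single (i j k : Fin 3) (h : ∀ u, u = i ∨ u = j ∨ u = k) (v : M) :
    liftVar i j k (Pi.single 0 1) (Pi.single 0 v : FDist 2 M) = Pi.single 0 v := by
  funext e
  rw [liftVar_single_apply]
  by_cases he : e = 0
  · subst he
    have : ![(0 : Fin 3 → ℤ) i, (0 : Fin 3 → ℤ) j] = 0 := by
      funext u; fin_cases u <;> rfl
    rw [if_pos (show (0 : Fin 3 → ℤ) k = 0 from rfl), this, Pi.single_eq_same, Pi.single_eq_same]
  · rw [Pi.single_eq_of_ne he]
    split_ifs with hk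
    · refine Pi.single_eq_of_ne (fun h0 => he (funext fun u => ?_)) _
      rcases h u with rfl | rfl | rfl
      · exact congrFun h0 0
      · exact congrFun h0 1
      · exact hk
    · rfl

/-- The series in two variables that satisfy the Jacobi identity for `x₁ = x₀ + x₂`. -/
structure SatisfiesDelta (G : FDist 2 M) : Prop where
  bdd : G ∈ bddBelowSnd M
  left : MulSummable (deltaSeries 0 1 2 1 (-1) 1) (liftVar 1 2 0 (Pi.single 0 1) G)
  right : MulSummable (deltaSeries 0 2 1 1 (-1) (-1)) (liftVar 1 2 0 (Pi.single 0 1) G)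
  iter : MulSummable (deltaSeries 2 1 0 1 (-1) 1) (liftVar 0 2 1 (Pi.single 0 1) (substAssoc G))
  identity : seriesMul (deltaSeries 0 1 2 1 (-1) 1) (liftVar 1 2 0 (Pi.single 0 1) G) -
      seriesMul (deltaSeries 0 2 1 1 (-1) (-1)) (liftVar 1 2 0 (Pi.single 0 1) G) =
        seriesMul (deltaSeries 2 1 0 1 (-1) 1) (liftVar 0 2 1 (Pi.single 0 1) (substAssoc G))

theorem SatisfiesDelta.zero : SatisfiesDelta (0 : FDist 2 M) := by
  have h0 : substAssoc (0 : FDist 2 M) = 0 := by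
    funext e; simp [substAssoc]
  have h1 : ∀ c : FDist 3 ℂ, seriesMul c (0 : FDist 3 M) = 0 := fun c => by
    funext e; simp [seriesMul]
  refine ⟨zero_mem _, ?_, ?_, ?_, ?_⟩
  · rw [map_zero]; exact summable_zero_right _
  · rw [map_zero]; exact summable_zero_right _
  · rw [h0, map_zero]; exact summable_zero_right _
  · rw [h0, map_zero, map_zero, h1, h1, h1, sub_zero]

theorem SatisfiesDelta.add {F G : FDist 2 M} (hF : SatisfiesDelta F) (hG : SatisfiesDelta G) :
    SatisfiesDelta (F + G) := by
  obtain ⟨a1, a2, a3, a4, a5⟩ := hF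
  obtain ⟨b1, b2, b3, b4, b5⟩ := hG
  refine ⟨add_mem a1 b1, ?_, ?_, ?_, ?_⟩
  · rw [map_add]; exact a2.add_right b2
  · rw [map_add]; exact a3.add_right b3
  · rw [substAssoc_add a1 b1, map_add]; exact a4.add_right b4
  · rw [substAssoc_add a1 b1, map_add, map_add, seriesMul_add_right a2 b2,
      seriesMul_add_right a3 b3, seriesMul_add_right a4 b4, ← a5, ← b5]
    abel

theorem SatisfiesDelta.smul {G : FDist 2 M} (hG : SatisfiesDelta G) (z : ℂ) :
    SatisfiesDelta (z • G) := by
  obtain ⟨a1, a2, a3, a4, a5⟩ := hG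
  refine ⟨Submodule.smul_mem _ z a1, ?_, ?_, ?_, ?_⟩
  · rw [map_smul]; exact a2.smul_right z
  · rw [map_smul]; exact a3.smul_right z
  · rw [substAssoc_const_smul z a1, map_smul]; exact a4.smul_right z
  · rw [substAssoc_const_smul z a1, map_smul, map_smul, seriesMul_smul_right a2,
      seriesMul_smul_right a3, seriesMul_smul_right a4, ← a5, smul_sub]

/-- The submodule of the series that satisfy the Jacobi identity for `x₁ = x₀ + x₂`. -/
def deltaSpace (M : Type*) [AddCommGroup M] [Module ℂ M] : Submodule ℂ (FDist 2 M) where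
  carrier := {G | SatisfiesDelta G}
  zero_mem' := SatisfiesDelta.zero
  add_mem' := SatisfiesDelta.add
  smul_mem' z _ hG := SatisfiesDelta.smul hG z

theorem mem_deltaSpace {G : FDist 2 M} : G ∈ deltaSpace M ↔ SatisfiesDelta G := Iff.rfl

/-- Multiplication of G by x₁ multiplies the left side by x₁ and the right side by x₀+x₂, and these
agree under the third delta series. -/
theorem X_smul_mem_deltaSpace (i : Fin 2) {G : FDist 2 M} (hG : G ∈ deltaSpace M) :
    (X i : MvPolynomial (Fin 2) ℂ) • G ∈ deltaSpace M := by
  obtain ⟨a1, a2, a3, a4, a5⟩ := mem_deltaSpace.1 hG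
  have h12 : liftVar 1 2 0 (Pi.single 0 1) ((X i : MvPolynomial (Fin 2) ℂ) • G) =
      MvPolynomial.rename ![(1 : Fin 3), 2] (X i) • liftVar 1 2 0 (Pi.single 0 1) G :=
    joinVar_smul (by decide) (by decide) (by decide) _ _ _
  have h02 : liftVar 0 2 1 (Pi.single 0 1) (substAssoc ((X i : MvPolynomial (Fin 2) ℂ) • G)) =
      MvPolynomial.rename ![(0 : Fin 3), 2] (shiftAlg 0 1 (X i)) •
        liftVar 0 2 1 (Pi.single 0 1) (substAssoc G) := by
    rw [substAssoc_smul _ a1]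
    exact joinVar_smul (by decide) (by decide) (by decide) _ _ _
  refine ⟨X_smul_mem_bddBelowSnd i a1, h12 ▸ a2.polySMul_right _, h12 ▸ a3.polySMul_right _,
    h02 ▸ a4.polySMul_right _, ?_⟩
  rw [h12, h02, seriesMul_polySMul_right a2, seriesMul_polySMul_right a3,
      seriesMul_polySMul_right a4,
    ← smul_sub, a5]
  fin_cases i
  · change MvPolynomial.rename ![(1 : Fin 3), 2] (X 0) • _ =
      MvPolynomial.rename ![(0 : Fin 3), 2] (shiftAlg 0 1 (X 0)) • _
    rw [shiftAlg_X_self, map_add, MvPolynomial.rename_X, MvPolynomial.rename_X,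
        MvPolynomial.rename_X]
    exact seriesMul_relation a4 deltaThree_relation
  · change MvPolynomial.rename ![(1 : Fin 3), 2] (X 1) • _ =
      MvPolynomial.rename ![(0 : Fin 3), 2] (shiftAlg 0 1 (X 1)) • _
    rw [shiftAlg_X_of_ne 1 (by decide), MvPolynomial.rename_X, MvPolynomial.rename_X]
    rfl

/-- For a constant series the identity is `deltaSeries_sub`; a monomial is reached by multiplying
with the variables. -/
theorem single_mem_deltaSpace (i j : ℕ) (v : M) :
    (Pi.single ![(i : ℤ), j] v : FDist 2 M) ∈ deltaSpace M := by
  have h0 : (Pi.single 0 v : FDist 2 M) ∈ deltaSpace M := by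
    have h12 := liftVar_single_single 1 2 0 (by decide) v
    have h02 := liftVar_single_single 0 2 1 (by decide) v
    rw [← substAssoc_single_zero] at h02
    refine ⟨⟨0, fun e he => Pi.single_eq_of_ne (fun h => ?_) _⟩,
      h12 ▸ (seriesMul_single_right _ v).1, h12 ▸ (seriesMul_single_right _ v).1, ?_, ?_⟩
    · rw [h] at he; exact lt_irrefl _ he
    · rw [h02]; exact (seriesMul_single_right _ v).1
    rw [h12, h02]
    funext e
    rw [Pi.sub_apply, (seriesMul_single_right _ v).2, (seriesMul_single_right _ v).2,
      (seriesMul_single_right _ v).2, ← deltaSeries_sub, Pi.sub_apply, sub_smul]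
  have := smul_mem_of_X_smul_mem _ (fun u _ h => X_smul_mem_deltaSpace u h)
    (X 0 ^ i * X 1 ^ j : MvPolynomial (Fin 2) ℂ) h0
  convert this using 1
  funext e
  rw [mul_smul, X_pow_smul_apply, X_pow_smul_apply]
  simp only [Pi.single_apply]
  congr 1
  refine propext ⟨fun h => ?_, fun h => ?_⟩
  · rw [h]; funext u; fin_cases u <;> simp [Matrix.vecHead, Matrix.vecTail]
  · funext u
    have := congrFun h u
    fin_cases u
    · simp at this; simp; omega
    · simp at this; simp; omega

/-- A delta series is homogeneous of degree -1, so one coefficient of the product sees only one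
total degree of the other factor. -/
theorem seriesMul_delta_congr {z x y : Fin 3} {α β γ : ℂ} {F F' : FDist 3 M} {e : Fin 3 → ℤ}
    (h : ∀ e' : Fin 3 → ℤ, e' z + e' x + e' y = e z + e x + e y + 1 → F e' = F' e') :
    seriesMul (deltaSeries z x y α β γ) F e = seriesMul (deltaSeries z x y α β γ) F' e := by
  refine finsum_congr fun d => ?_
  by_cases hd : d z + d x + d y + 1 = 0
  · rw [h]
    simp only [Pi.sub_apply]
    omega
  · rw [deltaSeries_eq_zero (.inl hd), zero_smul, zero_smul]

/-- The Jacobi identity for series with nonnegative exponents. -/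
theorem delta_identity_of_nonneg {G : FDist 2 M}
    (hG : ∀ e : Fin 2 → ℤ, e 0 < 0 ∨ e 1 < 0 → G e = 0) :
    seriesMul (deltaSeries 0 1 2 1 (-1) 1) (liftVar 1 2 0 (Pi.single 0 1) G) -
      seriesMul (deltaSeries 0 2 1 1 (-1) (-1)) (liftVar 1 2 0 (Pi.single 0 1) G) =
        seriesMul (deltaSeries 2 1 0 1 (-1) 1) (liftVar 0 2 1 (Pi.single 0 1) (substAssoc G)) := by
  funext e
  set D := e 0 + e 1 + e 2 + 1 with hD
  -- The part of `G` of degree `D`, a finite sum of monomials because exponents are nonnegative. For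
  -- D < 0 the only summand sits in degree zero and does not interfere.
  set G' : FDist 2 M := ∑ i ∈ Finset.range (D.toNat + 1),
    Pi.single ![(i : ℤ), ((D.toNat - i : ℕ) : ℤ)] (G ![(i : ℤ), D - i]) with hG'
  have hmem : G' ∈ deltaSpace M := sum_mem fun i _ => single_mem_deltaSpace _ _ _
  have hvec : ∀ e : Fin 2 → ℤ, e = ![e 0, e 1] := fun e => by
    funext i; fin_cases i <;> rfl
  have heq : ∀ e' : Fin 2 → ℤ, e' 0 + e' 1 = D → G e' = G' e' := by
    intro e' he'
    rw [hG', Finset.sum_apply]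
    by_cases hneg : e' 0 < 0 ∨ e' 1 < 0
    · rw [hG _ hneg]
      refine (Finset.sum_eq_zero fun i _ => Pi.single_eq_of_ne (fun h => ?_) _).symm
      have h0 : e' 0 = i := congrFun h 0
      have h1 : e' 1 = ((D.toNat - i : ℕ) : ℤ) := congrFun h 1
      omega
    · push Not at hneg
      rw [Finset.sum_eq_single (e' 0).toNat]
      · have h0 : (((e' 0).toNat : ℕ) : ℤ) = e' 0 := by omega
        have h1 : ((D.toNat - (e' 0).toNat : ℕ) : ℤ) = e' 1 := by omega
        rw [h1, h0, ← hvec, Pi.single_eq_same, show D - e' 0 = e' 1 by omega, ← hvec]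
      · intro i _ hi
        refine Pi.single_eq_of_ne (fun h => hi ?_) _
        have h0 : e' 0 = i := congrFun h 0
        omega
      · intro h
        exact absurd (Finset.mem_range.2 (by omega)) h
  have hlift : ∀ e' : Fin 3 → ℤ, e' 0 + e' 1 + e' 2 = D →
      liftVar 1 2 0 (Pi.single 0 1) G e' = liftVar 1 2 0 (Pi.single 0 1) G' e' := by
    intro e' he'
    rw [liftVar_single_apply, liftVar_single_apply]
    split_ifs with h
    · exact heq _ (by simp; omega)
    · rfl
  have hlift' : ∀ e' : Fin 3 → ℤ, e' 0 + e' 1 + e' 2 = D →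
      liftVar 0 2 1 (Pi.single 0 1) (substAssoc G) e' =
        liftVar 0 2 1 (Pi.single 0 1) (substAssoc G') e' := by
    intro e' he'
    rw [liftVar_single_apply, liftVar_single_apply]
    split_ifs with h
    · exact finsum_congr fun i => by rw [heq]; simp; omega
    · rfl
  have := congrFun (mem_deltaSpace.1 hmem).identity e
  rw [Pi.sub_apply] at this ⊢
  rw [seriesMul_delta_congr (F' := liftVar 1 2 0 (Pi.single 0 1) G') (fun e' h =>
      hlift e' (by omega)),
    seriesMul_delta_congr (z := 0) (x := 2) (y := 1) (F' := liftVar 1 2 0 (Pi.single 0 1) G')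
      (fun e' h => hlift e' (by omega)),
    seriesMul_delta_congr (F' := liftVar 0 2 1 (Pi.single 0 1) (substAssoc G'))
      (fun e' h => hlift' e' (by omega)), this]

/-- The `S`-Jacobi identity from weak associativity and polynomial locality. -/
theorem jacobi_of_assoc_of_local {A D G : FDist 2 M} {r k : ℕ} {B : Fin r → FDist 2 M}
    {p : Polynomial ℂ} {g : Fin r → Polynomial ℂ} {f : Fin r → LaurentSeries ℂ}
    (hA : A ∈ bddBelowSnd M) (hD : ∃ N : ℤ, ∀ e : Fin 2 → ℤ, e 0 < N → D e = 0)
    (hB : ∀ i, IsLowerBdd (B i))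
    (hAG : ((X 0 - X 1) * X 0 * X 1 : MvPolynomial (Fin 2) ℂ) ^ k • A = G)
    (hG : ∀ e : Fin 2 → ℤ, e 0 < 0 ∨ e 1 < 0 → G e = 0)
    (hDG : (X 0 * (X 0 + X 1) * X 1 : MvPolynomial (Fin 2) ℂ) ^ k • D = substAssoc G)
    (hp : p ≠ 0)
    (hAB : Polynomial.aeval (X 1 - X 0 : MvPolynomial (Fin 2) ℂ) p • A =
      ∑ i, Polynomial.aeval (X 1 - X 0 : MvPolynomial (Fin 2) ℂ) (g i) • B i)
    (hf : ∀ i, Polynomial.aeval laurentVar p * f i = Polynomial.aeval laurentVar (g i)) :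
    seriesMul (deltaSeries 0 1 2 1 (-1) 1) (liftVar 1 2 0 (Pi.single 0 1) A) -
      seriesMul (deltaSeries 0 2 1 1 (-1) (-1)) (∑ i, liftVar 1 2 0 (negCoeff (f i)) (B i)) =
        seriesMul (deltaSeries 2 1 0 1 (-1) 1) (liftVar 0 2 1 (Pi.single 0 1) D) := by
  have h0 : ∃ N : ℤ, ∀ m < N, (Pi.single 0 1 : ℤ → ℂ) m = 0 :=
    ⟨0, fun m hm => Pi.single_eq_of_ne hm.ne _⟩
  -- A single cancellable monomial: under the first two delta series x₀ acts as x₁-x₂, under the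
  -- third x₁ acts as x₀+x₂, which gives exactly the clearing factors of `A` and `D`.
  set P : MvPolynomial (Fin 3) ℂ := (X 0 * (X 1 * X 2)) ^ k with hP
  have s1 := summable_delta_vprod hA (-1) 1
  have s3 := summable_delta_viter hD (-1) 1
  have sB := fun i => (hB i).summable h0 (-1) (-1)
  have sf := fun i => (hB i).summable (negCoeff_eq_zero (f i)) (-1) (-1)
  have j1 : P • seriesMul (deltaSeries 0 1 2 1 (-1) 1) (liftVar 1 2 0 (Pi.single 0 1) A) =
      seriesMul (deltaSeries 0 1 2 1 (-1) 1) (liftVar 1 2 0 (Pi.single 0 1) G) := by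
    rw [hP, mul_pow_smul_eq_of_smul_eq (seriesMul_relation s1 deltaOne_relation),
      ← seriesMul_polySMul_right s1, ← hAG, joinVar_smul (by decide) (by decide) (by decide)]
    congr 2
    simp [mul_assoc]
  have j3 : P • seriesMul (deltaSeries 2 1 0 1 (-1) 1) (liftVar 0 2 1 (Pi.single 0 1) D) =
      seriesMul (deltaSeries 2 1 0 1 (-1) 1) (liftVar 0 2 1 (Pi.single 0 1) (substAssoc G)) := by
    rw [hP, mul_left_comm, mul_pow_smul_eq_of_smul_eq (seriesMul_relation s3 deltaThree_relation),
      ← seriesMul_polySMul_right s3, ← hDG, joinVar_smul (by decide) (by decide) (by decide)]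
    congr 2
    simp
    ring
  have hGb : IsLowerBdd G := ⟨⟨0, fun e he => hG e (.inl he)⟩, fun m => ⟨0, fun n hn =>
    hG _ (.inr hn)⟩⟩
  have sG := hGb.summable h0 (-1) (-1)
  set J2 := seriesMul (deltaSeries 0 2 1 1 (-1) (-1)) (∑ i, liftVar 1 2 0 (negCoeff (f i)) (B i))
    with hJ2
  -- The product of the second delta series with `A` itself need not be defined, as x₁ is not
  -- bounded below in `A`. After multiplication by p(x₂-x₁) it is, thanks to the expression in terms
  -- of the `B i`.
  set R : FDist 3 M := Polynomial.aeval (X 2 - X 1 : MvPolynomial (Fin 3) ℂ) p •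
    liftVar 1 2 0 (Pi.single 0 1) A with hR
  have hR' : R = ∑ i, Polynomial.aeval (X 2 - X 1 : MvPolynomial (Fin 3) ℂ) (g i) •
      liftVar 1 2 0 (Pi.single 0 1) (B i) := by
    have := congrArg (liftVar 1 2 0 (Pi.single 0 1)) hAB
    rw [map_sum, joinVar_smul (by decide) (by decide) (by decide), rename_aeval,
        rename_X_sub_X] at this
    rw [hR, this]
    refine Finset.sum_congr rfl fun i _ => ?_
    rw [joinVar_smul (by decide) (by decide) (by decide), rename_aeval, rename_X_sub_X]
  have sR : MulSummable (deltaSeries 0 2 1 1 (-1) (-1)) R := by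
    rw [hR']
    exact MulSummable.sum _ fun i => (sB i).polySMul_right _
  have hlift : ∀ i, Polynomial.aeval (-X 0 : MvPolynomial (Fin 3) ℂ) p •
      liftVar 1 2 0 (negCoeff (f i)) (B i) =
      Polynomial.aeval (-X 0 : MvPolynomial (Fin 3) ℂ) (g i) •
        liftVar 1 2 0 (Pi.single 0 1) (B i) := by
    intro i
    rw [← liftVar_negCoeff_aeval_mul 1 2 0 (by decide) (by decide), hf i, ← mul_one
      (Polynomial.aeval laurentVar (g i)), liftVar_negCoeff_aeval_mul 1 2 0 (by decide) (by decide),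
      negCoeff_one]
  have hJR : Polynomial.aeval (-X 0 : MvPolynomial (Fin 3) ℂ) p • J2 =
      seriesMul (deltaSeries 0 2 1 1 (-1) (-1)) R := by
    rw [hJ2, ← seriesMul_polySMul_right (MulSummable.sum _ sf), Finset.smul_sum,
      seriesMul_sum _ fun i => (sf i).polySMul_right _, hR',
      seriesMul_sum _ fun i => (sB i).polySMul_right _]
    refine Finset.sum_congr rfl fun i _ => ?_
    rw [hlift, seriesMul_polySMul_right (sB i), seriesMul_polySMul_right (sB i)]
    exact aeval_smul_eq_of_smul_eq (seriesMul_relation (sB i) deltaTwo_relation) _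
  have hrel : (X 0 : MvPolynomial (Fin 3) ℂ) • deltaSeries 0 2 1 1 (-1) (-1) =
      (X 1 - X 2 : MvPolynomial (Fin 3) ℂ) • deltaSeries 0 2 1 1 (-1) (-1) := by
    have := congrArg (fun F => -F) deltaTwo_relation
    simpa only [← neg_smul, neg_neg, neg_sub] using this
  have j2 : P • J2 =
      seriesMul (deltaSeries 0 2 1 1 (-1) (-1)) (liftVar 1 2 0 (Pi.single 0 1) G) := by
    have hlow : P • J2 - seriesMul (deltaSeries 0 2 1 1 (-1) (-1))
        (liftVar 1 2 0 (Pi.single 0 1) G) ∈ lowerBddZero M := by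
      refine sub_mem (polySMul_mem_lowerBddZero _ ?_) (hGb.seriesMul_mem h0 _ _)
      rw [hJ2, seriesMul_sum _ sf]
      exact sum_mem fun i _ => (hB i).seriesMul_mem (negCoeff_eq_zero (f i)) _ _
    -- The claim is checked after multiplication by p(-x₀), which turns the f_i into polynomials and
    -- acts as p(x₂-x₁) under the second delta series.
    refine sub_eq_zero.1 (eq_zero_of_aeval_smul_eq_zero hp hlow ?_)
    rw [smul_sub, smul_comm, hJR, hP,
      mul_pow_smul_eq_of_smul_eq (seriesMul_relation sR hrel), ← seriesMul_polySMul_right sR, hR,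
      smul_comm, aeval_smul_eq_of_smul_eq (seriesMul_relation sG deltaTwo_relation),
      ← seriesMul_polySMul_right sG, sub_eq_zero]
    congr 2
    rw [← hAG, joinVar_smul (by decide) (by decide) (by decide)]
    congr 1
    simp [mul_assoc]
  have hfin := delta_identity_of_nonneg hG
  rw [← j1, ← j2, ← j3, ← smul_sub, hP, mul_pow, mul_pow] at hfin
  simp only [mul_smul] at hfin
  exact X_pow_smul_injective 2 k (X_pow_smul_injective 1 k (X_pow_smul_injective 0 k hfin))

theorem jacobi_of_liftVar {A D : FDist 2 M} {r : ℕ} {B : Fin r → FDist 2 M}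
    {f : Fin r → LaurentSeries ℂ}
    (h : seriesMul (deltaSeries 0 1 2 1 (-1) 1) (liftVar 1 2 0 (Pi.single 0 1) A) -
      seriesMul (deltaSeries 0 2 1 1 (-1) (-1)) (∑ i, liftVar 1 2 0 (negCoeff (f i)) (B i)) =
        seriesMul (deltaSeries 2 1 0 1 (-1) 1) (liftVar 0 2 1 (Pi.single 0 1) D)) :
    seriesMul (deltaSeries 0 1 2 1 (-1) 1) (fun e => if e 0 = 0 then A ![e 1, e 2] else 0) -
      seriesMul (deltaSeries 0 2 1 1 (-1) (-1))
        (fun e => ∑ i, ((f i).coeff (e 0) * (-1 : ℂ) ^ (e 0)) • B i ![e 1, e 2]) =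
      seriesMul (deltaSeries 2 1 0 1 (-1) 1)
        (fun e => if e 1 = 0 then D ![e 0, e 2] else 0) := by
  have h1 : (fun e => if e 0 = 0 then A ![e 1, e 2] else 0) =
      liftVar 1 2 0 (Pi.single 0 1) A := funext fun e => (liftVar_single_apply ..).symm
  have h2 : (fun e => ∑ i, ((f i).coeff (e 0) * (-1 : ℂ) ^ (e 0)) • B i ![e 1, e 2]) =
      ∑ i, liftVar 1 2 0 (negCoeff (f i)) (B i) := by
    funext e
    rw [Finset.sum_apply]
    rfl
  have h3 : (fun e => if e 1 = 0 then D ![e 0, e 2] else 0) =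
      liftVar 0 2 1 (Pi.single 0 1) D := funext fun e => (liftVar_single_apply ..).symm
  rw [h1, h2, h3, h]

end Jacobi

/-! ### The weak quantum vertex algebra structure -/

section WeakQuantum

variable {W : Type*} [AddCommGroup W] [Module ℂ W] {V : Submodule ℂ (EInf W)}
  (hV : IsClosedCompatible V)

/-- The operator in x₁ acts first, so its truncation is uniform; that of the second depends on the
vector already produced. -/
theorem isLowerBdd_vprodRev (a b c : V) : IsLowerBdd (vprodRev hV a b c) := by
  refine ⟨?_, fun m => ?_⟩
  · obtain ⟨N, hN⟩ := (hV.pair b c).nthProd_eq_zero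
    refine ⟨-N, fun e he => ?_⟩
    have : HVertexOperator.coeff (vertexMap hV b) (e 0) c = 0 := Subtype.ext (hN _ (by omega))
    rw [vprodRev, this, map_zero]
  · obtain ⟨N, hN⟩ := (hV.pair a (HVertexOperator.coeff (vertexMap hV b) m c)).nthProd_eq_zero
    exact ⟨-N, fun n hn => Subtype.ext (hN _ (by change _ ≤ -n - 1; omega))⟩

theorem viter_lowerBdd (a b c : V) : ∃ N : ℤ, ∀ e : Fin 2 → ℤ, e 0 < N → viter hV a b c e = 0 := by
  obtain ⟨N, hN⟩ := (hV.pair a b).nthProd_eq_zero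
  refine ⟨-N, fun e he => ?_⟩
  have : HVertexOperator.coeff (vertexMap hV a) (e 0) b = 0 := Subtype.ext (hN _ (by omega))
  rw [viter, this, map_zero, map_zero]
  rfl

/-- The f_i are the rational functions g_i/p expanded at zero, as opposed to the expansions at
infinity in `S`-locality. -/
theorem exists_aeval_laurentVar_mul_eq {p : Polynomial ℂ} (hp : p ≠ 0) {r : ℕ}
    (g : Fin r → Polynomial ℂ) : ∃ f : Fin r → LaurentSeries ℂ,
      ∀ i, Polynomial.aeval laurentVar p * f i = Polynomial.aeval laurentVar (g i) :=
  ⟨fun i => Polynomial.aeval laurentVar (g i) / Polynomial.aeval laurentVar p,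
    fun _ => mul_div_cancel₀ _ (aeval_laurentVar_ne_zero hp)⟩

theorem exists_jacobi_vertexMap (a b : V)
    (h : PolyLocal (V : Set (EInf W)) V (a : EInf W) b) :
    ∃ (r : ℕ) (u v : Fin r → V) (f : Fin r → LaurentSeries ℂ), ∀ c : V,
      seriesMul (deltaSeries 0 1 2 1 (-1) 1)
          (liftVar 1 2 0 (Pi.single 0 1) (vprod hV a b c)) -
        seriesMul (deltaSeries 0 2 1 1 (-1) (-1))
          (∑ i, liftVar 1 2 0 (negCoeff (f i)) (vprodRev hV (v i) (u i) c)) =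
      seriesMul (deltaSeries 2 1 0 1 (-1) 1)
        (liftVar 0 2 1 (Pi.single 0 1) (viter hV a b c)) := by
  obtain ⟨p, r, g, u, v, hp, h⟩ := h.exists_vprod_eq hV
  obtain ⟨f, hf⟩ := exists_aeval_laurentVar_mul_eq hp g
  -- The roles are interchanged to match the convention that the factor in x₂ is the second family.
  refine ⟨r, v, u, f, fun c => ?_⟩
  obtain ⟨k, G, hAG, hG, hDG⟩ := exists_assoc_data hV a b c
  exact jacobi_of_assoc_of_local (vprod_mem_bddBelowSnd hV a b c) (viter_lowerBdd hV a b c)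
    (fun i => isLowerBdd_vprodRev hV (u i) (v i) c) hAG hG hDG hp (h c) hf

theorem isWeakQuantumVertexAlgebra_vertexMap
    (hloc : ∀ a b : V, PolyLocal (V : Set (EInf W)) V (a : EInf W) b) :
    IsWeakQuantumVertexAlgebra (vertexMap hV) ⟨idInf W, hV.one_mem⟩ := by
  refine ⟨hasVacuum_vertexMap hV, fun a b => ?_⟩
  obtain ⟨r, u, v, f, h⟩ := exists_jacobi_vertexMap hV a b (hloc a b)
  exact ⟨r, u, v, f, fun c => jacobi_of_liftVar (h c)⟩

end WeakQuantum

end VAInf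
end

/-! ### Application to the generated subspace -/

noncomputable section
namespace VAInf

variable {W : Type*} [AddCommGroup W] [Module ℂ W] {U : Set (EInf W)}

/-- The identity is adjoined to `U` before the hull is taken, so that the hull contains it. -/
theorem IsSLocal.isLeast_generated (hU : IsSLocal U) :
    IsLeast (closedSubspaces U) (generated U) :=
  VAInf.isLeast_generated (compatHull_mem_closedSubspaces hU.insert_idInf.isCompatible
    (Set.subset_insert _ _) (Set.mem_insert _ _))

theorem IsSLocal.isClosedCompatible_generated (hU : IsSLocal U) :
    IsClosedCompatible (generated U) where
  compat := (isCompatible_compatHull hU.insert_idInf.isCompatible).mono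
    (hU.isLeast_generated.2 (compatHull_mem_closedSubspaces hU.insert_idInf.isCompatible
      (Set.subset_insert _ _) (Set.mem_insert _ _)))
  closed := hU.isLeast_generated.1.2.1
  one_mem := hU.isLeast_generated.1.2.2.1

end VAInf
end

theorem theorem4p7 {W : Type*} [AddCommGroup W] [Module ℂ W] (U : Set (VAInf.EInf W))
    (hU : VAInf.IsSLocal U) :
    VAInf.IsCompatible U ∧
    IsLeast (VAInf.closedSubspaces U) (VAInf.generated U) ∧
    ∃ (Y : VAInf.generated U →ₗ[ℂ] VertexOperator ℂ (VAInf.generated U))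
      (one : VAInf.generated U),
      (one : VAInf.EInf W) = VAInf.idInf W ∧
      (∀ (a : VAInf.generated U) (n : ℤ) (b : VAInf.generated U),
        (VertexOperator.ncoeff (Y a) n b : VAInf.EInf W)
          = VAInf.nthProd (a : VAInf.EInf W) n (b : VAInf.EInf W)) ∧
      VAInf.IsNonlocalVertexAlgebra Y one ∧
      VAInf.IsWeakQuantumVertexAlgebra Y one ∧
      VAInf.IsModuleAtInfinity Y one (VAInf.generated U).subtype := by
  have hV := hU.isClosedCompatible_generated
  exact ⟨hU.isCompatible, hU.isLeast_generated, VAInf.vertexMap hV, ⟨VAInf.idInf W, hV.one_mem⟩,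
    rfl, VAInf.coe_ncoeff_vertexMap hV, VAInf.isNonlocalVertexAlgebra_vertexMap hV,
    VAInf.isWeakQuantumVertexAlgebra_vertexMap hV fun a b => VAInf.polyLocal_generated hU a.2 b.2,
    VAInf.isModuleAtInfinity_vertexMap hV⟩
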